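/- **Theorem 3.4 ($L^2$-Shapiro's Lemma with coefficients in Banach representations).** Let $X$ be a contractible (i.e. its geometric realization is contractible), locally finite simplicial complex that is pure of dimension $n$, with a coloring of its vertices by $n+1$ colors such that every $n$-simplex has a vertex of every color. Let $G$ be a locally compact (Hausdorff) unimodular group with Haar measure $\mu$, acting simplicially, properly and cocompactly on $X$, preserving the coloring and transitively on the $n$-simplices. Let $\Gamma\le G$ be a countable subgroup that also acts properly and cocompactly on $X$ (so $\Gamma$ is discrete and cocompact in $G$). Let $V$ be a real or complex Banach space and $\pi$ a representation of $\Gamma$ on $V$ by linear isometries. Then $\Gamma$ acting on $G$ by right translations has a fundamental domain $D$ (up to $\mu$-null sets). For any such $D$ let $$\operatorname{Ind}_\Gamma^G(\pi)_{L^2}=\Big\{f:G\to V \;:\; f(gh^{-1})=\pi(h)f(g)\ \ \forall g\in G,\,h\in\Gamma,\ f|_D \text{ Bochner measurable},\ \|f\|^2=\int_D\|f(g)\|_V^2\,d\mu(g)<\infty\Big\},$$ with functions equal almost everywhere identified, and let $G$ act on it by left translation, $(\lambda(g)f)(g')=f(g^{-1}g')$. Then, for every $k\ge 0$, there is a linear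 isomorphism of continuous group cohomology $$H^k(\Gamma,\pi)\;\cong\;H^k\big(G,\lambda\big).$$ Moreover, for a representation $\rho$ of a group $H$ acting simplicially on $X$, let $C^k(X,\rho)$ be the space of functions $\phi$ on ordered $k$-simplices of $X$ that are anti-symmetric under permutation of the vertices and satisfy $\phi(h.\sigma)=\rho(h)\phi(\sigma)$ for all $h \in H$, with differential $(d_k\phi)(v_0,\dots,v_{k+1})=\sum_{i=0}^{k+1}(-1)^i\phi(v_0,\dots,\widehat{v_i},\dots,v_{k+1})$. Then for every $\phi\in C^k(X,\pi)$ and every ordered $k$-simplex $\sigma$ the function $g\mapsto\phi(g^{-1}.\sigma)$ belongs to $\operatorname{Ind}_\Gamma^G(\pi)_{L^2}$, and $$\Phi_k: C^k(X,\pi)\to C^k(X,\lambda),\qquad (\Phi_k\phi)(\sigma)=\big[g\mapsto\phi(g^{-1}.\sigma)\big],$$ is a linear isomorphism for every $k\ge 0$, with $d_k\Phi_k=\Phi_{k+1}d_k$. -/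

import Mathlib

open MeasureTheory

open scoped Pointwise

universe u v w

namespace L2Shapiro

noncomputable section

/-! ### Simplicial complexes, their realizations, and simplicial group actions -/

section Complex

variable {W : Type w} (X : AbstractSimplicialComplex W)

/-- A point of the geometric realization `|X|`, given by its barycentric coordinates. -/
@[ext]
structure Realization where
  /-- the barycentric coordinates -/
  weight : W →₀ ℝ
  nonneg : ∀ x, 0 ≤ weight x
  sum_eq_one : (weight.sum fun _ r => r) = 1
  support_mem : weight.support ∈ X.faces

/-- The weak (coherent) topology of `|X|`: a set is open iff its trace on every closed simplex `s`
is open, where a closed simplex carries the Euclidean topology of its barycentric coordinates. -/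
instance : TopologicalSpace (Realization X) :=
  ⨆ s ∈ X.faces,
    TopologicalSpace.coinduced
      (Subtype.val : {p : Realization X // p.weight.support ⊆ s} → Realization X)
      (TopologicalSpace.induced (fun p (x : W) => p.1.weight x) inferInstance)

/-- Every simplex has at most `n + 1` vertices and is contained in a simplex with exactly
`n + 1` vertices. -/
def IsPure (n : ℕ) : Prop :=
  (∀ s ∈ X.faces, s.card ≤ n + 1) ∧ ∀ s ∈ X.faces, ∃ t ∈ X.faces, s ⊆ t ∧ t.card = n + 1

/-- Every vertex lies in only finitely many simplices. -/
def IsLocallyFinite : Prop :=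
  ∀ x : W, {s ∈ X.faces | x ∈ s}.Finite

/-- The coloring `c` gives every `n`-dimensional simplex a vertex of each of the `n + 1` colors. -/
def IsColoring {n : ℕ} (c : W → Fin (n + 1)) : Prop :=
  ∀ s ∈ X.faces, s.card = n + 1 → ∀ i, ∃ x ∈ s, c x = i

/-- The action of `H` on the vertex set maps simplices to simplices. -/
class SimplicialAction (H : Type*) [Group H] [MulAction H W] : Prop where
  map_mem : ∀ (h : H), ∀ s ∈ X.faces, s.map (MulAction.toPerm h).toEmbedding ∈ X.faces

instance {H : Type*} [Group H] [MulAction H W] [SimplicialAction X H] (Γ : Subgroup H) :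
    SimplicialAction X Γ where
  map_mem h s hs := SimplicialAction.map_mem (X := X) (h : H) s hs

/-- The induced action on the realization: the vertex `h • x` gets the weight of `x`. -/
instance {H : Type*} [Group H] [MulAction H W] [SimplicialAction X H] :
    MulAction H (Realization X) where
  smul h p :=
    { weight := p.weight.equivMapDomain (MulAction.toPerm h)
      nonneg := fun x => by simpa [Finsupp.equivMapDomain_apply] using p.nonneg _
      sum_eq_one := by
        rw [Finsupp.equivMapDomain_eq_mapDomain, Finsupp.sum_mapDomain_index_inj]
        · exact p.sum_eq_one
        · exact (MulAction.toPerm h).injective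
      support_mem := by
        exact SimplicialAction.map_mem h _ p.support_mem }
  one_smul p := by
    ext x
    change p.weight.equivMapDomain (MulAction.toPerm (1 : H)) x = p.weight x
    simp [Finsupp.equivMapDomain_apply]
  mul_smul g h p := by
    ext x
    change p.weight.equivMapDomain (MulAction.toPerm (g * h)) x =
      (p.weight.equivMapDomain (MulAction.toPerm h)).equivMapDomain (MulAction.toPerm g) x
    simp [Finsupp.equivMapDomain_apply, mul_smul]

/-- `H` acts transitively on the `n`-dimensional simplices. -/
def TransitiveOnTop (n : ℕ) (H : Type*) [Group H] [MulAction H W] : Prop :=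
  ∀ s ∈ X.faces, ∀ t ∈ X.faces, s.card = n + 1 → t.card = n + 1 →
    ∃ h : H, s.map (MulAction.toPerm h).toEmbedding = t

/-- The topological group `H` acts on `|X|` properly (in particular continuously) and with compact
quotient. -/
def ActsProperlyCocompactly (H : Type*) [Group H] [TopologicalSpace H] [MulAction H W]
    [SimplicialAction X H] : Prop :=
  ProperSMul H (Realization X) ∧ CompactSpace (MulAction.orbitRel.Quotient H (Realization X))

/-! ### Twisted simplicial cochains -/

/-- An ordered `k`-simplex: an ordering of the `k + 1` distinct vertices of a `k`-simplex. -/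
@[ext]
structure OrderedSimplex (k : ℕ) where
  /-- the list of vertices -/
  vertex : Fin (k + 1) → W
  injective : Function.Injective vertex
  mem : Finset.univ.map ⟨vertex, injective⟩ ∈ X.faces

namespace OrderedSimplex

variable {X} {k : ℕ}

/-- Permute the vertices: `(v₀, …, v_k) ↦ (v_{τ 0}, …, v_{τ k})`. -/
def perm (σ : OrderedSimplex X k) (τ : Equiv.Perm (Fin (k + 1))) : OrderedSimplex X k where
  vertex := σ.vertex ∘ τ
  injective := σ.injective.comp τ.injective
  mem := by
    convert σ.mem using 1
    ext x
    simp only [Finset.mem_map, Finset.mem_univ, true_and, Function.Embedding.coeFn_mk,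
      Function.comp_apply]
    exact ((Equiv.surjective τ).exists (p := fun a => σ.vertex a = x)).symm

/-- Omit the `i`-th vertex. -/
def face (σ : OrderedSimplex X (k + 1)) (i : Fin (k + 2)) : OrderedSimplex X k where
  vertex := σ.vertex ∘ i.succAbove
  injective := σ.injective.comp Fin.succAbove_right_injective
  mem := by
    refine (X.isRelLowerSet_faces σ.mem).2 ?_ (by simp)
    intro x
    simp only [Finset.mem_map, Finset.mem_univ, true_and, Function.Embedding.coeFn_mk,
      Function.comp_apply]
    rintro ⟨j, rfl⟩
    exact ⟨_, rfl⟩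

/-- The action on ordered simplices: `h • (v₀, …, v_k) = (h • v₀, …, h • v_k)`. -/
instance {H : Type*} [Group H] [MulAction H W] [SimplicialAction X H] :
    MulAction H (OrderedSimplex X k) where
  smul h σ :=
    { vertex := fun i => h • σ.vertex i
      injective := (MulAction.injective h).comp σ.injective
      mem := by
        convert SimplicialAction.map_mem h _ σ.mem using 1
        rw [Finset.map_map]
        rfl }
  one_smul σ := OrderedSimplex.ext (funext fun i => one_smul H (σ.vertex i))
  mul_smul g h σ := OrderedSimplex.ext (funext fun i => mul_smul g h (σ.vertex i))

theorem face_smul {H : Type*} [Group H] [MulAction H W] [SimplicialAction X H] (h : H)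
    (σ : OrderedSimplex X (k + 1)) (i : Fin (k + 2)) : (h • σ).face i = h • σ.face i := rfl

theorem perm_mul (σ : OrderedSimplex X k) (τ τ' : Equiv.Perm (Fin (k + 1))) :
    σ.perm (τ * τ') = (σ.perm τ).perm τ' := rfl

end OrderedSimplex

/-- `φ` is anti-symmetric under permutations of the vertices. -/
def IsAntisymmetric {V : Type*} [AddCommGroup V] {k : ℕ} (φ : OrderedSimplex X k → V) : Prop :=
  ∀ (τ : Equiv.Perm (Fin (k + 1))) (σ : OrderedSimplex X k),
    φ (σ.perm τ) = (Equiv.Perm.sign τ : ℤ) • φ σ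

section Cochains

variable {𝕜 : Type*} [CommRing 𝕜] {H : Type*} [Group H] [MulAction H W] [SimplicialAction X H]
  {V : Type*} [AddCommGroup V] [Module 𝕜 V] (ρ : Representation 𝕜 H V)

/-- The cochain space `C^k(X, ρ)`: anti-symmetric functions on ordered `k`-simplices that are
twisted by `ρ`, i.e. `φ (h • σ) = ρ(h) φ(σ)`. -/
def twistedCochains (k : ℕ) : Submodule 𝕜 (OrderedSimplex X k → V) where
  carrier := {φ | IsAntisymmetric X φ ∧ ∀ (h : H) (σ : OrderedSimplex X k), ρ h (φ σ) = φ (h • σ)}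
  zero_mem' := ⟨fun τ σ => by simp, fun h σ => by simp⟩
  add_mem' := by
    rintro φ ψ ⟨h1, h2⟩ ⟨h3, h4⟩
    refine ⟨fun τ σ => ?_, fun h σ => ?_⟩
    · simp [h1 τ σ, h3 τ σ]
    · simp [h2, h4]
  smul_mem' := by
    rintro a φ ⟨h1, h2⟩
    refine ⟨fun τ σ => ?_, fun h σ => ?_⟩
    · simp only [Pi.smul_apply, h1 τ σ]
      rw [smul_comm]
    · simp [h2]

/-- The alternating sum over the faces. -/
def coboundaryFun {k : ℕ} (φ : OrderedSimplex X k → V) (σ : OrderedSimplex X (k + 1)) : V :=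
  ∑ i : Fin (k + 2), (-1 : ℤ) ^ (i : ℕ) • φ (σ.face i)

variable {X}

theorem coboundaryFun_swap {k : ℕ} {φ : OrderedSimplex X k → V} (hφ : IsAntisymmetric X φ)
    (j : Fin (k + 1)) (σ : OrderedSimplex X (k + 1)) :
    coboundaryFun X φ (σ.perm (Equiv.swap j.castSucc j.succ)) = -coboundaryFun X φ σ := by
  set s := Equiv.swap j.castSucc j.succ with hs
  unfold coboundaryFun
  rw [← Finset.sum_neg_distrib, ← Equiv.sum_comp s]
  refine Finset.sum_congr rfl fun i _ => ?_
  by_cases h1 : i = j.castSucc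
  · subst h1
    have h : (σ.perm s).face (s j.castSucc) = σ.face j.castSucc := by
      ext x
      change σ.vertex (s ((s j.castSucc).succAbove x)) = σ.vertex (j.castSucc.succAbove x)
      congr 1
      rw [hs, Equiv.swap_apply_left]
      rcases lt_trichotomy x j with hx | rfl | hx
      · rw [Fin.succAbove_of_castSucc_lt _ _ (by simp [Fin.lt_def]; grind),
          Fin.succAbove_of_castSucc_lt _ _ (by simpa using hx),
          Equiv.swap_apply_of_ne_of_ne] <;> simp [Fin.ext_iff] <;> grind
      · rw [Fin.succAbove_of_castSucc_lt _ _ (by simp),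
          Fin.succAbove_of_le_castSucc _ _ (by simp), Equiv.swap_apply_left]
      · rw [Fin.succAbove_of_le_castSucc _ _ (by simp [Fin.le_def]; grind),
          Fin.succAbove_of_le_castSucc _ _ (by simpa using hx.le),
          Equiv.swap_apply_of_ne_of_ne] <;> simp [Fin.ext_iff] <;> grind
    rw [h, hs, Equiv.swap_apply_left]
    simp [pow_succ]
  by_cases h2 : i = j.succ
  · subst h2
    have h : (σ.perm s).face (s j.succ) = σ.face j.succ := by
      ext x
      change σ.vertex (s ((s j.succ).succAbove x)) = σ.vertex (j.succ.succAbove x)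
      congr 1
      rw [hs, Equiv.swap_apply_right]
      rcases lt_trichotomy x j with hx | rfl | hx
      · rw [Fin.succAbove_of_castSucc_lt _ _ (by simpa using hx),
          Fin.succAbove_of_castSucc_lt j.succ _ (by simp [Fin.lt_def]; grind),
          Equiv.swap_apply_of_ne_of_ne] <;> simp [Fin.ext_iff] <;> grind
      · rw [Fin.succAbove_of_le_castSucc _ _ (by simp),
          Fin.succAbove_of_castSucc_lt x.succ _ (by simp), Equiv.swap_apply_right]
      · rw [Fin.succAbove_of_le_castSucc _ _ (by simpa using hx.le),
          Fin.succAbove_of_le_castSucc j.succ _ (by simp [Fin.le_def]; grind),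
          Equiv.swap_apply_of_ne_of_ne] <;> simp [Fin.ext_iff] <;> grind
    rw [h, hs, Equiv.swap_apply_right]
    simp [pow_succ]
  · have hi : s i = i := Equiv.swap_apply_of_ne_of_ne h1 h2
    rw [hi]
    obtain ⟨a, ha⟩ := Fin.exists_succAbove_eq (Ne.symm h1)
    obtain ⟨b, hb⟩ := Fin.exists_succAbove_eq (Ne.symm h2)
    have hab : a ≠ b := by
      rintro rfl
      exact absurd (ha.symm.trans hb) (by simp [Fin.ext_iff])
    have h : (σ.perm s).face i = (σ.face i).perm (Equiv.swap a b) := by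
      apply OrderedSimplex.ext
      change σ.vertex ∘ (s ∘ i.succAbove) = σ.vertex ∘ (i.succAbove ∘ Equiv.swap a b)
      rw [hs, ← ha, ← hb, (Fin.succAbove_right_injective (p := i)).swap_comp]
    rw [h, hφ, Equiv.Perm.sign_swap hab]
    simp

theorem coboundaryFun_antisymmetric {k : ℕ} {φ : OrderedSimplex X k → V}
    (hφ : IsAntisymmetric X φ) : IsAntisymmetric X (coboundaryFun X φ) := by
  intro τ
  have hτ : τ ∈ Submonoid.closure
      (Set.range fun i : Fin (k + 1) => Equiv.swap i.castSucc i.succ) := by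
    rw [Equiv.Perm.mclosure_swap_castSucc_succ]
    trivial
  induction hτ using Submonoid.closure_induction with
  | mem τ h =>
    obtain ⟨j, rfl⟩ := h
    intro σ
    rw [coboundaryFun_swap hφ, Equiv.Perm.sign_swap (by simp [Fin.ext_iff])]
    simp
  | one => exact fun σ => by simp; rfl
  | mul τ τ' _ _ h h' =>
    intro σ
    rw [OrderedSimplex.perm_mul, h', h, smul_smul, Equiv.Perm.sign_mul, Units.val_mul, mul_comm]

/-- The differential `d_k : C^k(X, ρ) → C^{k+1}(X, ρ)`. -/
def coboundary (k : ℕ) : twistedCochains X ρ k →ₗ[𝕜] twistedCochains X ρ (k + 1) where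
  toFun φ := ⟨coboundaryFun X φ.1, coboundaryFun_antisymmetric φ.2.1, fun h σ => by
    simp only [coboundaryFun, map_sum, map_zsmul, φ.2.2, OrderedSimplex.face_smul]⟩
  map_add' φ ψ := by
    ext σ
    simp [coboundaryFun, Finset.sum_add_distrib]
  map_smul' a φ := by
    ext σ
    simp [coboundaryFun, Finset.smul_sum, smul_comm a]

end Cochains

end Complex

/-! ### The `L²`-induced representation -/

section Induced

variable {𝕜 : Type*} [RCLike 𝕜] {G : Type u} [Group G] {Γ : Subgroup G}
  {V : Type v} [NormedAddCommGroup V] [NormedSpace 𝕜 V]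

/-- An isometric representation, as a continuous-linear representation. -/
def isomRep {H : Type*} [Group H] (π : H →* (V ≃ₗᵢ[𝕜] V)) : ContRepresentation 𝕜 H V :=
  ContRepresentation.ofMonoidHom
    { toFun := fun h => (π h).toContinuousLinearEquiv.toContinuousLinearMap
      map_one' := by ext; simp
      map_mul' := fun g h => by ext; simp }

variable [MeasurableSpace G]

/-- The functions `f : G → V` with `f (g h⁻¹) = π(h) f(g)` for all `g ∈ G`, `h ∈ Γ`, that are
Bochner measurable and square-integrable on the fundamental domain `D`. -/
def indSubmodule (π : Γ →* (V ≃ₗᵢ[𝕜] V)) (μ : Measure G) (D : Set G) :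
    Submodule 𝕜 (G → V) where
  carrier := {f | (∀ (g : G) (h : Γ), f (g * (h : G)⁻¹) = π h (f g)) ∧ MemLp f 2 (μ.restrict D)}
  zero_mem' := ⟨fun g h => by simp, MemLp.zero⟩
  add_mem' := by
    rintro f f' ⟨h1, h2⟩ ⟨h3, h4⟩
    exact ⟨fun g h => by simp [h1, h3], h2.add h4⟩
  smul_mem' := by
    rintro a f ⟨h1, h2⟩
    exact ⟨fun g h => by simp [h1], h2.const_smul a⟩

/-- The elements of `indSubmodule` as a type of its own, to be endowed with the `L²`-seminorm (and
not with the topology of pointwise convergence). -/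
def IndFun (π : Γ →* (V ≃ₗᵢ[𝕜] V)) (μ : Measure G) (D : Set G) : Type (max u v) :=
  ↥(indSubmodule π μ D)

namespace IndFun

variable (π : Γ →* (V ≃ₗᵢ[𝕜] V)) (μ : Measure G) (D : Set G)

instance : AddCommGroup (IndFun π μ D) := inferInstanceAs (AddCommGroup ↥(indSubmodule π μ D))

instance : Module 𝕜 (IndFun π μ D) := inferInstanceAs (Module 𝕜 ↥(indSubmodule π μ D))

variable {π μ D}

/-- The underlying function on `G`. -/
def toFun (f : IndFun π μ D) : G → V := Subtype.val f

theorem equivariant (f : IndFun π μ D) (g : G) (h : Γ) :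
    f.toFun (g * (h : G)⁻¹) = π h (f.toFun g) := (Subtype.property f).1 g h

theorem memLp (f : IndFun π μ D) : MemLp f.toFun 2 (μ.restrict D) := (Subtype.property f).2

/-- The class of `f` in `L²(D; V)`. -/
def toLp : IndFun π μ D →ₗ[𝕜] Lp V 2 (μ.restrict D) where
  toFun f := f.memLp.toLp
  map_add' _ _ := rfl
  map_smul' _ _ := rfl

/-- The seminorm `‖f‖ = (∫_D ‖f(g)‖² dμ(g))^{1/2}`. -/
instance : SeminormedAddCommGroup (IndFun π μ D) :=
  SeminormedAddCommGroup.induced (IndFun π μ D) (Lp V 2 (μ.restrict D)) (toLp (𝕜 := 𝕜))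

instance : NormedSpace 𝕜 (IndFun π μ D) :=
  NormedSpace.induced 𝕜 (IndFun π μ D) (Lp V 2 (μ.restrict D)) (toLp (𝕜 := 𝕜))

theorem norm_eq (f : IndFun π μ D) : ‖f‖ = (eLpNorm f.toFun 2 (μ.restrict D)).toReal :=
  Lp.norm_toLp _ f.memLp

end IndFun

/-- The space `Ind_Γ^G(π)_{L²}`: the functions of `IndFun` modulo those of seminorm `0`, i.e. modulo
equality almost everywhere. -/
abbrev IndL2 (π : Γ →* (V ≃ₗᵢ[𝕜] V)) (μ : Measure G) (D : Set G) : Type (max u v) :=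
  SeparationQuotient (IndFun π μ D)

variable [TopologicalSpace G] [IsTopologicalGroup G] [BorelSpace G]
  {π : Γ →* (V ≃ₗᵢ[𝕜] V)} {μ : Measure G} {D D' : Set G}

theorem eLpNorm_eq_of_equivariant [μ.IsMulRightInvariant] [Countable Γ]
    (hD : IsFundamentalDomain Γ.op D μ) (hD' : IsFundamentalDomain Γ.op D' μ) {f : G → V}
    (hf : ∀ (g : G) (h : Γ), f (g * (h : G)⁻¹) = π h (f g)) :
    eLpNorm f 2 (μ.restrict D) = eLpNorm f 2 (μ.restrict D') := by
  have : Countable Γ.op := Γ.equivOp.symm.injective.countable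
  rw [eLpNorm_eq_lintegral_rpow_enorm_toReal (by simp) (by simp),
    eLpNorm_eq_lintegral_rpow_enorm_toReal (by simp) (by simp)]
  congr 1
  refine hD.setLIntegral_eq hD' _ fun γ x => ?_
  have h := hf x ⟨γ.1.unop⁻¹, Γ.inv_mem γ.2⟩
  simp only [inv_inv] at h
  change ‖f (x * γ.1.unop)‖ₑ ^ _ = _
  rw [h, LinearIsometryEquiv.enorm_map]

theorem aestronglyMeasurable_of_equivariant [μ.IsMulRightInvariant] [Countable Γ]
    (hD : IsFundamentalDomain Γ.op D μ) {f : G → V}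
    (hf : ∀ (g : G) (h : Γ), f (g * (h : G)⁻¹) = π h (f g))
    (hm : AEStronglyMeasurable f (μ.restrict D)) : AEStronglyMeasurable f μ := by
  have : Countable Γ.op := Γ.equivOp.symm.injective.countable
  rw [← hD.sum_restrict, aestronglyMeasurable_sum_measure_iff]
  intro γ
  have hmp := (measurePreserving_smul γ⁻¹ μ).restrict_preimage_emb
    (measurableEmbedding_const_smul γ⁻¹) D
  rw [Set.preimage_smul_inv] at hmp
  have hc := (π ⟨γ.1.unop⁻¹, Γ.inv_mem γ.2⟩).continuous.comp_aestronglyMeasurable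
    (hm.comp_measurePreserving hmp)
  convert hc using 1
  funext x
  have h := hf (γ⁻¹ • x) ⟨γ.1.unop⁻¹, Γ.inv_mem γ.2⟩
  rw [Function.comp_apply, ← h]
  change f x = f (x * γ.1.unop⁻¹ * (γ.1.unop⁻¹)⁻¹)
  simp

theorem measurePreserving_translate [μ.IsMulLeftInvariant] (g : G) :
    MeasurePreserving (fun x => g⁻¹ * x) (μ.restrict D) (μ.restrict (g⁻¹ • D)) := by
  have h := (measurePreserving_smul g⁻¹ μ).restrict_preimage_emb
    (measurableEmbedding_const_smul g⁻¹) (g⁻¹ • D)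
  rw [Set.preimage_smul, inv_inv, smul_inv_smul] at h
  exact h

variable [μ.IsMulLeftInvariant] [μ.IsMulRightInvariant] [Countable Γ]

theorem translate_mem (hD : IsFundamentalDomain Γ.op D μ) (g : G) {f : G → V}
    (hf : f ∈ indSubmodule π μ D) : (fun x => f (g⁻¹ * x)) ∈ indSubmodule π μ D := by
  refine ⟨fun x h => by simp only [← mul_assoc, hf.1], ?_⟩
  refine MemLp.comp_measurePreserving (g := f) ?_ (measurePreserving_translate g)
  refine ⟨(aestronglyMeasurable_of_equivariant hD hf.1 hf.2.1).restrict, ?_⟩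
  rw [← eLpNorm_eq_of_equivariant hD (hD.smul_of_comm g⁻¹) hf.1]
  exact hf.2.2

/-- Left translation by `g`: `f ↦ (x ↦ f (g⁻¹ x))`. -/
def translate (hD : IsFundamentalDomain Γ.op D μ) (g : G) : IndFun π μ D →ₗᵢ[𝕜] IndFun π μ D where
  toFun f := ⟨fun x => f.toFun (g⁻¹ * x), translate_mem hD g f.2⟩
  map_add' _ _ := rfl
  map_smul' _ _ := rfl
  norm_map' f := by
    rw [IndFun.norm_eq, IndFun.norm_eq,
      eLpNorm_eq_of_equivariant hD (hD.smul_of_comm g⁻¹) f.equivariant]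
    congr 1
    exact eLpNorm_comp_measurePreserving
      (aestronglyMeasurable_of_equivariant hD f.equivariant f.memLp.1).restrict
      (measurePreserving_translate g)

/-- The induced representation of `G` on `Ind_Γ^G(π)_{L²}` by left translation:
`(λ(g) f)(x) = f (g⁻¹ x)`. -/
def indRep (π : Γ →* (V ≃ₗᵢ[𝕜] V)) (hD : IsFundamentalDomain Γ.op D μ) :
    ContRepresentation 𝕜 G (IndL2 π μ D) :=
  ContRepresentation.ofMonoidHom
    { toFun := fun g => SeparationQuotient.liftCLM
        ((SeparationQuotient.mkCLM 𝕜 (IndFun π μ D)).comp (translate hD g).toContinuousLinearMap)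
        fun _ _ h => SeparationQuotient.mk_eq_mk.2 (h.map (translate hD g).continuous)
      map_one' := by
        ext x
        obtain ⟨f, rfl⟩ := SeparationQuotient.surjective_mk x
        change SeparationQuotient.mk (translate hD 1 f) = SeparationQuotient.mk f
        congr 1
        refine Subtype.ext (funext fun x => ?_)
        change f.toFun (1⁻¹ * x) = f.toFun x
        simp
      map_mul' := fun g h => by
        ext x
        obtain ⟨f, rfl⟩ := SeparationQuotient.surjective_mk x
        change SeparationQuotient.mk (translate hD (g * h) f) =
          SeparationQuotient.mk (translate hD g (translate hD h f))
        congr 1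
        refine Subtype.ext (funext fun x => ?_)
        change f.toFun ((g * h)⁻¹ * x) = f.toFun (h⁻¹ * (g⁻¹ * x))
        rw [mul_inv_rev, mul_assoc] }

theorem indRep_mk (hD : IsFundamentalDomain Γ.op D μ) (g : G) (f : IndFun π μ D) :
    indRep π hD g (SeparationQuotient.mk f) = SeparationQuotient.mk (translate hD g f) := rfl

end Induced

end

end L2Shapiro

open L2Shapiro

namespace L2Shapiro

/-! ### Double complexes with exact rows and columns -/

section DoubleComplex

/-! For a group `H` acting properly and cocompactly on `X`, continuous cohomology can be read off
from equivariant simplicial cochains. Once this is known for `Γ` with coefficients `π` and for `G`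
with coefficients `λ`, it remains to match two cochain complexes on `X`, and this can be done degree
by degree through `φ ↦ [g ↦ φ(g⁻¹ • σ)]`.

The first half uses a double complex `K^{p,q}` of equivariant functions of `p` group elements and of
a tuple of `q` vertices of a common simplex, with repetitions allowed. Both directions are
augmented: `q = 0` gives the homogeneous group cochains, `p = 0` the equivariant simplicial
cochains, and the corner `K^{0,0}` is set to zero. If everything except these two edges is exact,
then the edges have the same cohomology (`nonempty_cohomology_equiv_of_exact`).

For `p ≥ 1`, exactness in the simplicial direction comes from a linear contraction of the augmented
tuple complex of `X` (`exists_contraction`). It is not equivariant, but conjugating it by the first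
group argument makes the resulting operator on cochains equivariant, and openness of the vertex
stabilizers keeps it continuous (`mem_imVert_of_vertBd_eq_zero`). The contraction exists because
contractibility of the realization makes the tuple complex exact (`exists_bd_eq`): subdivide a cycle
until it is small, then push it along the contraction in short time steps, replacing points by
nearby vertices.

For `q ≥ 1`, exactness in the group direction comes from averaging the first group argument over a
compact open coset of the stabilizer of the tuple (`mem_imHor_of_horBd_eq_zero`). This is a Bochner
integral, hence the need for complete coefficients, and for `completeSpace_indL2` on the side of
`G`.

The second half is `exists_equivariantFunctions_equiv`. The function `g ↦ φ(g⁻¹ • ω)` is bounded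
because `Γ` has finitely many orbits and acts by isometries, and it is square-integrable because a
fundamental domain has finite measure. Conversely, let `ψ` be `G`-equivariant with values in the
induced space. A representative of `ψ(ω)` is almost everywhere invariant under the compact open
stabilizer of `ω`, hence almost everywhere constant there, and that constant is `φ(ω)`. The same
lemma applies to tuples, for cohomology, and to ordered simplices, for the maps `Φ_k`. -/

/-- A surjective linear map `f : M → N`, together with submodules `A ≤ M` and `B ≤ N` such that
`f x ∈ B ↔ x ∈ A`, induces an isomorphism `M ⧸ A ≃ N ⧸ B`. -/
theorem nonempty_quotient_equiv {R M N : Type*} [Ring R] [AddCommGroup M] [Module R M]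
    [AddCommGroup N] [Module R N] (f : M →ₗ[R] N) (hf : Function.Surjective f)
    (A : Submodule R M) (B : Submodule R N) (h : ∀ x, f x ∈ B ↔ x ∈ A) :
    Nonempty ((M ⧸ A) ≃ₗ[R] (N ⧸ B)) := by
  have hker : LinearMap.ker (B.mkQ ∘ₗ f) = A := by
    ext x
    simp [h]
  exact ⟨(Submodule.quotEquivOfEq _ _ hker.symm).trans
    ((B.mkQ ∘ₗ f).quotKerEquivOfSurjective ((Submodule.mkQ_surjective B).comp hf))⟩

/-- The homology `ker g / im f` at the middle term of a complex `M₁ → M₂ → M₃`. -/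
def MidHomology {R M₁ M₂ M₃ : Type*} [Ring R] [AddCommGroup M₁] [Module R M₁] [AddCommGroup M₂]
    [Module R M₂] [AddCommGroup M₃] [Module R M₃] (f : M₁ →ₗ[R] M₂) (g : M₂ →ₗ[R] M₃) : Type _ :=
  LinearMap.ker g ⧸ (LinearMap.range f).submoduleOf (LinearMap.ker g)

section

variable {R M₁ M₂ M₃ : Type*} [Ring R] [AddCommGroup M₁] [Module R M₁] [AddCommGroup M₂]
    [Module R M₂] [AddCommGroup M₃] [Module R M₃] (f : M₁ →ₗ[R] M₂) (g : M₂ →ₗ[R] M₃)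

instance : AddCommGroup (MidHomology f g) :=
  inferInstanceAs (AddCommGroup (LinearMap.ker g ⧸ (LinearMap.range f).submoduleOf _))

instance : Module R (MidHomology f g) :=
  inferInstanceAs (Module R (LinearMap.ker g ⧸ (LinearMap.range f).submoduleOf _))

end

variable {R : Type*} [Ring R] {K : ℕ → ℕ → Type*} [∀ p q, AddCommGroup (K p q)]
  [∀ p q, Module R (K p q)] (dh : ∀ p q, K p q →ₗ[R] K (p + 1) q)
  (dv : ∀ p q, K p q →ₗ[R] K p (q + 1))

/-- The image of the incoming horizontal differential. -/
def imHor : ∀ p q, Submodule R (K p q)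
  | 0, _ => ⊥
  | p + 1, q => LinearMap.range (dh p q)

/-- The image of the incoming vertical differential. -/
def imVert : ∀ p q, Submodule R (K p q)
  | _, 0 => ⊥
  | p, q + 1 => LinearMap.range (dv p q)

/-- The elements killed by the composition of both differentials. -/
def diagKer (p q : ℕ) : Submodule R (K p q) := LinearMap.ker (dv (p + 1) q ∘ₗ dh p q)

variable {dh dv}

/-- Both quotients are identified with `(ker dh ∩ ker dv) / im (dv ∘ dh)` at position `(p + 1, q +
1)`, one through `dh` and the other through `dv`. Exactness gives surjectivity onto the common
kernel and identifies what is killed. -/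
theorem nonempty_antidiagonal_step
    (comm : ∀ p q x, dv (p + 1) q (dh p q x) = dh p (q + 1) (dv p q x))
    (hh : ∀ p q x, dh (p + 1) q (dh p q x) = 0) (vv : ∀ p q x, dv p (q + 1) (dv p q x) = 0)
    (hcol : ∀ p q x, dh p (q + 1) x = 0 → x ∈ imHor dh p (q + 1))
    (hrow : ∀ p q x, dv (p + 1) q x = 0 → x ∈ imVert dv (p + 1) q) (p q : ℕ) :
    Nonempty ((diagKer dh dv p (q + 1) ⧸
        (imHor dh p (q + 1) ⊔ imVert dv p (q + 1)).submoduleOf (diagKer dh dv p (q + 1))) ≃ₗ[R]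
      (diagKer dh dv (p + 1) q ⧸
        (imHor dh (p + 1) q ⊔ imVert dv (p + 1) q).submoduleOf (diagKer dh dv (p + 1) q))) := by
  have himh : ∀ p q x, x ∈ imHor dh p q → dh p q x = 0 := by
    rintro (_ | p) q x hx
    · rw [show x = 0 from hx, map_zero]
    · obtain ⟨y, rfl⟩ := hx
      exact hh _ _ _
  have himv : ∀ p q x, x ∈ imVert dv p q → dv p q x = 0 := by
    rintro p (_ | q) x hx
    · rw [show x = 0 from hx, map_zero]
    · obtain ⟨y, rfl⟩ := hx
      exact vv _ _ _
  let N : Submodule R (K (p + 1) (q + 1)) :=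
    LinearMap.ker (dh (p + 1) (q + 1)) ⊓ LinearMap.ker (dv (p + 1) (q + 1))
  let B : Submodule R N := (LinearMap.range (dv (p + 1) q ∘ₗ dh p q)).submoduleOf N
  let f : diagKer dh dv p (q + 1) →ₗ[R] N :=
    LinearMap.codRestrict N (dh p (q + 1) ∘ₗ Submodule.subtype _) fun x => ⟨hh _ _ _, x.2⟩
  let g : diagKer dh dv (p + 1) q →ₗ[R] N :=
    LinearMap.codRestrict N (dv (p + 1) q ∘ₗ Submodule.subtype _) fun x =>
      ⟨(comm _ _ _).symm.trans x.2, vv _ _ _⟩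
  have hf : Function.Surjective f := by
    rintro ⟨y, hy1, hy2⟩
    obtain ⟨x, rfl⟩ := hcol _ _ _ hy1
    exact ⟨⟨x, hy2⟩, rfl⟩
  have hg : Function.Surjective g := by
    rintro ⟨y, hy1, hy2⟩
    obtain ⟨x, rfl⟩ := hrow _ _ _ hy2
    exact ⟨⟨x, (comm _ _ _).trans hy1⟩, rfl⟩
  obtain ⟨e⟩ := nonempty_quotient_equiv f hf
    ((imHor dh p (q + 1) ⊔ imVert dv p (q + 1)).submoduleOf (diagKer dh dv p (q + 1))) B (by
      rintro ⟨x, hx⟩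
      simp only [Submodule.submoduleOf, Submodule.mem_comap, Submodule.subtype_apply, B]
      constructor
      · rintro ⟨m, hm⟩
        have hm' : dv (p + 1) q (dh p q m) = dh p (q + 1) x := hm
        rw [comm] at hm'
        rw [← sub_add_cancel x (dv p q m)]
        exact Submodule.add_mem_sup (hcol _ _ _ (by rw [map_sub, hm', sub_self])) ⟨m, rfl⟩
      · intro h
        obtain ⟨a, ha, b, ⟨m, rfl⟩, rfl⟩ := Submodule.mem_sup.1 h
        refine ⟨m, ?_⟩
        change dv (p + 1) q (dh p q m) = dh p (q + 1) (a + dv p q m)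
        rw [comm, map_add, himh _ _ _ ha, zero_add])
  obtain ⟨e'⟩ := nonempty_quotient_equiv g hg
    ((imHor dh (p + 1) q ⊔ imVert dv (p + 1) q).submoduleOf (diagKer dh dv (p + 1) q)) B (by
      rintro ⟨x, hx⟩
      simp only [Submodule.submoduleOf, Submodule.mem_comap, Submodule.subtype_apply, B]
      constructor
      · rintro ⟨m, hm⟩
        have hm' : dv (p + 1) q (dh p q m) = dv (p + 1) q x := hm
        rw [← add_sub_cancel (dh p q m) x]
        exact Submodule.add_mem_sup ⟨m, rfl⟩ (hrow _ _ _ (by rw [map_sub, hm', sub_self]))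
      · intro h
        obtain ⟨a, ⟨m, rfl⟩, b, hb, rfl⟩ := Submodule.mem_sup.1 h
        refine ⟨m, ?_⟩
        change dv (p + 1) q (dh p q m) = dv (p + 1) q (dh p q m + b)
        rw [map_add, himv _ _ _ hb, add_zero])
  exact ⟨e.trans e'.symm⟩

/-- If all columns except the `0`-th one and all rows except the `0`-th one of a double complex are
exact, then the `0`-th row and the `0`-th column have isomorphic cohomology. -/
theorem nonempty_cohomology_equiv_of_exact
    (comm : ∀ p q x, dv (p + 1) q (dh p q x) = dh p (q + 1) (dv p q x))
    (hh : ∀ p q x, dh (p + 1) q (dh p q x) = 0) (vv : ∀ p q x, dv p (q + 1) (dv p q x) = 0)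
    (hcol : ∀ p q x, dh p (q + 1) x = 0 → x ∈ imHor dh p (q + 1))
    (hrow : ∀ p q x, dv (p + 1) q x = 0 → x ∈ imVert dv (p + 1) q) (n : ℕ) :
    Nonempty (MidHomology (dv 0 n) (dv 0 (n + 1)) ≃ₗ[R] MidHomology (dh n 0) (dh (n + 1) 0)) := by
  have key : ∀ q p, Nonempty ((diagKer dh dv p q ⧸
        (imHor dh p q ⊔ imVert dv p q).submoduleOf (diagKer dh dv p q)) ≃ₗ[R]
      (diagKer dh dv (q + p) 0 ⧸
        (imHor dh (q + p) 0 ⊔ imVert dv (q + p) 0).submoduleOf (diagKer dh dv (q + p) 0))) := by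
    intro q
    induction q with
    | zero => intro p; rw [Nat.zero_add]; exact ⟨LinearEquiv.refl _ _⟩
    | succ q ih =>
      intro p
      obtain ⟨e⟩ := nonempty_antidiagonal_step comm hh vv hcol hrow p q
      obtain ⟨e'⟩ := ih (p + 1)
      rw [show q + 1 + p = q + (p + 1) by ring]
      exact ⟨e.trans e'⟩
  have h := key (n + 1) 0
  -- On the edge `p = 0` the incoming image is `⊥`, so exactness says that `dh` is injective there,
  -- and the diagonal kernel collapses to `ker dv`. The other edge is symmetric.
  have h1 : diagKer dh dv 0 (n + 1) = LinearMap.ker (dv 0 (n + 1)) := by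
    ext x
    change dv _ _ (dh _ _ x) = 0 ↔ dv _ _ x = 0
    rw [comm]
    exact ⟨fun h => hcol _ _ _ h, fun h => by rw [h, map_zero]⟩
  have h2 : diagKer dh dv (n + 1) 0 = LinearMap.ker (dh (n + 1) 0) := by
    ext x
    change dv _ _ (dh _ _ x) = 0 ↔ dh _ _ x = 0
    exact ⟨fun h => hrow _ _ _ h, fun h => by rw [h, map_zero]⟩
  have h3 : imHor dh 0 (n + 1) ⊔ imVert dv 0 (n + 1) = LinearMap.range (dv 0 n) := bot_sup_eq _
  have h4 : imHor dh (n + 1) 0 ⊔ imVert dv (n + 1) 0 = LinearMap.range (dh n 0) := sup_bot_eq _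
  rw [h1, h3] at h
  change Nonempty (_ ≃ₗ[R] (diagKer dh dv (n + 1) 0 ⧸
    (imHor dh (n + 1) 0 ⊔ imVert dv (n + 1) 0).submoduleOf (diagKer dh dv (n + 1) 0))) at h
  rw [h2, h4] at h
  exact h

end DoubleComplex


/-! ### The augmented chain complex of tuples -/

section TupleChain

variable (R : Type*) [CommRing R] {T T' : Type*}

/-- Formal linear combinations of tuples of elements of `T`. The empty tuple spans the augmentation
degree. -/
abbrev TupleChain (T : Type*) := List T →₀ R

namespace TupleChain

/-- Prepend `x` to all tuples of a chain. -/
noncomputable def cons (x : T) : TupleChain R T →ₗ[R] TupleChain R T :=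
  Finsupp.lmapDomain R R (List.cons x)

/-- Apply `f` to all entries of the tuples of a chain. -/
noncomputable def map (f : T → T') : TupleChain R T →ₗ[R] TupleChain R T' :=
  Finsupp.lmapDomain R R (List.map f)

/-- The boundary of a tuple. -/
noncomputable def bdList : List T → TupleChain R T
  | [] => 0
  | x :: l => Finsupp.single l 1 - cons R x (bdList l)

/-- The boundary of a chain of tuples. -/
noncomputable def bd : TupleChain R T →ₗ[R] TupleChain R T :=
  Finsupp.linearCombination R (bdList R)

variable {R}

@[simp]
theorem cons_single (x : T) (l : List T) (a : R) :
    cons R x (Finsupp.single l a) = Finsupp.single (x :: l) a := Finsupp.mapDomain_single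

@[simp]
theorem map_single (f : T → T') (l : List T) (a : R) :
    map R f (Finsupp.single l a) = Finsupp.single (l.map f) a := Finsupp.mapDomain_single

theorem bd_single (l : List T) : bd R (Finsupp.single l 1) = bdList R l := by
  simp [bd]

theorem map_cons (f : T → T') (x : T) (c : TupleChain R T) :
    map R f (cons R x c) = cons R (f x) (map R f c) := by
  induction c using Finsupp.induction_linear with
  | zero => simp
  | add c d hc hd => simp only [map_add, hc, hd]
  | single l a => simp

theorem map_map {T'' : Type*} (g : T' → T'') (f : T → T') (c : TupleChain R T) :
    map R g (map R f c) = map R (g ∘ f) c := by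
  induction c using Finsupp.induction_linear with
  | zero => simp
  | add c d hc hd => simp only [map_add, hc, hd]
  | single l a => simp

/-- Coning with a fixed point is a contracting homotopy. Because the empty tuple is part of the
complex, no exception is needed in the lowest degree. -/
theorem bd_cons (x : T) (c : TupleChain R T) : bd R (cons R x c) = c - cons R x (bd R c) := by
  induction c using Finsupp.induction_linear with
  | zero => simp
  | add c d hc hd => simp only [map_add, hc, hd]; abel
  | single l a =>
    rw [← mul_one a, ← smul_eq_mul, ← Finsupp.smul_single]
    simp only [map_smul, cons_single, bd_single, bdList, smul_sub]

theorem bd_bd (c : TupleChain R T) : bd R (bd R c) = 0 := by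
  induction c using Finsupp.induction_linear with
  | zero => simp
  | add c d hc hd => simp only [map_add, hc, hd, add_zero]
  | single l a =>
    rw [← mul_one a, ← smul_eq_mul, ← Finsupp.smul_single]
    simp only [map_smul, bd_single]
    suffices bd R (bdList R l) = 0 by rw [this, smul_zero]
    induction l with
    | nil => simp [bdList]
    | cons x l ih => simp [bdList, bd_cons, bd_single, ih]

theorem bd_map (f : T → T') (c : TupleChain R T) : bd R (map R f c) = map R f (bd R c) := by
  induction c using Finsupp.induction_linear with
  | zero => simp
  | add c d hc hd => simp only [map_add, hc, hd]
  | single l a =>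
    rw [← mul_one a, ← smul_eq_mul, ← Finsupp.smul_single]
    simp only [map_smul, bd_single, map_single]
    congr 1
    induction l with
    | nil => simp [bdList]
    | cons x l ih => simp [bdList, map_cons, ih]

theorem mem_supported_of_forall {S : Set (List T)} (φ : List T → TupleChain R T')
    {S' : Set (List T')} (h : ∀ l ∈ S, φ l ∈ Finsupp.supported R R S') {c : TupleChain R T}
    (hc : c ∈ Finsupp.supported R R S) :
    Finsupp.linearCombination R φ c ∈ Finsupp.supported R R S' := by
  rw [Finsupp.linearCombination_apply]
  exact Submodule.sum_mem _ fun l hl => Submodule.smul_mem _ _ (h l (hc hl))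

theorem map_mem_supported {S : Set (List T)} {S' : Set (List T')}
    {F : TupleChain R T →ₗ[R] TupleChain R T'}
    (h : ∀ l ∈ S, F (Finsupp.single l 1) ∈ Finsupp.supported R R S') {c : TupleChain R T}
    (hc : c ∈ Finsupp.supported R R S) : F c ∈ Finsupp.supported R R S' := by
  have : F = Finsupp.linearCombination R fun l => F (Finsupp.single l 1) := by
    ext; simp
  rw [this]
  exact mem_supported_of_forall _ h hc

theorem cons_mem_supported {S S' : Set (List T)} {x : T} (h : ∀ l ∈ S, x :: l ∈ S')
    {c : TupleChain R T} (hc : c ∈ Finsupp.supported R R S) :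
    cons R x c ∈ Finsupp.supported R R S' :=
  map_mem_supported (fun l hl => by
    rw [cons_single]; exact Finsupp.single_mem_supported R 1 (h l hl)) hc

/-- The length drop feeds inductions on length, and the sublist relation transports every condition
on entries to the boundary. -/
theorem bdList_mem_supported (l : List T) :
    bdList R l ∈ Finsupp.supported R R {l' | l'.Sublist l ∧ l'.length + 1 = l.length} := by
  induction l with
  | nil => exact Submodule.zero_mem _
  | cons x l ih =>
    refine Submodule.sub_mem _ (Finsupp.single_mem_supported R 1 ⟨by simp, by simp⟩)
      (cons_mem_supported ?_ ih)
    rintro l' ⟨h1, h2⟩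
    exact ⟨h1.cons_cons x, by simp [h2]⟩

/-- The prism operator, a chain homotopy between `map f` and `map g`. -/
noncomputable def prismList (f g : T → T') : List T → TupleChain R T'
  | [] => 0
  | x :: l => Finsupp.single (f x :: g x :: l.map g) 1 - cons R (f x) (prismList f g l)

/-- Since the prism is built by coning with `f x`, the cone formula reduces the identity for `x ::
l` to `cons (f x)` applied to the identity for `l`. -/
theorem bd_prism (f g : T → T') (c : TupleChain R T) :
    bd R (Finsupp.linearCombination R (prismList f g) c) +
      Finsupp.linearCombination R (prismList f g) (bd R c) = map R g c - map R f c := by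
  set P := Finsupp.linearCombination R (prismList (R := R) f g) with hP
  have hcons : ∀ x c, P (cons R x c) =
      cons R (f x) (cons R (g x) (map R g c)) - cons R (f x) (P c) := by
    intro x c
    induction c using Finsupp.induction_linear with
    | zero => simp
    | add c d hc hd => simp only [map_add, hc, hd]; abel
    | single l a =>
      rw [← mul_one a, ← smul_eq_mul, ← Finsupp.smul_single]
      simp [hP, prismList, smul_sub]
  induction c using Finsupp.induction_linear with
  | zero => simp
  | add c d hc hd =>
    simp only [map_add]
    rw [add_add_add_comm, hc, hd]; abel
  | single l a =>
    rw [← mul_one a, ← smul_eq_mul, ← Finsupp.smul_single]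
    simp only [map_smul, ← smul_add, ← smul_sub]
    congr 1
    induction l with
    | nil => simp [hP, prismList, bd_single, bdList]
    | cons x l ih =>
      rw [← cons_single, hcons, bd_cons, map_sub, map_sub, bd_cons, bd_cons, bd_cons, hcons,
        map_cons, map_cons, bd_map]
      have := congrArg (cons R (f x)) ih
      simp only [map_add, map_sub] at this ⊢
      rw [← sub_eq_zero] at this ⊢
      rw [← this]
      abel

theorem prismList_mem_supported (f g : T → T') (l : List T) :
    prismList f g l ∈ Finsupp.supported R R {l' | ∀ y ∈ l', ∃ x ∈ l, y = f x ∨ y = g x} := by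
  induction l with
  | nil => exact Submodule.zero_mem _
  | cons x l ih =>
    refine Submodule.sub_mem _ (Finsupp.single_mem_supported R 1 ?_) (cons_mem_supported ?_ ih)
    · intro y hy
      simp only [List.mem_cons, List.mem_map] at hy
      rcases hy with rfl | rfl | ⟨z, hz, rfl⟩
      · exact ⟨x, by simp⟩
      · exact ⟨x, by simp⟩
      · exact ⟨z, by simp [hz]⟩
    · intro l' hl' y hy
      rcases List.mem_cons.1 hy with rfl | hy
      · exact ⟨x, by simp⟩
      · obtain ⟨z, hz, h⟩ := hl' y hy
        exact ⟨z, by simp [hz], h⟩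

/-! ### Barycentric subdivision -/

/-- The chain homotopy between the identity and the barycentric subdivision with respect to a
choice `b l` of a barycentre of every tuple `l`. -/
noncomputable def baryList (b : List T → T) (l : List T) : TupleChain R T :=
  if l = [] then 0 else cons R (b l) (Finsupp.single l 1 -
    ∑ l' ∈ (bdList R l).support.attach, bdList R l l'.1 • baryList b l'.1)
termination_by l.length
decreasing_by
  have := (bdList_mem_supported l l'.2).2
  omega

/-- The linear extension of `baryList`. -/
noncomputable def bary (b : List T → T) : TupleChain R T →ₗ[R] TupleChain R T :=
  Finsupp.linearCombination R (baryList b)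

theorem bary_single (b : List T → T) {l : List T} (hl : l ≠ []) :
    bary b (Finsupp.single l (1 : R)) =
      cons R (b l) (Finsupp.single l 1 - bary b (bd R (Finsupp.single l 1))) := by
  rw [bd_single, bary, Finsupp.linearCombination_single, one_smul, baryList, if_neg hl,
    Finsupp.linearCombination_apply, Finsupp.sum,
    Finset.sum_attach (bdList R l).support (fun l' => bdList R l l' • baryList b l')]

theorem bary_nil (b : List T → T) : bary b (Finsupp.single [] (1 : R)) = 0 := by
  rw [bary, Finsupp.linearCombination_single, baryList, if_pos rfl, smul_zero]

/-- Barycentric subdivision. -/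
noncomputable def sd (b : List T → T) : TupleChain R T →ₗ[R] TupleChain R T :=
  LinearMap.id - bd R ∘ₗ bary b - bary b ∘ₗ bd R

theorem sd_apply (b : List T → T) (c : TupleChain R T) :
    sd b c = c - bd R (bary b c) - bary b (bd R c) := rfl

/-- Although `sd` is defined through the homotopy `bary`, it obeys the usual recursion: cone the
subdivided boundary from the barycentre. All size and support estimates rest on this. -/
theorem sd_single (b : List T → T) {l : List T} (hl : l ≠ []) :
    sd b (Finsupp.single l (1 : R)) = cons R (b l) (sd b (bd R (Finsupp.single l 1))) := by
  rw [sd_apply, sd_apply, bary_single b hl, bd_cons, bd_bd, map_zero, map_sub, sub_zero]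
  abel

theorem sd_nil (b : List T → T) : sd b (Finsupp.single [] (1 : R)) = Finsupp.single [] 1 := by
  rw [sd_apply, bary_nil, bd_single, bdList]
  simp

theorem bary_mem_supported (b : List T → T) (A : Set T)
    (hA : ∀ l ≠ [], (∀ x ∈ l, x ∈ A) → b l ∈ A) (l : List T) (hl : ∀ x ∈ l, x ∈ A) :
    bary b (Finsupp.single l (1 : R)) ∈ Finsupp.supported R R {l | ∀ x ∈ l, x ∈ A} := by
  induction hn : l.length using Nat.strong_induction_on generalizing l with
  | _ n ih =>
    by_cases h0 : l = []
    · rw [h0, bary_nil]; exact Submodule.zero_mem _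
    rw [bary_single b h0, bd_single]
    refine cons_mem_supported (S := {l | ∀ x ∈ l, x ∈ A}) ?_
      (Submodule.sub_mem _ (Finsupp.single_mem_supported R 1 hl)
        (map_mem_supported ?_ (bdList_mem_supported l)))
    · intro l' hl' x hx
      rcases List.mem_cons.1 hx with rfl | hx
      · exact hA l h0 hl
      · exact hl' x hx
    · rintro l' ⟨h1, h2⟩
      exact ih _ (by omega) l' (fun x hx => hl x (h1.subset hx)) rfl

theorem sd_mem_supported (b : List T → T) (A : Set T)
    (hA : ∀ l ≠ [], (∀ x ∈ l, x ∈ A) → b l ∈ A) (l : List T) (hl : ∀ x ∈ l, x ∈ A) :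
    sd b (Finsupp.single l (1 : R)) ∈
      Finsupp.supported R R {l' | l'.length = l.length ∧ ∀ x ∈ l', x ∈ A} := by
  induction hn : l.length using Nat.strong_induction_on generalizing l with
  | _ n ih =>
    by_cases h0 : l = []
    · subst h0
      rw [sd_nil]; exact Finsupp.single_mem_supported R 1 ⟨by simpa using hn, by simp⟩
    rw [sd_single b h0, bd_single]
    refine cons_mem_supported (S := {l' | l'.length + 1 = n ∧ ∀ x ∈ l', x ∈ A}) ?_
      (map_mem_supported ?_ (bdList_mem_supported l))
    · rintro l' ⟨h1, h2⟩
      refine ⟨by simp [h1], fun x hx => ?_⟩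
      rcases List.mem_cons.1 hx with rfl | hx
      · exact hA l h0 hl
      · exact h2 x hx
    · rintro l' ⟨h1, h2⟩
      refine Finsupp.supported_mono ?_
        (ih _ (by omega) l' (fun x hx => hl x (h1.subset hx)) rfl)
      rintro l'' ⟨h3, h4⟩
      exact ⟨by omega, h4⟩

end TupleChain

end TupleChain


/-! ### Small tuples of points of simplices -/

section Mesh

variable {W : Type w}

/-- The closed simplex spanned by `s`, in barycentric coordinates. -/
def simplexPoints (s : Finset W) : Set (W →₀ ℝ) :=
  {p | (∀ x, 0 ≤ p x) ∧ ∑ x ∈ s, p x = 1 ∧ ∀ x ∉ s, p x = 0}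

/-- The barycentre of a tuple of points. -/
noncomputable def barycentre (l : List (W →₀ ℝ)) : W →₀ ℝ := (l.length : ℝ)⁻¹ • l.sum

theorem barycentre_apply (l : List (W →₀ ℝ)) (x : W) :
    barycentre l x = (l.length : ℝ)⁻¹ * (l.map fun p => p x).sum := by
  rw [barycentre, Finsupp.smul_apply, smul_eq_mul]
  congr 1
  exact map_list_sum (Finsupp.applyAddHom x) l

theorem barycentre_mem_simplexPoints {s : Finset W} {l : List (W →₀ ℝ)} (h0 : l ≠ [])
    (hl : ∀ p ∈ l, p ∈ simplexPoints s) : barycentre l ∈ simplexPoints s := by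
  have hlen : (l.length : ℝ) ≠ 0 := by simpa using h0
  refine ⟨fun x => ?_, ?_, fun x hx => ?_⟩
  · rw [barycentre_apply]
    refine mul_nonneg (by positivity) (List.sum_nonneg ?_)
    simp only [List.mem_map]
    rintro _ ⟨p, hp, rfl⟩
    exact (hl p hp).1 x
  · simp only [barycentre_apply]
    rw [← Finset.mul_sum]
    have : ∑ x ∈ s, (l.map fun p => p x).sum = (l.map fun p => ∑ x ∈ s, p x).sum := by
      clear hlen h0 hl
      induction l with
      | nil => simp
      | cons p l ih => simp [Finset.sum_add_distrib, ih]
    rw [this, List.map_congr_left (g := fun _ => (1 : ℝ)) fun p hp => (hl p hp).2.1]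
    simp [hlen]
  · rw [barycentre_apply, List.map_congr_left (g := fun _ => (0 : ℝ)) fun p hp => (hl p hp).2.2 x hx]
    simp

/-- The points all of whose coordinates lie between the extreme coordinates of the points
of `l`. -/
def boxHull (l : List (W →₀ ℝ)) : Set (W →₀ ℝ) :=
  {y | ∀ x c, ((∀ p ∈ l, p x ≤ c) → y x ≤ c) ∧ ((∀ p ∈ l, c ≤ p x) → c ≤ y x)}

theorem subset_boxHull {l : List (W →₀ ℝ)} {p : W →₀ ℝ} (hp : p ∈ l) : p ∈ boxHull l :=
  fun _ _ => ⟨fun h => h p hp, fun h => h p hp⟩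

theorem barycentre_mem_boxHull {l l' : List (W →₀ ℝ)} (h0 : l' ≠ [])
    (hl : ∀ p ∈ l', p ∈ boxHull l) : barycentre l' ∈ boxHull l := by
  have hlen : 0 < (l'.length : ℝ) := by
    simpa [List.length_pos_iff] using h0
  intro x c
  rw [barycentre_apply, inv_mul_le_iff₀ hlen, le_inv_mul_iff₀ hlen]
  refine ⟨fun h => ?_, fun h => ?_⟩
  · have := List.sum_le_card_nsmul (l'.map fun p => p x) c (by
      simp only [List.mem_map]
      rintro _ ⟨p, hp, rfl⟩
      exact (hl p hp x c).1 h)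
    simpa using this
  · have := List.card_nsmul_le_sum (l'.map fun p => p x) c (by
      simp only [List.mem_map]
      rintro _ ⟨p, hp, rfl⟩
      exact (hl p hp x c).2 h)
    simpa using this

/-- All coordinates of any two points of `l` differ by at most `δ`. -/
def IsSmallTuple (δ : ℝ) (l : List (W →₀ ℝ)) : Prop := ∀ p ∈ l, ∀ q ∈ l, ∀ x, p x - q x ≤ δ

/-- The entry `r` contributes no excess over itself, so `δ` is counted only `length - 1` times. This
saving produces the contraction factor of barycentric subdivision. -/
theorem sum_le_of_mem {l : List ℝ} {r δ : ℝ} (hr : r ∈ l) (h : ∀ t ∈ l, t ≤ r + δ) :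
    l.sum ≤ l.length * r + (l.length - 1) * δ := by
  obtain ⟨l₁, l₂, rfl⟩ := List.append_of_mem hr
  have h1 := List.sum_le_card_nsmul l₁ (r + δ) fun t ht => h t (by simp [ht])
  have h2 := List.sum_le_card_nsmul l₂ (r + δ) fun t ht => h t (by simp [ht])
  simp only [List.sum_append, List.sum_cons, List.length_append, List.length_cons, nsmul_eq_mul]
    at h1 h2 ⊢
  push_cast
  linarith

theorem exists_apply_le_forall {l : List (W →₀ ℝ)} (h0 : l ≠ []) (f : (W →₀ ℝ) → ℝ) :
    ∃ p ∈ l, ∀ q ∈ l, f p ≤ f q := by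
  classical
  obtain ⟨p, hp, h⟩ := l.toFinset.exists_min_image f (by simpa using h0)
  exact ⟨p, by simpa using hp, by simpa using h⟩

/-- In a fixed coordinate, `y` is bounded by an extreme entry of `l`, and the average is at distance
at most `(1 - 1/length) δ` from that entry. The second inequality is the first one after a change of
sign. -/
theorem barycentre_sub_le {l : List (W →₀ ℝ)} (h0 : l ≠ []) {δ : ℝ}
    (hδ : IsSmallTuple δ l) {y : W →₀ ℝ} (hy : y ∈ boxHull l) (x : W) :
    barycentre l x - y x ≤ (1 - (l.length : ℝ)⁻¹) * δ ∧
      y x - barycentre l x ≤ (1 - (l.length : ℝ)⁻¹) * δ := by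
  have hlen : 0 < (l.length : ℝ) := by simpa [List.length_pos_iff] using h0
  rw [barycentre_apply]
  constructor
  · obtain ⟨p, hp, hmin⟩ := exists_apply_le_forall h0 fun p => p x
    have h1 := (hy x (p x)).2 hmin
    have h2 := sum_le_of_mem (l := l.map fun p => p x) (r := p x) (δ := δ)
      (List.mem_map.2 ⟨p, hp, rfl⟩) (by
        simp only [List.mem_map]
        rintro _ ⟨q, hq, rfl⟩
        linarith [hδ q hq p hp x])
    rw [List.length_map] at h2
    have h3 := mul_le_mul_of_nonneg_left h2 (inv_nonneg.2 hlen.le)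
    have h4 : (l.length : ℝ)⁻¹ * (l.length * p x + (l.length - 1) * δ) =
        p x + (1 - (l.length : ℝ)⁻¹) * δ := by field_simp
    linarith
  · obtain ⟨p, hp, hmax⟩ := exists_apply_le_forall h0 fun p => - p x
    have h1 := (hy x (p x)).1 fun q hq => by linarith [hmax q hq]
    have h2 := sum_le_of_mem (l := l.map fun p => - p x) (r := - p x) (δ := δ)
      (List.mem_map.2 ⟨p, hp, rfl⟩) (by
        simp only [List.mem_map]
        rintro _ ⟨q, hq, rfl⟩
        linarith [hδ p hp q hq x])
    have h5 : (l.map fun p => - p x).sum = - (l.map fun p => p x).sum := by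
      clear * -
      induction l with
      | nil => simp
      | cons p l ih => simp [ih]; ring
    rw [List.length_map, h5] at h2
    have h3 := mul_le_mul_of_nonneg_left h2 (inv_nonneg.2 hlen.le)
    have h4 : (l.length : ℝ)⁻¹ * (l.length * -p x + (l.length - 1) * δ) =
        -p x + (1 - (l.length : ℝ)⁻¹) * δ := by field_simp
    linarith

open TupleChain in
/-- Barycentric subdivision makes tuples smaller by a factor depending only on their length. -/
theorem sd_isSmallTuple {R : Type*} [CommRing R] {M : ℕ} (δ : ℝ) (hδ0 : 0 ≤ δ)
    (l : List (W →₀ ℝ)) (hM : l.length ≤ M) (hδ : IsSmallTuple δ l) :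
    sd barycentre (Finsupp.single l (1 : R)) ∈
      Finsupp.supported R R {l' | IsSmallTuple ((1 - (M : ℝ)⁻¹) * δ) l'} := by
  induction hn : l.length using Nat.strong_induction_on generalizing l with
  | _ n ih =>
    by_cases h0 : l = []
    · subst h0
      rw [sd_nil]; exact Finsupp.single_mem_supported R 1 (by simp [IsSmallTuple])
    rw [sd_single _ h0, bd_single]
    have hpos : 0 < l.length := List.length_pos_iff.2 h0
    have hfac : (1 - (l.length : ℝ)⁻¹) * δ ≤ (1 - (M : ℝ)⁻¹) * δ := by
      have : (M : ℝ)⁻¹ ≤ (l.length : ℝ)⁻¹ :=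
        inv_anti₀ (by exact_mod_cast hpos) (by exact_mod_cast hM)
      gcongr
    -- The induction must also remember that the subdivided boundary stays in `boxHull l`: this
    -- bounds its distance from the new cone point, the barycentre of `l`.
    refine cons_mem_supported (S := {l' | IsSmallTuple ((1 - (M : ℝ)⁻¹) * δ) l'} ∩
      {l' | ∀ y ∈ l', y ∈ boxHull l}) ?_ (map_mem_supported ?_ (bdList_mem_supported l))
    · rintro l' ⟨h1, h2⟩ p hp q hq x
      rcases List.mem_cons.1 hp with rfl | hp <;> rcases List.mem_cons.1 hq with rfl | hq
      · rw [sub_self]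
        refine mul_nonneg (sub_nonneg.2 (inv_le_one_of_one_le₀ ?_)) hδ0
        exact_mod_cast hpos.trans_le hM
      · exact ((barycentre_sub_le h0 hδ (h2 q hq) x).1).trans hfac
      · exact ((barycentre_sub_le h0 hδ (h2 p hp) x).2).trans hfac
      · exact h1 p hp q hq x
    · rintro l' ⟨h1, h2⟩
      rw [Finsupp.supported_inter]
      refine ⟨ih _ (by omega) l' (by omega)
        (fun p hp q hq x => hδ p (h1.subset hp) q (h1.subset hq) x) rfl, ?_⟩
      refine Finsupp.supported_mono ?_ (sd_mem_supported barycentre (boxHull l)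
        (fun _ => barycentre_mem_boxHull) l' fun p hp => subset_boxHull (h1.subset hp))
      exact fun l'' h => h.2

end Mesh

/-! ### The realization of a simplicial complex -/

section RealizationTopology

variable {W : Type w} {X : AbstractSimplicialComplex W}

theorem isOpen_realization {U : Set (Realization X)}
    (h : ∀ s ∈ X.faces, ∃ V : Set (W → ℝ), IsOpen V ∧
      ∀ p : Realization X, p.weight.support ⊆ s → ((fun x => p.weight x) ∈ V ↔ p ∈ U)) :
    IsOpen U := by
  refine isOpen_iSup_iff.2 fun s => isOpen_iSup_iff.2 fun hs => ?_
  rw [isOpen_coinduced]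
  obtain ⟨V, hV, hVU⟩ := h s hs
  exact isOpen_induced_iff.2 ⟨V, hV, Set.ext fun p => hVU p.1 p.2⟩

/-- The points whose coordinates outside of `s` are smaller than `c` form an open set. -/
theorem isOpen_setOf_weight_lt (t : Set W) (c : ℝ) (hc : 0 < c) :
    IsOpen {p : Realization X | ∀ x ∉ t, p.weight x < c} := by
  classical
  -- On the closed simplex `s` only the finitely many coordinates in `s \ t` matter; coordinates
  -- outside `s` vanish and are below `c` since `c > 0`.
  refine isOpen_realization fun s _ => ⟨{f | ∀ x ∈ (s : Set W) \ t, f x < c}, ?_, ?_⟩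
  · have : {f : W → ℝ | ∀ x ∈ (s : Set W) \ t, f x < c} =
        ⋂ x ∈ (s : Set W) \ t, {f | f x < c} := by ext; simp
    rw [this]
    exact (s.finite_toSet.subset Set.sdiff_subset).isOpen_biInter fun x _ =>
      isOpen_lt (continuous_apply x) continuous_const
  · intro p hp
    refine ⟨fun h x hx => ?_, fun h x hx => h x hx.2⟩
    by_cases hxs : x ∈ s
    · exact h x ⟨hxs, hx⟩
    · rw [Finsupp.notMem_support_iff.1 fun h => hxs (hp h)]
      exact hc

/-- The open star of a vertex is open. -/
theorem isOpen_setOf_weight_pos (x : W) : IsOpen {p : Realization X | 0 < p.weight x} :=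
  isOpen_realization fun _ _ => ⟨{f | 0 < f x}, isOpen_lt continuous_const (continuous_apply x),
    fun _ _ => Iff.rfl⟩

theorem continuous_of_support_subset {Y : Type*} [TopologicalSpace Y] {s : Finset W}
    (hs : s ∈ X.faces) {f : Y → Realization X} (hf : ∀ y, (f y).weight.support ⊆ s)
    (hc : ∀ x, Continuous fun y => (f y).weight x) : Continuous f := by
  let _ : TopologicalSpace {p : Realization X // p.weight.support ⊆ s} :=
    TopologicalSpace.induced (fun p (x : W) => p.1.weight x) inferInstance
  have h1 : Continuous (fun y => (⟨f y, hf y⟩ : {p : Realization X // p.weight.support ⊆ s})) :=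
    continuous_induced_rng.2 (continuous_pi hc)
  have h2 : Continuous (Subtype.val : {p : Realization X // p.weight.support ⊆ s} → _) :=
    continuous_iff_coinduced_le.2 (le_iSup₂_of_le s hs le_rfl)
  exact h2.comp h1

/-- A point of a simplex as a point of the realization. -/
def toRealization {s : Finset W} (hs : s ∈ X.faces) (p : W →₀ ℝ) (hp : p ∈ simplexPoints s) :
    Realization X where
  weight := p
  nonneg := hp.1
  sum_eq_one := by
    rw [Finsupp.sum_of_support_subset (s := s)]
    · exact hp.2.1
    · exact fun x hx => by_contra fun h => Finsupp.mem_support_iff.1 hx (hp.2.2 x h)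
    · simp
  support_mem := by
    refine (X.isRelLowerSet_faces hs).2 ?_ ?_
    · exact fun x hx => by_contra fun h => Finsupp.mem_support_iff.1 hx (hp.2.2 x h)
    · by_contra h
      rw [Finset.not_nonempty_iff_eq_empty, Finsupp.support_eq_empty] at h
      have := hp.2.1
      simp [h] at this

/-- The vertex `x` as a point of the realization. -/
noncomputable def vertexPoint (x : W) : Realization X where
  weight := Finsupp.single x 1
  nonneg y := by classical rw [Finsupp.single_apply]; split_ifs <;> simp
  sum_eq_one := by simp
  support_mem := by
    rw [Finsupp.support_single x one_ne_zero]
    exact X.singleton_mem x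

end RealizationTopology


/-! ### Acyclicity of contractible simplicial complexes -/

section Acyclic

variable {W : Type w} (X : AbstractSimplicialComplex W)

/-- The entries of the tuple `l` all lie in a common simplex. -/
def IsFaceTuple (l : List W) : Prop := ∃ s ∈ X.faces, ∀ x ∈ l, x ∈ s

variable {X}

theorem IsFaceTuple.sublist {l l' : List W} (h : IsFaceTuple X l) (hl : l'.Sublist l) :
    IsFaceTuple X l' := by
  obtain ⟨s, hs, h⟩ := h
  exact ⟨s, hs, fun x hx => h x (hl.subset hx)⟩

/-- Pigeonhole: at most `n + 1` coordinates sum to one. Choosing such a heavy vertex gives a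
discontinuous vertex approximation of the identity of the realization, which is enough for tuples of
points. -/
theorem exists_le_weight {n : ℕ} (hn : ∀ s ∈ X.faces, s.card ≤ n + 1) (p : Realization X) :
    ∃ x, ((n : ℝ) + 1)⁻¹ ≤ p.weight x := by
  by_contra! h
  have h1 : ∑ x ∈ p.weight.support, p.weight x = 1 := p.sum_eq_one
  have hne : p.weight.support.Nonempty := (X.isRelLowerSet_faces p.support_mem).1
  have h2 := Finset.sum_lt_sum_of_nonempty hne fun x _ => h x
  rw [h1, Finset.sum_const, nsmul_eq_mul] at h2
  have h3 : (p.weight.support.card : ℝ) ≤ n + 1 := by exact_mod_cast hn _ p.support_mem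
  have h4 : (p.weight.support.card : ℝ) * ((n : ℝ) + 1)⁻¹ ≤ 1 := by
    rw [← div_eq_mul_inv, div_le_one (by positivity)]
    exact h3
  linarith

/-- The points whose coordinates outside the support of `q` are below `1/(n + 1)` form an open
neighbourhood of `q`, and their heavy vertices lie in that support. A Lebesgue number for the
pulled-back cover of the compact space `[0,1] × s` gives `δ`. -/
theorem exists_common_face {n : ℕ} {v : Realization X → W}
    (hv : ∀ p : Realization X, ((n : ℝ) + 1)⁻¹ ≤ p.weight (v p))
    {h : unitInterval × Realization X → Realization X} (hh : Continuous h) {s : Finset W}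
    (hs : s ∈ X.faces) :
    ∃ δ > 0, ∀ l : List (W →₀ ℝ), ∀ hl : (∀ p ∈ l, p ∈ simplexPoints s), IsSmallTuple δ l →
      ∀ t t' : unitInterval, dist t t' ≤ δ →
      ∃ s' ∈ X.faces, ∀ p, ∀ hp : p ∈ l, v (h (t, toRealization hs p (hl p hp))) ∈ s' ∧
        v (h (t', toRealization hs p (hl p hp))) ∈ s' := by
  classical
  -- Parametrizing `s` by the standard simplex provides a compact metric space; extension by zero
  -- returns to finitely supported coordinates.
  let ext : stdSimplex ℝ s → W →₀ ℝ := fun y =>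
    Finsupp.onFinset s (fun x => if hx : x ∈ s then y.1 ⟨x, hx⟩ else 0) fun x hx => by
      by_contra hxs
      simp [hxs] at hx
  have ext_mem : ∀ y, ext y ∈ simplexPoints s := by
    intro y
    refine ⟨fun x => ?_, ?_, fun x hx => by simp [ext, hx]⟩
    · simp only [ext, Finsupp.onFinset_apply]
      split_ifs
      · exact y.2.1 _
      · exact le_rfl
    · rw [← y.2.2, ← Finset.sum_coe_sort s]
      simp [ext]
  let F : unitInterval × stdSimplex ℝ s → Realization X := fun y =>
    h (y.1, toRealization hs (ext y.2) (ext_mem y.2))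
  have hF : Continuous F := by
    have h1 : Continuous fun y => toRealization hs (ext y) (ext_mem y) := ?_
    · exact hh.comp (continuous_fst.prodMk (h1.comp continuous_snd))
    refine continuous_of_support_subset hs (fun y x hx => ?_) fun x => ?_
    · by_contra h
      exact Finsupp.mem_support_iff.1 hx ((ext_mem y).2.2 x h)
    · by_cases hx : x ∈ s
      · simp only [toRealization, ext, Finsupp.onFinset_apply, hx, dite_true]
        exact (continuous_apply (⟨x, hx⟩ : s)).comp continuous_subtype_val
      · simpa [toRealization, ext, hx] using continuous_const
  let N : Realization X → Set (Realization X) := fun q =>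
    {p | ∀ x ∉ (q.weight.support : Set W), p.weight x < ((n : ℝ) + 1)⁻¹}
  have hN : ∀ q, IsOpen (N q) := fun q => isOpen_setOf_weight_lt _ _ (by positivity)
  have hNv : ∀ q, ∀ p ∈ N q, v p ∈ q.weight.support := by
    intro q p hp
    by_contra hvp
    exact absurd (hp (v p) hvp) (not_lt.2 (hv p))
  obtain ⟨δ, hδ, H⟩ := lebesgue_number_lemma_of_metric (isCompact_univ (X := unitInterval × stdSimplex ℝ s))
    (c := fun q => F ⁻¹' N q) (fun q => (hN q).preimage hF) (by
      intro y _
      refine Set.mem_iUnion.2 ⟨F y, fun x hx => ?_⟩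
      rw [Finsupp.notMem_support_iff.1 hx]
      positivity)
  -- Halving turns the non-strict smallness conditions into membership in the open ball of radius
  -- `δ`.
  refine ⟨δ / 2, half_pos hδ, fun l hl hsmall t t' htt' => ?_⟩
  by_cases h0 : l = []
  · subst h0
    exact ⟨s, hs, by simp⟩
  obtain ⟨p₀, hp₀⟩ := List.exists_mem_of_ne_nil l h0
  let res : ∀ p, p ∈ l → stdSimplex ℝ s := fun p hp => ⟨fun x => p x, fun x => (hl p hp).1 x, by
    rw [← (hl p hp).2.1, ← Finset.sum_coe_sort s]⟩
  have hres : ∀ p hp, ext (res p hp) = p := by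
    intro p hp
    ext x
    by_cases hx : x ∈ s
    · simp [ext, res, hx]
    · simp [ext, hx, (hl p hp).2.2 x hx]
  obtain ⟨q, hq⟩ := H (t, res p₀ hp₀) (Set.mem_univ _)
  refine ⟨q.weight.support, q.support_mem, fun p hp => ?_⟩
  have hdist : dist (res p hp) (res p₀ hp₀) < δ := by
    refine lt_of_le_of_lt ?_ (half_lt_self hδ)
    rw [Subtype.dist_eq, dist_pi_le_iff (half_pos hδ).le]
    intro x
    rw [Real.dist_eq, abs_sub_le_iff]
    exact ⟨hsmall p hp p₀ hp₀ x, hsmall p₀ hp₀ p hp x⟩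
  have key : ∀ t'', dist t'' t < δ → v (h (t'', toRealization hs p (hl p hp))) ∈ q.weight.support := by
    intro t'' ht''
    refine hNv _ _ ?_
    have := hq (show (t'', res p hp) ∈ _ from by
      rw [Metric.mem_ball, Prod.dist_eq]; exact max_lt ht'' hdist)
    simpa only [F, Set.mem_preimage, hres] using this
  exact ⟨key t (by simpa using hδ), key t' (by rw [dist_comm]; linarith)⟩

open TupleChain in
-- On cycles `sd` differs from the identity by the boundary of `bary`, so each subdivision stays in
-- the homology class and shrinks the tuples by `1 - 1/M`. Every tuple remains inside the simplex of
-- `𝓕` it started in.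
theorem exists_small_homologous {R : Type*} [CommRing R] (𝓕 : Set (Finset W)) (M : ℕ)
    {c : TupleChain R (W →₀ ℝ)} (hc : bd R c = 0) {δ : ℝ} (hδ : 0 ≤ δ)
    (hs : c ∈ Finsupp.supported R R
      {l | l.length ≤ M ∧ IsSmallTuple δ l ∧ ∃ s ∈ 𝓕, ∀ p ∈ l, p ∈ simplexPoints s}) (r : ℕ) :
    ∃ d ∈ Finsupp.supported R R {l | ∃ s ∈ 𝓕, ∀ p ∈ l, p ∈ simplexPoints s},
      c - bd R d ∈ Finsupp.supported R R {l | l.length ≤ M ∧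
        IsSmallTuple ((1 - (M : ℝ)⁻¹) ^ r * δ) l ∧ ∃ s ∈ 𝓕, ∀ p ∈ l, p ∈ simplexPoints s} := by
  have hM : 0 ≤ 1 - (M : ℝ)⁻¹ := by
    rcases Nat.eq_zero_or_pos M with rfl | h
    · simp
    · exact sub_nonneg.2 (inv_le_one_of_one_le₀ (by exact_mod_cast h))
  induction r with
  | zero => exact ⟨0, Submodule.zero_mem _, by simpa using hs⟩
  | succ r ih =>
    obtain ⟨d, hd, hcd⟩ := ih
    have hbd : bd R (c - bd R d) = 0 := by rw [map_sub, hc, bd_bd, sub_zero]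
    refine ⟨d + bary barycentre (c - bd R d), Submodule.add_mem _ hd ?_, ?_⟩
    · refine map_mem_supported ?_ hcd
      rintro l ⟨-, -, s, hs, hl⟩
      refine Finsupp.supported_mono ?_ (bary_mem_supported barycentre (simplexPoints s)
        (fun l => barycentre_mem_simplexPoints) l hl)
      exact fun l' hl' => ⟨s, hs, hl'⟩
    · have : c - bd R (d + bary barycentre (c - bd R d)) = sd barycentre (c - bd R d) := by
        rw [sd_apply, hbd, map_zero, sub_zero, map_add, sub_add_eq_sub_sub]
      rw [this]
      refine map_mem_supported ?_ hcd
      rintro l ⟨hlM, hsm, s, hs, hl⟩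
      have h1 := sd_mem_supported (R := R) barycentre (simplexPoints s)
        (fun l => barycentre_mem_simplexPoints) l hl
      have h2 := sd_isSmallTuple (R := R) _ (mul_nonneg (pow_nonneg hM r) hδ) l hlM hsm
      refine Finsupp.supported_mono ?_ (show _ ∈ Finsupp.supported R R (_ ∩ _) by
        rw [Finsupp.supported_inter]; exact ⟨h1, h2⟩)
      rintro l' ⟨⟨h3, h4⟩, h5⟩
      refine ⟨h3.trans_le hlM, ?_, s, hs, h4⟩
      rw [pow_succ', mul_assoc]
      exact h5

open TupleChain in
/-- The augmented chain complex of tuples of vertices of simplices of a finite-dimensional simplicial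
complex with contractible realization is exact. -/
theorem exists_bd_eq {R : Type*} [CommRing R] {n : ℕ} (hn : ∀ s ∈ X.faces, s.card ≤ n + 1)
    [hX : ContractibleSpace (Realization X)] {c : TupleChain R W}
    (hcX : c ∈ Finsupp.supported R R {l | IsFaceTuple X l}) (hc : bd R c = 0) :
    ∃ d ∈ Finsupp.supported R R {l | IsFaceTuple X l}, bd R d = c := by
  classical
  obtain ⟨p₁, ⟨H⟩⟩ := id_nullhomotopic (Realization X)
  choose v hv using exists_le_weight hn
  have hface : ∀ l : List W, ∃ s : Finset W, IsFaceTuple X l → s ∈ X.faces ∧ ∀ x ∈ l, x ∈ s := by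
    intro l
    by_cases h : IsFaceTuple X l
    · obtain ⟨s, hs⟩ := h
      exact ⟨s, fun _ => hs⟩
    · exact ⟨∅, fun h' => absurd h' h⟩
  choose face hface using hface
  -- Only the finitely many simplices chosen for the tuples of `c` occur, and subdivision does not
  -- leave them, so a single `δ` serves for all.
  let 𝓕 : Finset (Finset W) := c.support.image face
  have h𝓕 : ∀ s ∈ 𝓕, s ∈ X.faces := by
    intro s hs
    obtain ⟨l, hl, rfl⟩ := Finset.mem_image.1 hs
    exact (hface l (hcX hl)).1
  -- The `+ 1` makes `M` positive, so that `1 - 1/M < 1` and its powers tend to zero.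
  let M : ℕ := c.support.sup List.length + 1
  have hM : ∀ l ∈ c.support, l.length ≤ M := fun l hl =>
    (Finset.le_sup (f := List.length) hl).trans (Nat.le_succ _)
  -- a common scale of smallness
  have hδ : ∃ δ > 0, ∀ s, ∀ hs : s ∈ 𝓕, ∀ l : List (W →₀ ℝ),
      ∀ hl : (∀ p ∈ l, p ∈ simplexPoints s), IsSmallTuple δ l →
      ∀ t t' : unitInterval, dist t t' ≤ δ →
      ∃ s' ∈ X.faces, ∀ p, ∀ hp : p ∈ l, v (H (t, toRealization (h𝓕 s hs) p (hl p hp))) ∈ s' ∧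
        v (H (t', toRealization (h𝓕 s hs) p (hl p hp))) ∈ s' := by
    have h1 := fun s : 𝓕 => exists_common_face hv (map_continuous H) (h𝓕 s s.2)
    choose δ hδ h1 using h1
    obtain ⟨ε, hε, h2⟩ : ∃ ε > 0, ∀ s : 𝓕, ε ≤ δ s := by
      rcases isEmpty_or_nonempty 𝓕 with h | h
      · exact ⟨1, one_pos, fun s => h.elim s⟩
      · obtain ⟨s, hs⟩ := Finite.exists_min δ
        exact ⟨δ s, hδ s, hs⟩
    exact ⟨ε, hε, fun s hs l hl hsm t t' htt' => h1 ⟨s, hs⟩ l hl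
      (fun p hp q hq x => (hsm p hp q hq x).trans (h2 _)) t t' (htt'.trans (h2 _))⟩
  obtain ⟨δ, hδ0, hδ⟩ := hδ
  -- `N + 1` is the number of time steps along the contraction, and `r` is the number of
  -- subdivisions that makes the tuples smaller than `δ`.
  obtain ⟨N, hN⟩ := exists_nat_one_div_lt hδ0
  obtain ⟨r, hr⟩ := exists_pow_lt_of_lt_one hδ0 (show 1 - (M : ℝ)⁻¹ < 1 by
    have : 0 < (M : ℝ)⁻¹ := by positivity
    linarith)
  -- the tuples of vertices as tuples of points
  let e : W → W →₀ ℝ := fun x => Finsupp.single x 1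
  have he : ∀ s : Finset W, ∀ x ∈ s, e x ∈ simplexPoints s := by
    intro s x hx
    refine ⟨fun y => ?_, ?_, fun y hy => ?_⟩
    · simp only [e, Finsupp.single_apply]; split_ifs <;> simp
    · simp [e, Finsupp.single_apply, hx]
    · simp only [e, Finsupp.single_apply]
      rw [if_neg]
      rintro rfl
      exact hy hx
  have hec : map R e c ∈ Finsupp.supported R R {l | l.length ≤ M ∧ IsSmallTuple 1 l ∧
      ∃ s ∈ (𝓕 : Set (Finset W)), ∀ p ∈ l, p ∈ simplexPoints s} := by
    refine map_mem_supported (S := {l | l ∈ c.support}) ?_ ((Finsupp.mem_supported R c).2 subset_rfl)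
    intro l hl
    rw [map_single]
    refine Finsupp.single_mem_supported R 1 ⟨by simpa using hM l hl, ?_, face l,
      Finset.mem_image_of_mem _ hl, ?_⟩
    · intro p hp q hq x
      obtain ⟨y, -, rfl⟩ := List.mem_map.1 hp
      obtain ⟨z, -, rfl⟩ := List.mem_map.1 hq
      simp only [e, Finsupp.single_apply]
      split_ifs <;> norm_num
    · intro p hp
      obtain ⟨y, hy, rfl⟩ := List.mem_map.1 hp
      exact he _ _ ((hface l (hcX hl)).2 y hy)
  obtain ⟨d, hd, hcd⟩ := exists_small_homologous (𝓕 : Set (Finset W)) M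
    (by rw [bd_map, hc, map_zero]) zero_le_one hec r
  set z := map R e c - bd R d with hz
  have hbz : bd R z = 0 := by rw [hz, map_sub, bd_map, hc, map_zero, bd_bd, sub_zero]
  -- moving along the contraction
  let u : unitInterval → (W →₀ ℝ) → W := fun t p =>
    if h : ∃ s, ∃ hs : s ∈ X.faces, p ∈ simplexPoints s then
      v (H (t, toRealization h.choose_spec.choose p h.choose_spec.choose_spec)) else v p₁
  have hu : ∀ t s (hs : s ∈ X.faces) p (hp : p ∈ simplexPoints s),
      u t p = v (H (t, toRealization hs p hp)) := by
    intro t s hs p hp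
    exact dif_pos ⟨s, hs, hp⟩
  have hu0 : ∀ s ∈ X.faces, ∀ p ∈ simplexPoints s, u 0 p ∈ s := by
    intro s hs p hp
    rw [hu 0 s hs p hp, H.apply_zero, ContinuousMap.id_apply]
    by_contra hvs
    have h1 := hv (toRealization hs p hp)
    rw [show (toRealization hs p hp).weight _ = 0 from hp.2.2 _ hvs] at h1
    exact absurd h1 (not_le.2 (by positivity))
  have hu1 : ∀ p, u 1 p = v p₁ := by
    intro p
    simp only [u]
    split_ifs with h
    · rw [H.apply_one, ContinuousMap.const_apply]
    · rfl
  let B : Submodule R (TupleChain R W) :=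
    (Finsupp.supported R R {l | IsFaceTuple X l}).map (bd R)
  -- As `z` is a cycle, the prism between `u t` and `u t'` bounds the difference. Smallness of the
  -- tuples and of the time step puts each prism into one simplex.
  have hstep : ∀ t t' : unitInterval, dist t t' ≤ δ → map R (u t') z - map R (u t) z ∈ B := by
    intro t t' htt'
    rw [← bd_prism, hbz, map_zero, add_zero]
    refine ⟨_, mem_supported_of_forall _ ?_ hcd, rfl⟩
    rintro l ⟨-, hsm, s, hs, hl⟩
    obtain ⟨s', hs', hl'⟩ := hδ s hs l hl
      (fun p hp q hq x => (hsm p hp q hq x).trans (by simpa using hr.le)) t t' htt'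
    refine Finsupp.supported_mono ?_ (prismList_mem_supported (u t) (u t') l)
    intro l'' hl''
    refine ⟨s', hs', fun y hy => ?_⟩
    obtain ⟨p, hp, rfl | rfl⟩ := hl'' y hy
    · rw [hu t s (h𝓕 s hs) p (hl p hp)]
      exact (hl' p hp).1
    · rw [hu t' s (h𝓕 s hs) p (hl p hp)]
      exact (hl' p hp).2
  let τ : ℕ → unitInterval := fun i => Set.projIcc 0 1 zero_le_one ((i : ℝ) / (N + 1))
  have hτ : ∀ i, dist (τ i) (τ (i + 1)) ≤ δ := by
    intro i
    rw [Subtype.dist_eq, Real.dist_eq]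
    refine (Set.abs_projIcc_sub_projIcc zero_le_one).trans ?_
    have : (i : ℝ) / (N + 1) - ((i + 1 : ℕ) : ℝ) / (N + 1) = -(1 / ((N : ℝ) + 1)) := by
      push_cast; ring
    rw [this, abs_neg, abs_of_pos (by positivity)]
    exact hN.le
  have hmove : ∀ i, map R (u (τ i)) z - map R (u 0) z ∈ B := by
    intro i
    induction i with
    | zero =>
      have : τ 0 = 0 := by
        simp only [τ, Nat.cast_zero, zero_div]
        exact Set.projIcc_left _
      rw [this, sub_self]
      exact Submodule.zero_mem _
    | succ i ih =>
      have := Submodule.add_mem _ (hstep _ _ (hτ i)) ih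
      rwa [sub_add_sub_cancel] at this
  -- At time one every entry is the vertex `v p₁`, so coning with that vertex stays in a simplex and
  -- fills the cycle.
  have hend : map R (u 1) z ∈ B := by
    obtain ⟨s, hs, hsv⟩ : ∃ s ∈ X.faces, v p₁ ∈ s :=
      ⟨{v p₁}, X.singleton_mem _, Finset.mem_singleton_self _⟩
    have hmem : map R (u 1) z ∈ Finsupp.supported R R {l | ∀ x ∈ l, x ∈ s} := by
      refine map_mem_supported (S := Set.univ) ?_ (by simp [Finsupp.supported_univ])
      intro l _
      rw [map_single]
      refine Finsupp.single_mem_supported R 1 fun x hx => ?_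
      obtain ⟨p, -, rfl⟩ := List.mem_map.1 hx
      rw [hu1]
      exact hsv
    refine ⟨cons R (v p₁) (map R (u 1) z), cons_mem_supported ?_ hmem, ?_⟩
    · intro l hl
      refine ⟨s, hs, fun x hx => ?_⟩
      rcases List.mem_cons.1 hx with rfl | hx
      · exact hsv
      · exact hl x hx
    · rw [bd_cons, bd_map, hbz, map_zero, map_zero, sub_zero]
  have hstart : map R (u 0) z ∈ B := by
    have h1 : τ (N + 1) = 1 := by
      simp only [τ]
      rw [Nat.cast_add, Nat.cast_one, div_self (by positivity)]
      exact Set.projIcc_right _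
    have h2 := Submodule.sub_mem _ hend (h1 ▸ hmove (N + 1))
    rwa [sub_sub_cancel] at h2
  -- At time zero a point of a simplex goes to a vertex of that simplex, so vertices are fixed.
  -- Pushing `map e c = z + bd d` forward by `u 0` therefore recovers `c`, and the second summand is
  -- a boundary of face tuples.
  have hue : ∀ x, u 0 (e x) = x := fun x =>
    Finset.mem_singleton.1 (hu0 {x} (X.singleton_mem x) _ (he _ x (Finset.mem_singleton_self x)))
  have hue' : map R (u 0) (map R e c) = c := by
    rw [map_map, show u 0 ∘ e = id from funext hue, map, List.map_id_fun]
    exact Finsupp.mapDomain_id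
  have hcz : c = map R (u 0) z + bd R (map R (u 0) d) := by
    rw [hz, map_sub, hue', bd_map, sub_add_cancel]
  have hcB : c ∈ B := by
    rw [hcz]
    refine Submodule.add_mem _ hstart ⟨_, map_mem_supported ?_ hd, rfl⟩
    rintro l ⟨s, hs, hl⟩
    rw [map_single]
    refine Finsupp.single_mem_supported R 1 ⟨s, h𝓕 s hs, fun x hx => ?_⟩
    obtain ⟨p, hp, rfl⟩ := List.mem_map.1 hx
    exact hu0 s (h𝓕 s hs) p (hl p hp)
  exact hcB

open TupleChain in
theorem TupleChain.eqOn_supported {R M T : Type*} [CommRing R] [AddCommGroup M] [Module R M]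
    {S : Set (List T)} {F F' : TupleChain R T →ₗ[R] M}
    (h : ∀ l ∈ S, F (Finsupp.single l 1) = F' (Finsupp.single l 1)) {c : TupleChain R T}
    (hc : c ∈ Finsupp.supported R R S) : F c = F' c := by
  have key : ∀ F : TupleChain R T →ₗ[R] M, F c = ∑ l ∈ c.support, c l • F (Finsupp.single l 1) := by
    intro F
    conv_lhs => rw [← Finsupp.sum_single c, Finsupp.sum, map_sum]
    refine Finset.sum_congr rfl fun l _ => ?_
    rw [← map_smul, Finsupp.smul_single, smul_eq_mul, mul_one]
  rw [key, key]
  exact Finset.sum_congr rfl fun l hl => by rw [h l (hc hl)]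

/-- The part of a chain consisting of the tuples of length `k`. -/
noncomputable def TupleChain.ofLength (R : Type*) {T : Type*} [CommRing R] (k : ℕ) :
    TupleChain R T →ₗ[R] TupleChain R T :=
  Finsupp.linearCombination R fun l => if l.length = k then Finsupp.single l 1 else 0

open TupleChain in
theorem TupleChain.ofLength_of_mem {R T : Type*} [CommRing R] {k : ℕ} {c : TupleChain R T}
    (hc : c ∈ Finsupp.supported R R {l | l.length = k}) : ofLength R k c = c :=
  eqOn_supported (F' := LinearMap.id) (fun l hl => by
    simp only [ofLength, Finsupp.linearCombination_single, one_smul, LinearMap.id_apply]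
    exact if_pos hl) hc

open TupleChain in
theorem TupleChain.ofLength_eq_zero {R T : Type*} [CommRing R] {k : ℕ} {c : TupleChain R T}
    (hc : c ∈ Finsupp.supported R R {l | l.length ≠ k}) : ofLength R k c = 0 :=
  eqOn_supported (F' := 0) (fun l hl => by
    simp only [ofLength, Finsupp.linearCombination_single, one_smul, LinearMap.zero_apply]
    exact if_neg hl) hc

open TupleChain in
theorem TupleChain.bd_ofLength {R T : Type*} [CommRing R] (k : ℕ) (c : TupleChain R T) :
    bd R (ofLength R (k + 1) c) = ofLength R k (bd R c) := by
  suffices h : bd R ∘ₗ ofLength R (k + 1) = ofLength R k ∘ₗ bd (T := T) R from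
    LinearMap.congr_fun h c
  refine Finsupp.lhom_ext' fun l => LinearMap.ext_ring ?_
  simp only [LinearMap.comp_apply, Finsupp.lsingle_apply]
  by_cases hl : l.length = k + 1
  · rw [ofLength_of_mem (Finsupp.single_mem_supported R 1 (by exact hl)), ofLength_of_mem]
    rw [bd_single]
    refine Finsupp.supported_mono ?_ (bdList_mem_supported l)
    rintro l' ⟨-, h⟩
    exact Nat.succ_injective (h.trans hl)
  · rw [ofLength_eq_zero (Finsupp.single_mem_supported R 1 (by exact hl)), map_zero]
    symm
    refine ofLength_eq_zero ?_
    rw [bd_single]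
    refine Finsupp.supported_mono ?_ (bdList_mem_supported l)
    rintro l' ⟨-, h⟩ h'
    exact hl (by rw [← h, h'])

open TupleChain in
theorem bd_mem_supported_isFaceTuple {R : Type*} [CommRing R] {c : TupleChain R W}
    (hc : c ∈ Finsupp.supported R R {l | IsFaceTuple X l}) :
    bd R c ∈ Finsupp.supported R R {l | IsFaceTuple X l} := by
  refine map_mem_supported (fun l hl => ?_) hc
  rw [bd_single]
  exact Finsupp.supported_mono (fun l' h => hl.sublist h.1) (bdList_mem_supported l)

/-- Over a field, the surjection `D : E → ker D` has a linear section `r`. Then `k = id - r ∘ D`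
projects `E` onto `ker D`, and `r ∘ k` is the contraction. -/
theorem exists_contraction_of_exact {𝕜 E : Type*} [Field 𝕜] [AddCommGroup E] [Module 𝕜 E]
    (D : E →ₗ[𝕜] E) (hD : ∀ x, D (D x) = 0) (hD' : ∀ x, D x = 0 → ∃ y, D y = x) :
    ∃ g : E →ₗ[𝕜] E, ∀ x, D (g x) + g (D x) = x := by
  let D' : E →ₗ[𝕜] LinearMap.ker D := D.codRestrict _ hD
  obtain ⟨r, hr⟩ := LinearMap.exists_rightInverse_of_surjective D' (by
    rw [LinearMap.range_eq_top]
    rintro ⟨x, hx⟩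
    obtain ⟨y, hy⟩ := hD' x hx
    exact ⟨y, Subtype.ext hy⟩)
  have hr' : ∀ z : LinearMap.ker D, D (r z) = z.1 := fun z =>
    congrArg Subtype.val (LinearMap.congr_fun hr z)
  have h0 : ∀ x, D (x - r (D' x)) = 0 := fun x => by rw [map_sub, hr']; exact sub_self _
  let k : E →ₗ[𝕜] LinearMap.ker D :=
    LinearMap.codRestrict (LinearMap.ker D) (LinearMap.id - r ∘ₗ D') h0
  refine ⟨r ∘ₗ k, fun x => ?_⟩
  have h1 : D' (D x) = 0 := Subtype.ext (hD _)
  have h2 : k (D x) = D' x := Subtype.ext (by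
    change D x - r (D' (D x)) = D x
    rw [h1, map_zero, sub_zero])
  rw [LinearMap.comp_apply, LinearMap.comp_apply, hr', h2]
  change x - r (D' x) + r (D' x) = x
  rw [sub_add_cancel]

open TupleChain in
/-- A linear contraction of the augmented chain complex of tuples of a contractible simplicial
complex. -/
theorem exists_contraction (𝕜 : Type*) [Field 𝕜] {n : ℕ} (hn : ∀ s ∈ X.faces, s.card ≤ n + 1)
    [hX : ContractibleSpace (Realization X)] :
    ∃ s : TupleChain 𝕜 W →ₗ[𝕜] TupleChain 𝕜 W, ∀ l, IsFaceTuple X l →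
      s (Finsupp.single l 1) ∈
        Finsupp.supported 𝕜 𝕜 {l' | IsFaceTuple X l' ∧ l'.length = l.length + 1} ∧
      bd 𝕜 (s (Finsupp.single l 1)) + s (bd 𝕜 (Finsupp.single l 1)) = Finsupp.single l 1 := by
  let C : Submodule 𝕜 (TupleChain 𝕜 W) := Finsupp.supported 𝕜 𝕜 {l | IsFaceTuple X l}
  let D : C →ₗ[𝕜] C := (bd 𝕜).restrict fun c hc => bd_mem_supported_isFaceTuple hc
  obtain ⟨g₀, hg₀⟩ := exists_contraction_of_exact (E := C) D
    (fun c => Subtype.ext (bd_bd c.1)) (by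
    rintro ⟨c, hc⟩ hbc
    obtain ⟨d, hd, h⟩ := exists_bd_eq hn hc (congrArg Subtype.val hbc)
    exact ⟨⟨d, hd⟩, Subtype.ext h⟩)
  -- Linear algebra gives a contraction only on face tuples and without regard to degree. It is
  -- extended to all chains, and `s` then retains only its component raising the length by one.
  obtain ⟨g, hg⟩ := LinearMap.exists_extend (C.subtype ∘ₗ g₀)
  have hg' : ∀ c (hc : c ∈ C), g c = g₀ ⟨c, hc⟩ := fun c hc => LinearMap.congr_fun hg ⟨c, hc⟩
  let s : TupleChain 𝕜 W →ₗ[𝕜] TupleChain 𝕜 W :=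
    Finsupp.linearCombination 𝕜 fun l => ofLength 𝕜 (l.length + 1) (g (Finsupp.single l 1))
  have hs : ∀ l, s (Finsupp.single l 1) = ofLength 𝕜 (l.length + 1) (g (Finsupp.single l 1)) := by
    intro l
    simp [s]
  refine ⟨s, fun l hl => ⟨?_, ?_⟩⟩
  · rw [hs]
    have hlC : Finsupp.single l 1 ∈ C := Finsupp.single_mem_supported 𝕜 1 hl
    rw [hg' _ hlC]
    refine mem_supported_of_forall _ (fun l' hl' => ?_) (g₀ ⟨_, hlC⟩).2
    split_ifs with h
    · exact Finsupp.single_mem_supported 𝕜 1 ⟨hl', h⟩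
    · exact Submodule.zero_mem _
  · have hlC : Finsupp.single l 1 ∈ C := Finsupp.single_mem_supported 𝕜 1 hl
    have h1 : s (bd 𝕜 (Finsupp.single l 1)) = ofLength 𝕜 l.length (g (bd 𝕜 (Finsupp.single l 1))) := by
      refine eqOn_supported (F' := ofLength 𝕜 l.length ∘ₗ g) (fun l' hl' => ?_)
        (bd_single (R := 𝕜) l ▸ bdList_mem_supported l)
      rw [hs, hl'.2]
      rfl
    rw [hs, bd_ofLength, h1, ← map_add, hg' _ hlC, hg' _ (bd_mem_supported_isFaceTuple hlC)]
    have h2 := congrArg Subtype.val (hg₀ ⟨_, hlC⟩)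
    exact (congrArg _ h2).trans (ofLength_of_mem (Finsupp.single_mem_supported 𝕜 1 rfl))

end Acyclic


/-! ### Proper cocompact simplicial actions -/

section TupleAction

variable {W : Type w} {H : Type*} [Group H] [MulAction H W]

/-- The diagonal action on tuples. -/
instance : MulAction H (List W) where
  smul h l := l.map (h • ·)
  one_smul l := by
    change l.map ((1 : H) • ·) = l
    simp
  mul_smul g h l := by
    change l.map ((g * h) • ·) = (l.map (h • ·)).map (g • ·)
    simp [mul_smul]

theorem smul_cons (h : H) (x : W) (l : List W) : h • (x :: l) = h • x :: h • l := rfl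

@[simp]
theorem smul_list_nil (h : H) : h • ([] : List W) = [] := rfl

@[simp]
theorem length_smul_list (h : H) (l : List W) : (h • l).length = l.length := List.length_map _

theorem isFaceTuple_smul {X : AbstractSimplicialComplex W} [SimplicialAction X H] (h : H)
    {l : List W} : IsFaceTuple X (h • l) ↔ IsFaceTuple X l := by
  have key : ∀ (h : H) (l : List W), IsFaceTuple X l → IsFaceTuple X (h • l) := by
    rintro h l ⟨s, hs, hl⟩
    refine ⟨_, SimplicialAction.map_mem h s hs, fun x hx => ?_⟩
    obtain ⟨y, hy, rfl⟩ := List.mem_map.1 hx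
    exact Finset.mem_map_of_mem _ (hl y hy)
  exact ⟨fun hl => by simpa using key h⁻¹ _ hl, key h l⟩

end TupleAction

theorem finite_setOf_length_eq {W : Type*} {B : Set W} (hB : B.Finite) (k : ℕ) :
    {l : List W | l.length = k ∧ ∀ y ∈ l, y ∈ B}.Finite := by
  induction k with
  | zero =>
    refine (Set.finite_singleton []).subset ?_
    rintro l ⟨hl, -⟩
    exact List.length_eq_zero_iff.1 hl
  | succ k ih =>
    refine (hB.image2 List.cons ih).subset ?_
    rintro (_ | ⟨x, l⟩) ⟨hl, h⟩
    · simp at hl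
    · exact ⟨x, h x (by simp), l, ⟨by simpa using hl, fun y hy => h y (by simp [hy])⟩, rfl⟩

/-! ### Transporters of vertices and tuples, and finiteness of orbits. -/

section Proper

variable {W : Type w} {X : AbstractSimplicialComplex W} {H : Type*} [Group H]
  [MulAction H W] [SimplicialAction X H]

theorem smul_vertexPoint (h : H) (x : W) :
    h • (vertexPoint x : Realization X) = vertexPoint (h • x) := by
  ext y
  change (Finsupp.single x (1 : ℝ)).equivMapDomain (MulAction.toPerm h) y = Finsupp.single (h • x) 1 y
  rw [Finsupp.equivMapDomain_single]
  rfl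

theorem vertexPoint_injective : Function.Injective (vertexPoint : W → Realization X) := by
  intro x y h
  have : Finsupp.single x (1 : ℝ) = Finsupp.single y 1 := congrArg Realization.weight h
  exact (Finsupp.single_left_inj one_ne_zero).1 this

theorem vertexPoint_weight_pos (x y : W) :
    0 < (vertexPoint x : Realization X).weight y ↔ x = y := by
  classical
  change 0 < Finsupp.single x (1 : ℝ) y ↔ _
  rw [Finsupp.single_apply]
  split_ifs with h <;> simp [h]

variable [TopologicalSpace H] (hH : ActsProperlyCocompactly X H)

include hH

/-- The open star of `y` contains no vertex other than `y`; the transporter is its preimage under a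
continuous orbit map. -/
theorem isOpen_transporter (x y : W) : IsOpen {h : H | h • x = y} := by
  have := hH.1
  have hc : Continuous fun h : H => h • (vertexPoint x : Realization X) :=
    continuous_id.smul continuous_const
  convert (isOpen_setOf_weight_pos y).preimage hc using 1
  ext h
  rw [Set.mem_preimage, Set.mem_ofPred_eq, Set.mem_ofPred_eq, smul_vertexPoint,
    vertexPoint_weight_pos]

theorem isCompact_transporter (x y : W) : IsCompact {h : H | h • x = y} := by
  have := hH.1
  have h1 := (ProperSMul.isProperMap_smul_pair (G := H) (X := Realization X)).isCompact_preimage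
    (isCompact_singleton (x := (vertexPoint y, vertexPoint x)))
  convert h1.image continuous_fst using 1
  ext h
  constructor
  · rintro rfl
    exact ⟨(h, vertexPoint x), by simp [smul_vertexPoint], rfl⟩
  · rintro ⟨⟨h', p⟩, hp, rfl⟩
    simp only [Set.mem_preimage, Set.mem_singleton_iff, Prod.mk.injEq] at hp
    obtain ⟨hp, rfl⟩ := hp
    rw [smul_vertexPoint] at hp
    exact vertexPoint_injective hp

/-- The complement is the union of the open transporters to the other vertices, so no separation
axiom on `H` is required. -/
theorem isClosed_transporter (x y : W) : IsClosed {h : H | h • x = y} := by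
  have : {h : H | h • x = y} = (⋃ z ∈ {z | z ≠ y}, {h : H | h • x = z})ᶜ := by
    ext h
    simp only [ne_eq, Set.mem_ofPred_eq, Set.mem_compl_iff, Set.mem_iUnion, not_exists]
    exact ⟨fun hy z hz hz' => hz (hz'.symm.trans hy), fun hy => by_contra fun hn => hy _ hn rfl⟩
  rw [this, isClosed_compl_iff]
  exact isOpen_biUnion fun z _ => isOpen_transporter hH x z

theorem isOpen_transporter_list (l l' : List W) : IsOpen {h : H | h • l = l'} := by
  induction l generalizing l' with
  | nil => simp
  | cons x l ih =>
    cases l' with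
    | nil => simp [smul_cons]
    | cons y l' =>
      simp only [smul_cons, List.cons.injEq]
      exact (isOpen_transporter hH x y).inter (ih l')

theorem isClosed_transporter_list (l l' : List W) : IsClosed {h : H | h • l = l'} := by
  induction l generalizing l' with
  | nil =>
    simp only [smul_list_nil]
    exact isClosed_const
  | cons x l ih =>
    cases l' with
    | nil => simp [smul_cons]
    | cons y l' =>
      simp only [smul_cons, List.cons.injEq]
      exact (isClosed_transporter hH x y).inter (ih l')

/-- The first entry supplies compactness and the remaining ones a closed condition. For the empty
tuple the transporter to itself is the whole group, hence `l ≠ []`. -/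
theorem isCompact_transporter_list {l : List W} (hl : l ≠ []) (l' : List W) :
    IsCompact {h : H | h • l = l'} := by
  obtain ⟨x, l, rfl⟩ := List.exists_cons_of_ne_nil hl
  cases l' with
  | nil => simp [smul_cons]
  | cons y l' =>
    simp only [smul_cons, List.cons.injEq]
    exact (isCompact_transporter hH x y).inter_right (isClosed_transporter_list hH l l')

/-- The images of the open stars form an open cover of the compact quotient. A vertex lying in a
translate of the star of `r` is a translate of `r`. -/
theorem exists_finite_vertex_orbits : ∃ R : Finset W, ∀ x : W, ∃ h : H, ∃ r ∈ R, h • r = x := by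
  classical
  have := hH.1
  have := hH.2
  let π : Realization X → MulAction.orbitRel.Quotient H (Realization X) := Quotient.mk''
  have hπ : IsOpenMap π := isOpenMap_quotient_mk'_mul
  obtain ⟨R, hR⟩ := isCompact_univ.elim_finite_subcover
    (fun x : W => π '' {p : Realization X | 0 < p.weight x})
    (fun x => hπ _ (isOpen_setOf_weight_pos x)) (by
      rintro q -
      obtain ⟨p, rfl⟩ := Quotient.exists_rep q
      obtain ⟨x, hx⟩ : ∃ x, 0 < p.weight x := by
        obtain ⟨x, hx⟩ := (X.isRelLowerSet_faces p.support_mem).1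
        exact ⟨x, (p.nonneg x).lt_of_ne (Finsupp.mem_support_iff.1 hx).symm⟩
      exact Set.mem_iUnion.2 ⟨x, p, hx, rfl⟩)
  refine ⟨R, fun x => ?_⟩
  obtain ⟨r, hr, p, hp, hpx⟩ : ∃ r ∈ R, ∃ p : Realization X, 0 < p.weight r ∧
      π p = π (vertexPoint x) := by
    have := hR (Set.mem_univ (π (vertexPoint x)))
    simpa using this
  obtain ⟨h, hh⟩ : p ∈ MulAction.orbit H (vertexPoint x : Realization X) := Quotient.exact hpx
  have hh : h • (vertexPoint x : Realization X) = p := hh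
  refine ⟨h⁻¹, r, hr, ?_⟩
  rw [← hh, smul_vertexPoint, vertexPoint_weight_pos] at hp
  rw [← hp, inv_smul_smul]

/-- Move the first entry to one of finitely many representatives; local finiteness leaves finitely
many choices for the others. -/
theorem exists_finite_tuple_orbits (hX : IsLocallyFinite X) (q : ℕ) :
    ∃ R : Set (List W), R.Finite ∧ ∀ l : List W, IsFaceTuple X l → l.length = q + 1 →
      ∃ h : H, ∃ r ∈ R, h • r = l := by
  obtain ⟨R, hR⟩ := exists_finite_vertex_orbits hH
  let B : Set W := ⋃ r ∈ R, ⋃ s ∈ {s ∈ X.faces | r ∈ s}, (s : Set W)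
  have hB : B.Finite := R.finite_toSet.biUnion fun r _ =>
    (hX r).biUnion fun s _ => s.finite_toSet
  refine ⟨{l | l.length = q + 1 ∧ ∀ y ∈ l, y ∈ B}, finite_setOf_length_eq hB _, ?_⟩
  intro l hl hq
  obtain ⟨x, l', rfl⟩ := List.exists_cons_of_length_eq_add_one hq
  obtain ⟨h, r, hr, rfl⟩ := hR x
  obtain ⟨s, hs, hl'⟩ := (isFaceTuple_smul h⁻¹).2 hl
  rw [smul_cons, inv_smul_smul] at hl'
  have hmem : ∀ y ∈ r :: h⁻¹ • l', y ∈ B := fun y hy => by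
    simp only [B, Set.mem_iUnion]
    exact ⟨r, hr, s, ⟨hs, hl' r (by simp)⟩, hl' y hy⟩
  have hlen : (r :: h⁻¹ • l').length = q + 1 := by simpa using hq
  refine ⟨h, r :: h⁻¹ • l', ⟨hlen, hmem⟩, ?_⟩
  rw [smul_cons, smul_inv_smul]

end Proper

/-- A countable locally compact Hausdorff group is discrete. -/
theorem discreteTopology_of_countable (H : Type*) [Group H] [TopologicalSpace H]
    [IsTopologicalGroup H] [T2Space H] [LocallyCompactSpace H] [Countable H] :
    DiscreteTopology H := by
  -- Baire category: among countably many closed singletons covering the group, one has interior.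
  obtain ⟨x, y, hy⟩ := nonempty_interior_of_iUnion_of_closed (f := fun x : H => {x})
    (fun x => isClosed_singleton) (Set.iUnion_of_singleton H)
  have hx : IsOpen ({x} : Set H) := by
    have hyx : y = x := Set.mem_singleton_iff.1 (interior_subset hy)
    subst hyx
    rw [← interior_subset.antisymm (Set.singleton_subset_iff.2 hy)]
    exact isOpen_interior
  refine discreteTopology_of_isOpen_singleton_one ?_
  convert hx.smul x⁻¹ using 1
  simp


/-! ### The homogeneous differential -/

section GroupBd

variable (𝕜 : Type*) [CommRing 𝕜] {H : Type u} (E : Type*) [AddCommGroup E] [Module 𝕜 E]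

/-- The alternating sum over the omissions of one of the `p + 1` arguments. -/
def groupBd : ∀ p : ℕ, ((Fin p → H) → E) →ₗ[𝕜] ((Fin (p + 1) → H) → E)
  | 0 => LinearMap.funLeft 𝕜 E fun x : Fin 1 → H => (Fin.tail x : Fin 0 → H)
  | p + 1 => (LinearMap.funLeft 𝕜 E fun x : Fin (p + 2) → H => (Fin.tail x : Fin (p + 1) → H)) -
      LinearMap.pi fun x : Fin (p + 2) → H =>
      LinearMap.proj (Fin.tail x) ∘ₗ groupBd p ∘ₗ
        LinearMap.funLeft 𝕜 E fun y : Fin p → H => (Fin.cons (x 0) y : Fin (p + 1) → H)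

variable {E}

theorem groupBd_zero_apply (F : (Fin 0 → H) → E) (x : Fin 1 → H) :
    groupBd 𝕜 E 0 F x = F (Fin.tail x) := rfl

/-- Splitting off the first argument matches the iterated function spaces and the recursive
differential of `resolutionX`. -/
theorem groupBd_succ_apply {p : ℕ} (F : (Fin (p + 1) → H) → E) (x : Fin (p + 2) → H) :
    groupBd 𝕜 E (p + 1) F x =
      F (Fin.tail x) - groupBd 𝕜 E p (fun y => F (Fin.cons (x 0) y)) (Fin.tail x) := rfl

theorem groupBd_succ_cons {p : ℕ} (F : (Fin (p + 1) → H) → E) (a : H) (x : Fin (p + 1) → H) :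
    groupBd 𝕜 E (p + 1) F (Fin.cons a x : Fin (p + 2) → H) =
      F x - groupBd 𝕜 E p (fun y => F (Fin.cons a y)) x := by
  rw [groupBd_succ_apply, Fin.tail_cons, Fin.cons_zero]

theorem groupBd_comp_linearMap {E' : Type*} [AddCommGroup E'] [Module 𝕜 E'] (φ : E →ₗ[𝕜] E')
    {p : ℕ} (F : (Fin p → H) → E) (x : Fin (p + 1) → H) :
    groupBd 𝕜 E' p (fun y => φ (F y)) x = φ (groupBd 𝕜 E p F x) := by
  induction p with
  | zero => rfl
  | succ p ih => rw [groupBd_succ_apply, groupBd_succ_apply, ih, map_sub]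

theorem groupBd_comp_map (e : H → H) {p : ℕ} (F : (Fin p → H) → E) (x : Fin (p + 1) → H) :
    groupBd 𝕜 E p (fun y => F fun i => e (y i)) x = groupBd 𝕜 E p F fun i => e (x i) := by
  induction p with
  | zero => exact congrArg F (funext fun i => i.elim0)
  | succ p ih =>
    rw [groupBd_succ_apply, groupBd_succ_apply]
    congr 1
    rw [show (Fin.tail fun i => e (x i)) = fun i => e (Fin.tail x i) from rfl, ← ih]
    refine congrFun (congrArg _ (funext fun y => congrArg F (funext fun i => ?_))) _
    cases i using Fin.cases <;> rfl

theorem groupBd_groupBd {p : ℕ} (F : (Fin p → H) → E) :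
    groupBd 𝕜 E (p + 1) (groupBd 𝕜 E p F) = 0 := by
  induction p with
  | zero =>
    funext x
    rw [groupBd_succ_apply, groupBd_zero_apply, groupBd_zero_apply, groupBd_zero_apply]
    exact sub_eq_zero.2 (congrArg F (Subsingleton.elim _ _))
  | succ p ih =>
    funext x
    rw [groupBd_succ_apply]
    have : (fun y => groupBd 𝕜 E (p + 1) F (Fin.cons (x 0) y : Fin (p + 2) → H)) =
        F - groupBd 𝕜 E p (fun y => F (Fin.cons (x 0) y)) :=
      funext fun y => groupBd_succ_cons 𝕜 F (x 0) y
    rw [this, map_sub, ih, sub_zero, sub_self]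
    rfl

/-- The parameter space `Y` is there for the induction: the recursion freezes the first argument,
which then joins the parameters. -/
theorem continuous_groupBd [TopologicalSpace H] [TopologicalSpace E] [IsTopologicalAddGroup E]
    {p : ℕ} {Y : Type u} [TopologicalSpace Y] {F : Y → (Fin p → H) → E}
    (hF : Continuous fun z : Y × (Fin p → H) => F z.1 z.2) :
    Continuous fun z : Y × (Fin (p + 1) → H) => groupBd 𝕜 E p (F z.1) z.2 := by
  have htail : ∀ q, Continuous fun x : Fin (q + 1) → H => Fin.tail x := fun q =>
    continuous_pi fun i => continuous_apply _
  induction p generalizing Y with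
  | zero => exact hF.comp (continuous_fst.prodMk ((htail 0).comp continuous_snd))
  | succ p ih =>
    simp only [groupBd_succ_apply]
    refine (hF.comp (continuous_fst.prodMk ((htail _).comp continuous_snd))).sub ?_
    have h1 := ih (Y := Y × H) (F := fun y x => F y.1 (Fin.cons y.2 x)) (by
      refine hF.comp ((continuous_fst.comp continuous_fst).prodMk ?_)
      exact Continuous.finCons (A := fun _ => H) (continuous_snd.comp continuous_fst)
        continuous_snd)
    exact h1.comp (((continuous_fst).prodMk ((continuous_apply (0 : Fin (p + 2))).comp continuous_snd)).prodMk
      ((htail _).comp continuous_snd))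

end GroupBd

/-! ### The differential of cochains on tuples of vertices -/

section FaceBd

variable (𝕜 : Type*) [CommRing 𝕜] {W : Type w} (X : AbstractSimplicialComplex W)
  (A : Type*) [AddCommGroup A] [Module 𝕜 A]

open Classical in
/-- The coboundary of a cochain on tuples of length `q` with entries in a common simplex. -/
noncomputable def faceBd (q : ℕ) : (List W → A) →ₗ[𝕜] (List W → A) where
  toFun φ l := if IsFaceTuple X l ∧ l.length = q + 1 then
    Finsupp.linearCombination 𝕜 φ (TupleChain.bdList 𝕜 l) else 0
  map_add' φ ψ := by
    funext l
    simp only [Pi.add_apply]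
    split_ifs
    · simp [Finsupp.linearCombination_apply, Finsupp.sum, Finset.sum_add_distrib]
    · simp
  map_smul' a φ := by
    funext l
    simp only [Pi.smul_apply, RingHom.id_apply]
    split_ifs
    · simp [Finsupp.linearCombination_apply, Finsupp.sum, Finset.smul_sum, smul_comm a]
    · simp

variable {X A}

theorem faceBd_apply {q : ℕ} (φ : List W → A) {l : List W} (hl : IsFaceTuple X l)
    (hq : l.length = q + 1) :
    faceBd 𝕜 X A q φ l = Finsupp.linearCombination 𝕜 φ (TupleChain.bdList 𝕜 l) := if_pos ⟨hl, hq⟩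

theorem faceBd_eq_zero {q : ℕ} (φ : List W → A) {l : List W}
    (hl : ¬(IsFaceTuple X l ∧ l.length = q + 1)) : faceBd 𝕜 X A q φ l = 0 := if_neg hl

open TupleChain in
/-- The coboundary is dual to the boundary. -/
theorem linearCombination_faceBd {q : ℕ} (φ : List W → A) {c : TupleChain 𝕜 W}
    (hc : c ∈ Finsupp.supported 𝕜 𝕜 {l | IsFaceTuple X l ∧ l.length = q + 1}) :
    Finsupp.linearCombination 𝕜 (faceBd 𝕜 X A q φ) c = Finsupp.linearCombination 𝕜 φ (bd 𝕜 c) := by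
  refine eqOn_supported (F' := Finsupp.linearCombination 𝕜 φ ∘ₗ bd 𝕜) (fun l hl => ?_) hc
  rw [Finsupp.linearCombination_single, one_smul, faceBd_apply 𝕜 φ hl.1 hl.2,
    LinearMap.comp_apply, bd_single]

open TupleChain in
theorem bdList_mem_supported_isFaceTuple {q : ℕ} {l : List W} (hl : IsFaceTuple X l)
    (hq : l.length = q + 1) :
    bdList 𝕜 l ∈ Finsupp.supported 𝕜 𝕜 {l | IsFaceTuple X l ∧ l.length = q} :=
  Finsupp.supported_mono (t := {l | IsFaceTuple X l ∧ l.length = q})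
    (fun _ h => ⟨hl.sublist h.1, Nat.succ_injective (h.2.trans hq)⟩) (bdList_mem_supported l)

theorem faceBd_faceBd (q : ℕ) (φ : List W → A) :
    faceBd 𝕜 X A (q + 1) (faceBd 𝕜 X A q φ) = 0 := by
  funext l
  by_cases hl : IsFaceTuple X l ∧ l.length = q + 2
  · rw [faceBd_apply 𝕜 _ hl.1 hl.2,
      linearCombination_faceBd 𝕜 φ (bdList_mem_supported_isFaceTuple 𝕜 hl.1 hl.2),
      ← TupleChain.bd_single, TupleChain.bd_bd, map_zero]
    rfl
  · exact faceBd_eq_zero 𝕜 _ hl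

open TupleChain in
theorem bdList_smul {H : Type*} [Group H] [MulAction H W] (h : H) (l : List W) :
    bdList 𝕜 (h • l) = map 𝕜 (h • ·) (bdList 𝕜 l) := by
  rw [← bd_single, ← bd_single, ← bd_map, map_single]
  rfl

open TupleChain in
theorem linearCombination_map {T T' : Type*} (φ : List T' → A) (f : T → T') (c : TupleChain 𝕜 T) :
    Finsupp.linearCombination 𝕜 φ (map 𝕜 f c) =
      Finsupp.linearCombination 𝕜 (fun l => φ (l.map f)) c :=
  Finsupp.linearCombination_mapDomain 𝕜 _ _

end FaceBd

/-! ### The double complex -/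

section DoubleCochains

variable {𝕜 : Type*} [RCLike 𝕜] {H : Type u} [Group H] [TopologicalSpace H]
  {W : Type w} [MulAction H W] (X : AbstractSimplicialComplex W) [SimplicialAction X H]
  {A : Type*} [NormedAddCommGroup A] [NormedSpace 𝕜 A] (ρ : ContRepresentation 𝕜 H A)

/-- Equivariant functions of `p` group elements, depending continuously on them, and of a tuple of
`q` vertices of a common simplex. For `p = q = 0` we take the zero module. -/
def doubleCochains (p q : ℕ) : Submodule 𝕜 ((Fin p → H) → List W → A) where
  carrier := {F | (∀ l, Continuous fun x => F x l) ∧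
    (∀ (h : H) x l, F (fun i => h * x i) (h • l) = ρ h (F x l)) ∧
    (∀ x l, ¬(IsFaceTuple X l ∧ l.length = q) → F x l = 0) ∧ (p = 0 → q = 0 → F = 0)}
  zero_mem' := ⟨fun l => continuous_const, fun h x l => by simp, fun x l _ => rfl, fun _ _ => rfl⟩
  add_mem' := by
    rintro F F' ⟨h1, h2, h3, h4⟩ ⟨h1', h2', h3', h4'⟩
    refine ⟨fun l => (h1 l).add (h1' l), fun h x l => ?_, fun x l hl => ?_, fun hp hq => ?_⟩
    · simp [h2, h2']
    · simp [h3 x l hl, h3' x l hl]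
    · rw [h4 hp hq, h4' hp hq, add_zero]
  smul_mem' := by
    rintro a F ⟨h1, h2, h3, h4⟩
    refine ⟨fun l => (h1 l).const_smul a, fun h x l => ?_, fun x l hl => ?_, fun hp hq => ?_⟩
    · simp [h2]
    · simp [h3 x l hl]
    · rw [h4 hp hq, smul_zero]

variable {X ρ}

theorem groupBd_apply_list {p : ℕ} (F : (Fin p → H) → List W → A) (x : Fin (p + 1) → H)
    (l : List W) :
    groupBd 𝕜 (List W → A) p F x l = groupBd 𝕜 A p (fun y => F y l) x :=
  (groupBd_comp_linearMap 𝕜 (LinearMap.proj l) F x).symm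

theorem continuous_groupBd_apply {p : ℕ} {F : (Fin p → H) → A} (hF : Continuous F) :
    Continuous (groupBd 𝕜 A p F) :=
  (continuous_groupBd 𝕜 (Y := PUnit) (F := fun _ => F) (hF.comp continuous_snd)).comp
    (continuous_const.prodMk continuous_id : Continuous fun x => (PUnit.unit, x))

theorem groupBd_mem {p q : ℕ} {F : (Fin p → H) → List W → A} (hF : F ∈ doubleCochains X ρ p q) :
    groupBd 𝕜 (List W → A) p F ∈ doubleCochains X ρ (p + 1) q := by
  obtain ⟨h1, h2, h3, -⟩ := hF
  refine ⟨fun l => ?_, fun h x l => ?_, fun x l hl => ?_, fun hp => by simp at hp⟩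
  · simp only [groupBd_apply_list]
    exact continuous_groupBd_apply (h1 l)
  · rw [groupBd_apply_list, groupBd_apply_list, ← groupBd_comp_map 𝕜 (h * ·)]
    simp only [h2]
    exact groupBd_comp_linearMap 𝕜 (ρ h).toLinearMap _ x
  · rw [groupBd_apply_list]
    simp only [h3 _ l hl]
    exact congrFun (map_zero (groupBd 𝕜 A p)) x

theorem continuous_linearCombination {Y T : Type*} [TopologicalSpace Y] {F : Y → T → A}
    (hF : ∀ l, Continuous fun x => F x l) (c : T →₀ 𝕜) :
    Continuous fun x => Finsupp.linearCombination 𝕜 (F x) c := by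
  simp only [Finsupp.linearCombination_apply, Finsupp.sum]
  exact continuous_finsetSum _ fun l _ => (hF l).const_smul _

open TupleChain in
theorem linearCombination_smul {p q : ℕ} {F : (Fin p → H) → List W → A}
    (hF : F ∈ doubleCochains X ρ p q) (h : H) (x : Fin p → H) (c : TupleChain 𝕜 W) :
    Finsupp.linearCombination 𝕜 (F fun i => h * x i) (map 𝕜 (h • ·) c) =
      ρ h (Finsupp.linearCombination 𝕜 (F x) c) := by
  rw [linearCombination_map]
  have : (fun l : List W => F (fun i => h * x i) (l.map (h • ·))) = fun l => ρ h (F x l) :=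
    funext fun l => hF.2.1 h x l
  rw [this]
  simp [Finsupp.linearCombination_apply, Finsupp.sum, map_sum]

theorem faceBd_mem {p q : ℕ} {F : (Fin p → H) → List W → A} (hF : F ∈ doubleCochains X ρ p q) :
    (fun x => faceBd 𝕜 X A q (F x)) ∈ doubleCochains X ρ p (q + 1) := by
  refine ⟨fun l => ?_, fun h x l => ?_, fun x l hl => faceBd_eq_zero 𝕜 _ hl,
    fun _ hq => by simp at hq⟩
  · by_cases hl : IsFaceTuple X l ∧ l.length = q + 1
    · simp only [faceBd_apply 𝕜 _ hl.1 hl.2]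
      exact continuous_linearCombination hF.1 _
    · simp only [faceBd_eq_zero 𝕜 _ hl]
      exact continuous_const
  · by_cases hl : IsFaceTuple X l ∧ l.length = q + 1
    · beta_reduce
      rw [faceBd_apply 𝕜 _ hl.1 hl.2, faceBd_apply 𝕜 _ ((isFaceTuple_smul h).2 hl.1)
        ((length_smul_list h l).trans hl.2), bdList_smul, linearCombination_smul hF]
    · beta_reduce
      rw [faceBd_eq_zero 𝕜 _ hl, map_zero, faceBd_eq_zero 𝕜 _
        (by rwa [isFaceTuple_smul, length_smul_list])]

variable (X ρ)

/-- The differential of `doubleCochains` in the direction of the group. -/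
def horBd (p q : ℕ) : doubleCochains X ρ p q →ₗ[𝕜] doubleCochains X ρ (p + 1) q :=
  (groupBd 𝕜 (List W → A) p).restrict fun _ => groupBd_mem

/-- The differential of `doubleCochains` in the direction of the simplicial complex. -/
noncomputable def vertBd (p q : ℕ) : doubleCochains X ρ p q →ₗ[𝕜] doubleCochains X ρ p (q + 1) :=
  ((faceBd 𝕜 X A q).compLeft (Fin p → H)).restrict fun _ => faceBd_mem

variable {X ρ}

theorem vertBd_horBd (p q : ℕ) (F : doubleCochains X ρ p q) :
    vertBd X ρ (p + 1) q (horBd X ρ p q F) = horBd X ρ p (q + 1) (vertBd X ρ p q F) :=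
  Subtype.ext (funext fun x => (groupBd_comp_linearMap 𝕜 (faceBd 𝕜 X A q) F.1 x).symm)

theorem horBd_horBd (p q : ℕ) (F : doubleCochains X ρ p q) :
    horBd X ρ (p + 1) q (horBd X ρ p q F) = 0 :=
  Subtype.ext (groupBd_groupBd 𝕜 F.1)

theorem vertBd_vertBd (p q : ℕ) (F : doubleCochains X ρ p q) :
    vertBd X ρ p (q + 1) (vertBd X ρ p q F) = 0 :=
  Subtype.ext (funext fun x => faceBd_faceBd 𝕜 q (F.1 x))

end DoubleCochains


/-! ### Exactness of the double complex -/

section VertExact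

variable {𝕜 : Type*} [RCLike 𝕜] {H : Type u} [Group H] [TopologicalSpace H] [IsTopologicalGroup H]
  {W : Type w} [MulAction H W] {X : AbstractSimplicialComplex W} [SimplicialAction X H]
  {A : Type*} [NormedAddCommGroup A] [NormedSpace 𝕜 A] {ρ : ContRepresentation 𝕜 H A}

open TupleChain

/-- Conjugate of a linear map on chains of tuples by a group element. -/
noncomputable def conjChain (s : TupleChain 𝕜 W →ₗ[𝕜] TupleChain 𝕜 W) (g : H) :
    TupleChain 𝕜 W →ₗ[𝕜] TupleChain 𝕜 W :=
  map 𝕜 (g • ·) ∘ₗ s ∘ₗ map 𝕜 (g⁻¹ • ·)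

theorem conjChain_single (s : TupleChain 𝕜 W →ₗ[𝕜] TupleChain 𝕜 W) (g : H) (l : List W) :
    conjChain s g (Finsupp.single l 1) = map 𝕜 (g • ·) (s (Finsupp.single (g⁻¹ • l) 1)) := by
  rw [conjChain, LinearMap.comp_apply, LinearMap.comp_apply, map_single]
  rfl

theorem map_smul_mem_supported {k : ℕ} (g : H) {c : TupleChain 𝕜 W}
    (hc : c ∈ Finsupp.supported 𝕜 𝕜 {l | IsFaceTuple X l ∧ l.length = k}) :
    map 𝕜 (g • ·) c ∈ Finsupp.supported 𝕜 𝕜 {l | IsFaceTuple X l ∧ l.length = k} := by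
  refine map_mem_supported (fun l hl => ?_) hc
  rw [map_single]
  exact Finsupp.single_mem_supported 𝕜 1
    ⟨(isFaceTuple_smul g).2 hl.1, (length_smul_list g l).trans hl.2⟩

theorem conjChain_contraction {s : TupleChain 𝕜 W →ₗ[𝕜] TupleChain 𝕜 W}
    (hs : ∀ l, IsFaceTuple X l →
      s (Finsupp.single l 1) ∈
        Finsupp.supported 𝕜 𝕜 {l' | IsFaceTuple X l' ∧ l'.length = l.length + 1} ∧
      bd 𝕜 (s (Finsupp.single l 1)) + s (bd 𝕜 (Finsupp.single l 1)) = Finsupp.single l 1)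
    (g : H) {l : List W} (hl : IsFaceTuple X l) :
    conjChain s g (Finsupp.single l 1) ∈
        Finsupp.supported 𝕜 𝕜 {l' | IsFaceTuple X l' ∧ l'.length = l.length + 1} ∧
      bd 𝕜 (conjChain s g (Finsupp.single l 1)) + conjChain s g (bd 𝕜 (Finsupp.single l 1)) =
        Finsupp.single l 1 := by
  obtain ⟨h1, h2⟩ := hs (g⁻¹ • l) ((isFaceTuple_smul g⁻¹).2 hl)
  rw [length_smul_list] at h1
  refine ⟨?_, ?_⟩
  · rw [conjChain_single]
    exact map_smul_mem_supported g h1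
  · have h3 : conjChain s g (bd 𝕜 (Finsupp.single l 1)) =
        map 𝕜 (g • ·) (s (bd 𝕜 (Finsupp.single (g⁻¹ • l) 1))) := by
      rw [conjChain, LinearMap.comp_apply, LinearMap.comp_apply, ← bd_map, map_single]
      rfl
    rw [conjChain_single, h3, bd_map, ← map_add, h2, map_single]
    change Finsupp.single (g • g⁻¹ • l) 1 = _
    rw [smul_inv_smul]

/-- Locally, `conjChain s g c` does not depend on `g`. -/
theorem eventually_conjChain_eq (hH : ActsProperlyCocompactly X H)
    (s : TupleChain 𝕜 W →ₗ[𝕜] TupleChain 𝕜 W) (g₀ : H) (l : List W) :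
    ∀ᶠ g in nhds g₀, conjChain s g (Finsupp.single l 1) = conjChain s g₀ (Finsupp.single l 1) := by
  have h1 : ∀ᶠ g in nhds g₀, g⁻¹ • l = g₀⁻¹ • l :=
    ((isOpen_transporter_list hH l (g₀⁻¹ • l)).preimage continuous_inv).mem_nhds rfl
  have h2 : ∀ᶠ g in nhds g₀, ∀ l' ∈ (s (Finsupp.single (g₀⁻¹ • l) 1)).support,
      g • l' = g₀ • l' :=
    (Filter.eventually_all_finset _).2 fun l' _ =>
      (isOpen_transporter_list hH l' (g₀ • l')).mem_nhds rfl
  filter_upwards [h1, h2] with g hg1 hg2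
  rw [conjChain_single, conjChain_single, hg1]
  refine eqOn_supported (F := map 𝕜 (g • ·)) (F' := map 𝕜 (g₀ • ·))
    (S := {l' | l' ∈ (s (Finsupp.single (g₀⁻¹ • l) 1)).support}) (fun l' hl' => ?_)
    ((Finsupp.mem_supported 𝕜 _).2 subset_rfl)
  rw [map_single, map_single]
  exact congrArg (Finsupp.single · 1) (hg2 l' hl')

/-- The primitive is `F'(x, l) = F(x)(x₀ s x₀⁻¹ l)`. Conjugation by the first argument `x₀` restores
the equivariance that `s` lacks, which is why at least one group argument is required; continuity
holds because the conjugate is locally constant in `x₀`. -/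
theorem mem_imVert_of_vertBd_eq_zero (hH : ActsProperlyCocompactly X H)
    {s : TupleChain 𝕜 W →ₗ[𝕜] TupleChain 𝕜 W}
    (hs : ∀ l, IsFaceTuple X l →
      s (Finsupp.single l 1) ∈
        Finsupp.supported 𝕜 𝕜 {l' | IsFaceTuple X l' ∧ l'.length = l.length + 1} ∧
      bd 𝕜 (s (Finsupp.single l 1)) + s (bd 𝕜 (Finsupp.single l 1)) = Finsupp.single l 1)
    {p q : ℕ} (F : doubleCochains X ρ (p + 1) q) (hF : vertBd X ρ (p + 1) q F = 0) :
    F ∈ imVert (vertBd X ρ) (p + 1) q := by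
  have hF0 : ∀ x, ∀ c ∈ Finsupp.supported 𝕜 𝕜 {l | IsFaceTuple X l ∧ l.length = q + 1},
      Finsupp.linearCombination 𝕜 (F.1 x) (bd 𝕜 c) = 0 := by
    intro x c hc
    rw [← linearCombination_faceBd 𝕜 (F.1 x) hc,
      show faceBd 𝕜 X A q (F.1 x) = 0 from congrFun (congrArg Subtype.val hF) x]
    simp
  have hFs : ∀ x (g : H) l, IsFaceTuple X l → l.length = q →
      Finsupp.linearCombination 𝕜 (F.1 x) (conjChain s g (bd 𝕜 (Finsupp.single l 1))) = F.1 x l := by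
    intro x g l hl hq
    obtain ⟨h1, h2⟩ := conjChain_contraction hs g hl
    have h3 := congrArg (Finsupp.linearCombination 𝕜 (F.1 x)) h2
    rw [map_add, hF0 x _ (by rwa [hq] at h1), zero_add, Finsupp.linearCombination_single,
      one_smul] at h3
    exact h3
  cases q with
  | zero =>
    -- Here the incoming image is `⊥`, so `F` itself must vanish. On the empty tuple, `bd [] = 0`
    -- forces this through the contraction identity.
    refine Subtype.ext (funext fun x => funext fun l => ?_)
    by_cases hl : IsFaceTuple X l ∧ l.length = 0
    · rw [← hFs x 1 l hl.1 hl.2, List.length_eq_zero_iff.1 hl.2, bd_single, bdList, map_zero,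
        map_zero]
      rfl
    · exact F.2.2.2.1 x l hl
  | succ q =>
    classical
    let F' : (Fin (p + 1) → H) → List W → A := fun x l =>
      if IsFaceTuple X l ∧ l.length = q then
        Finsupp.linearCombination 𝕜 (F.1 x) (conjChain s (x 0) (Finsupp.single l 1)) else 0
    have hF' : F' ∈ doubleCochains X ρ (p + 1) q := by
      refine ⟨fun l => ?_, fun h x l => ?_, fun x l hl => if_neg hl, fun hp => by simp at hp⟩
      · by_cases hl : IsFaceTuple X l ∧ l.length = q
        · simp only [F', if_pos hl]
          refine continuous_iff_continuousAt.2 fun x₀ => ?_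
          have h1 := (continuous_linearCombination F.2.1
            (conjChain s (x₀ 0) (Finsupp.single l 1))).continuousAt (x := x₀)
          refine h1.congr ?_
          have h2 := (continuous_apply (A := fun _ => H) (0 : Fin (p + 1))).continuousAt.eventually
            (eventually_conjChain_eq hH s (x₀ 0) l)
          filter_upwards [h2] with x hx
          rw [hx]
        · simp only [F', if_neg hl]
          exact continuous_const
      · by_cases hl : IsFaceTuple X l ∧ l.length = q
        · simp only [F', if_pos hl, isFaceTuple_smul, length_smul_list]
          rw [← linearCombination_smul F.2, conjChain_single, conjChain_single, map_map, mul_inv_rev,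
            mul_smul, inv_smul_smul]
          have h1 : ((h * x 0) • · : W → W) = (h • ·) ∘ (x 0 • ·) := funext fun y => mul_smul h (x 0) y
          rw [h1]
        · simp only [F', if_neg hl, isFaceTuple_smul, length_smul_list, map_zero]
    refine ⟨⟨F', hF'⟩, Subtype.ext (funext fun x => funext fun l => ?_)⟩
    change faceBd 𝕜 X A q (F' x) l = F.1 x l
    by_cases hl : IsFaceTuple X l ∧ l.length = q + 1
    · rw [faceBd_apply 𝕜 _ hl.1 hl.2, ← hFs x (x 0) l hl.1 hl.2, bd_single]
      refine eqOn_supported (F' := Finsupp.linearCombination 𝕜 (F.1 x) ∘ₗ conjChain s (x 0))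
        (fun l' hl' => ?_) (bdList_mem_supported_isFaceTuple 𝕜 hl.1 hl.2)
      rw [Finsupp.linearCombination_single, one_smul]
      exact if_pos hl'
    · rw [faceBd_eq_zero 𝕜 _ hl, F.2.2.2.1 x l hl]

end VertExact

/-! ### Exactness in the group direction, by averaging over stabilizer cosets. -/

section HorExact

variable {𝕜 : Type*} [RCLike 𝕜] {H : Type u} [Group H] [TopologicalSpace H] [IsTopologicalGroup H]
  [T2Space H] [MeasurableSpace H] [BorelSpace H]
  {W : Type w} [MulAction H W] {X : AbstractSimplicialComplex W} [SimplicialAction X H]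
  {A : Type*} [NormedAddCommGroup A] [NormedSpace 𝕜 A] [NormedSpace ℝ A] {ρ : ContRepresentation 𝕜 H A}

theorem groupBd_setIntegral (μ : Measure H) [IsFiniteMeasureOnCompacts μ] {E : Set H}
    (hE : IsCompact E)
    {p : ℕ} {F : H → (Fin p → H) → A} (hF : Continuous fun z : H × (Fin p → H) => F z.1 z.2)
    (x : Fin (p + 1) → H) :
    groupBd 𝕜 A p (fun z => ∫ y in E, F y z ∂μ) x = ∫ y in E, groupBd 𝕜 A p (F y) x ∂μ := by
  induction p with
  | zero => rfl
  | succ p ih =>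
    have h1 : Continuous fun z : H × (Fin p → H) => F z.1 (Fin.cons (x 0) z.2) :=
      hF.comp (continuous_fst.prodMk (Continuous.finCons (A := fun _ => H) continuous_const
        continuous_snd))
    have h2 := continuous_groupBd 𝕜 (F := fun y z => F y (Fin.cons (x 0) z)) h1
    simp only [groupBd_succ_apply]
    rw [ih h1, integral_sub]
    · exact (hF.comp (continuous_id.prodMk continuous_const)).continuousOn.integrableOn_compact hE
    · exact (h2.comp (continuous_id.prodMk continuous_const)).continuousOn.integrableOn_compact hE

/-- Because `E` is clopen, cutting off by its indicator keeps the integrand jointly continuous, with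
support in the compact set `E`. -/
theorem continuous_setIntegral (μ : Measure H) [IsFiniteMeasureOnCompacts μ] {E : Set H}
    (hE : IsCompact E) (hE' : IsClopen E) {Y : Type*} [TopologicalSpace Y] {F : H → Y → A}
    (hF : Continuous fun z : H × Y => F z.1 z.2) : Continuous fun x => ∫ y in E, F y x ∂μ := by
  have h1 : Continuous fun z : Y × H => E.indicator (fun y => F y z.1) z.2 := by
    have h2 : IsClopen (Prod.snd ⁻¹' E : Set (Y × H)) := hE'.preimage continuous_snd
    refine (continuous_indicator (s := Prod.snd ⁻¹' E) (f := fun z : Y × H => F z.2 z.1)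
      (fun a ha => ?_) (hF.comp continuous_swap).continuousOn)
    rw [h2.frontier_eq] at ha
    exact ha.elim
  have h3 := continuousOn_integral_of_compact_support (μ := μ)
    (f := fun x y => E.indicator (fun y => F y x) y) (s := Set.univ) hE h1.continuousOn
    (fun x y _ hy => Set.indicator_of_notMem hy _)
  simp only [integral_indicator hE'.isOpen.measurableSet, continuousOn_univ] at h3
  exact h3

end HorExact

section

variable {𝕜 : Type*} [RCLike 𝕜] {H : Type u} [Group H] [TopologicalSpace H] [IsTopologicalGroup H]
  [T2Space H] [MeasurableSpace H] [BorelSpace H] (μ : Measure H) [μ.IsHaarMeasure]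
  {W : Type w} [MulAction H W] {X : AbstractSimplicialComplex W} [SimplicialAction X H]
  {A : Type*} [NormedAddCommGroup A] [NormedSpace 𝕜 A] [CompleteSpace A]
  {ρ : ContRepresentation 𝕜 H A}

variable (H) in
/-- The elements moving the chosen representative of the orbit of `l` to `l`. -/
def fromRep (l : List W) : Set H :=
  {y | y • (Quotient.out (Quotient.mk'' l : MulAction.orbitRel.Quotient H (List W))) = l}

theorem fromRep_nonempty (l : List W) : (fromRep H l).Nonempty := by
  obtain ⟨y, hy⟩ : Quotient.out (Quotient.mk'' l : MulAction.orbitRel.Quotient H (List W)) ∈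
      MulAction.orbit H l := Quotient.exact (Quotient.out_eq
        (Quotient.mk'' l : MulAction.orbitRel.Quotient H (List W)))
  refine ⟨y⁻¹, ?_⟩
  have hy : y • l = _ := hy
  change y⁻¹ • _ = l
  rw [← hy, inv_smul_smul]

/-- The tuples `l` and `h • l` share an orbit representative, so the averaging sets form an
equivariant family. -/
theorem preimage_fromRep_smul (h : H) (l : List W) :
    (h * ·) ⁻¹' fromRep H (h • l) = fromRep H l := by
  have h1 : (Quotient.mk'' (h • l) : MulAction.orbitRel.Quotient H (List W)) = Quotient.mk'' l :=
    Quotient.sound ⟨h, rfl⟩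
  ext y
  change (h * y) • Quotient.out (Quotient.mk'' (h • l) : MulAction.orbitRel.Quotient H (List W)) =
    h • l ↔ y • _ = l
  rw [h1, mul_smul, smul_left_cancel_iff]

include μ in
-- For each fixed `y`, the cocycle identity makes `F(y, ·)` a primitive of `F`, but not an
-- equivariant one. Averaging `y` over the compact open set `fromRep H l` repairs this, by left
-- invariance of `μ` and equivariance of these sets; compactness needs a nonempty tuple.
theorem mem_imHor_of_horBd_eq_zero (hH : ActsProperlyCocompactly X H) {p q : ℕ}
    (F : doubleCochains X ρ p (q + 1)) (hF : horBd X ρ p (q + 1) F = 0) :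
    F ∈ imHor (horBd X ρ) p (q + 1) := by
  classical
  have hF0 : ∀ x l, groupBd 𝕜 A p (fun y => F.1 y l) x = 0 := fun x l => by
    rw [← groupBd_apply_list]
    exact congrFun (congrFun (congrArg Subtype.val hF) x) l
  cases p with
  | zero =>
    refine Subtype.ext (funext fun x => funext fun l => ?_)
    rw [show x = Fin.tail (fun _ : Fin 1 => (1 : H)) from Subsingleton.elim _ _]
    exact hF0 (fun _ => 1) l
  | succ p =>
    let _ : NormedSpace ℝ A := NormedSpace.restrictScalars ℝ 𝕜 A
    have : IsScalarTower ℝ 𝕜 A := IsScalarTower.restrictScalars ℝ 𝕜 A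
    have hclopen : ∀ l : List W, IsClopen (fromRep H l) := fun l =>
      ⟨isClosed_transporter_list hH _ l, isOpen_transporter_list hH _ l⟩
    have hcompact : ∀ l : List W, l.length = q + 1 → IsCompact (fromRep H l) := fun l hl => by
      refine isCompact_transporter_list hH (fun h => ?_) l
      obtain ⟨y, hy⟩ := fromRep_nonempty (H := H) l
      rw [fromRep, Set.mem_ofPred_eq, h, smul_list_nil] at hy
      rw [← hy] at hl
      simp at hl
    have hcons : ∀ l, Continuous fun z : H × (Fin p → H) => F.1 (Fin.cons z.1 z.2) l := fun l =>
      (F.2.1 l).comp (Continuous.finCons (A := fun _ => H) continuous_fst continuous_snd)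
    let F' : (Fin p → H) → List W → A := fun x l =>
      if IsFaceTuple X l ∧ l.length = q + 1 then
        ((μ.real (fromRep H l) : ℝ) : 𝕜)⁻¹ • ∫ y in fromRep H l, F.1 (Fin.cons y x) l ∂μ else 0
    have hF' : F' ∈ doubleCochains X ρ p (q + 1) := by
      refine ⟨fun l => ?_, fun h x l => ?_, fun x l hl => if_neg hl, fun _ hq => by simp at hq⟩
      · by_cases hl : IsFaceTuple X l ∧ l.length = q + 1
        · simp only [F', if_pos hl]
          exact (continuous_setIntegral μ (hcompact l hl.2) (hclopen l) (hcons l)).const_smul _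
        · simp only [F', if_neg hl]
          exact continuous_const
      · by_cases hl : IsFaceTuple X l ∧ l.length = q + 1
        · simp only [F', isFaceTuple_smul, length_smul_list, if_pos hl]
          have h1 : μ.real (fromRep H (h • l)) = μ.real (fromRep H l) := by
            rw [← preimage_fromRep_smul h l, measureReal_def, measureReal_def,
              measure_preimage_mul]
          have h2 : ∫ y in fromRep H (h • l), F.1 (Fin.cons y fun i => h * x i) (h • l) ∂μ =
              ρ h (∫ y in fromRep H l, F.1 (Fin.cons y x) l ∂μ) := by
            rw [← (measurePreserving_mul_left μ h).setIntegral_preimage_emb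
              (measurableEmbedding_mulLeft h), preimage_fromRep_smul,
              ← ContinuousLinearMap.integral_comp_comm]
            · refine setIntegral_congr_fun (hclopen l).isOpen.measurableSet fun y _ => ?_
              beta_reduce
              rw [← F.2.2.1]
              refine congrFun (congrArg F.1 (funext fun i => ?_)) _
              cases i using Fin.cases <;> rfl
            · exact ((hcons l).comp (continuous_id.prodMk
                continuous_const)).continuousOn.integrableOn_compact (hcompact l hl.2)
          rw [h1, h2, map_smul]
        · simp only [F', isFaceTuple_smul, length_smul_list, if_neg hl, map_zero]
    refine ⟨⟨F', hF'⟩, Subtype.ext (funext fun x => funext fun l => ?_)⟩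
    change groupBd 𝕜 (List W → A) p F' x l = F.1 x l
    rw [groupBd_apply_list]
    by_cases hl : IsFaceTuple X l ∧ l.length = q + 1
    · simp only [F', if_pos hl]
      have h1 : groupBd 𝕜 A p (fun y => ((μ.real (fromRep H l) : ℝ) : 𝕜)⁻¹ •
          ∫ z in fromRep H l, F.1 (Fin.cons z y) l ∂μ) x = ((μ.real (fromRep H l) : ℝ) : 𝕜)⁻¹ •
          groupBd 𝕜 A p (fun y => ∫ z in fromRep H l, F.1 (Fin.cons z y) l ∂μ) x :=
        groupBd_comp_linearMap 𝕜 (LinearMap.lsmul 𝕜 A ((μ.real (fromRep H l) : ℝ) : 𝕜)⁻¹) _ x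
      rw [h1, groupBd_setIntegral μ (hcompact l hl.2)
        (F := fun z y => F.1 (Fin.cons z y) l) (hcons l)]
      have h2 : ∀ z, groupBd 𝕜 A p (fun y => F.1 (Fin.cons z y) l) x = F.1 x l := fun z => by
        have h3 := hF0 (Fin.cons z x) l
        rw [groupBd_succ_cons, sub_eq_zero] at h3
        exact h3.symm
      have h4 : μ.real (fromRep H l) ≠ 0 := by
        rw [measureReal_def, ENNReal.toReal_ne_zero]
        exact ⟨((hclopen l).isOpen.measure_pos μ (fromRep_nonempty l)).ne',
          (hcompact l hl.2).measure_ne_top⟩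
      simp only [h2]
      rw [setIntegral_const, RCLike.real_smul_eq_coe_smul (K := 𝕜), smul_smul, inv_mul_cancel₀,
        one_smul]
      exact_mod_cast h4
    · simp only [F', if_neg hl]
      rw [F.2.2.2.1 x l hl]
      exact congrFun (map_zero (groupBd 𝕜 A p)) x

end


/-! ### Continuous cohomology in terms of functions of several variables -/

section Homology

open CategoryTheory Limits

/-- Homology in `TopModuleCat` may be computed from the concrete kernel and cokernel, whose
underlying modules are the algebraic ones. -/
theorem nonempty_shortComplex_homology_equiv {R : Type*} [Ring R] [TopologicalSpace R]
    (S : ShortComplex (TopModuleCat R)) :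
    Nonempty (S.homology ≃ₗ[R] MidHomology S.f.hom.toLinearMap S.g.hom.toLinearMap) := by
  let D : S.LeftHomologyData :=
    ⟨_, _, _, _, _, TopModuleCat.isLimitKer _, by simp, TopModuleCat.isColimitCoker _⟩
  let e := (D.homologyIso).toContinuousLinearEquiv.toLinearEquiv
  have hf' : ∀ x, (D.f'.hom x : LinearMap.ker S.g.hom.toLinearMap).1 = S.f.hom x := fun x => by
    have := ConcreteCategory.congr_hom D.f'_i x
    exact this
  obtain ⟨e'⟩ := nonempty_quotient_equiv (R := R)
    (LinearMap.id : LinearMap.ker S.g.hom.toLinearMap →ₗ[R] LinearMap.ker S.g.hom.toLinearMap)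
    Function.surjective_id (LinearMap.range D.f'.hom.toLinearMap)
    ((LinearMap.range S.f.hom.toLinearMap).submoduleOf (LinearMap.ker S.g.hom.toLinearMap)) (by
      intro x
      constructor
      · rintro ⟨y, hy⟩
        exact ⟨y, Subtype.ext ((hf' y).trans hy)⟩
      · rintro ⟨y, rfl⟩
        exact ⟨y, (hf' y).symm⟩)
  exact ⟨e.trans e'⟩

/-- Only the image and the kernel in the middle have to correspond, not the outer terms; degree zero
needs this, where the incoming terms of the two complexes differ. -/
theorem nonempty_homology_equiv_of_linearEquiv {R M₁ M₂ M₃ N₁ N₂ N₃ : Type*} [Ring R]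
    [AddCommGroup M₁] [Module R M₁] [AddCommGroup M₂] [Module R M₂] [AddCommGroup M₃] [Module R M₃]
    [AddCommGroup N₁] [Module R N₁] [AddCommGroup N₂] [Module R N₂] [AddCommGroup N₃] [Module R N₃]
    (f : M₁ →ₗ[R] M₂) (g : M₂ →ₗ[R] M₃) (f' : N₁ →ₗ[R] N₂) (g' : N₂ →ₗ[R] N₃)
    (e₂ : M₂ ≃ₗ[R] N₂) (hf : (LinearMap.range f).map e₂.toLinearMap = LinearMap.range f')
    (hg : (LinearMap.ker g).map e₂.toLinearMap = LinearMap.ker g') :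
    Nonempty (MidHomology f g ≃ₗ[R] MidHomology f' g') := by
  let e := (e₂.submoduleMap (LinearMap.ker g)).trans (LinearEquiv.ofEq _ _ hg)
  refine nonempty_quotient_equiv e.toLinearMap e.surjective _ _ fun x => ?_
  rw [Submodule.submoduleOf, Submodule.submoduleOf, Submodule.mem_comap, Submodule.mem_comap,
    ← hf]
  exact e₂.injective.mem_set_image (s := (LinearMap.range f : Set M₂))

theorem nonempty_homology_equiv_of_comm {R M₁ M₂ M₃ N₁ N₂ N₃ : Type*} [Ring R]
    [AddCommGroup M₁] [Module R M₁] [AddCommGroup M₂] [Module R M₂] [AddCommGroup M₃] [Module R M₃]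
    [AddCommGroup N₁] [Module R N₁] [AddCommGroup N₂] [Module R N₂] [AddCommGroup N₃] [Module R N₃]
    (f : M₁ →ₗ[R] M₂) (g : M₂ →ₗ[R] M₃) (f' : N₁ →ₗ[R] N₂) (g' : N₂ →ₗ[R] N₃)
    (e₁ : M₁ → N₁) (he₁ : Function.Surjective e₁) (e₂ : M₂ ≃ₗ[R] N₂) (e₃ : M₃ →ₗ[R] N₃)
    (he₃ : Function.Injective e₃)
    (hf : ∀ x, e₂ (f x) = f' (e₁ x)) (hg : ∀ x, e₃ (g x) = g' (e₂ x)) :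
    Nonempty (MidHomology f g ≃ₗ[R] MidHomology f' g') := by
  refine nonempty_homology_equiv_of_linearEquiv f g f' g' e₂ ?_ ?_
  · ext y
    constructor
    · rintro ⟨_, ⟨x, rfl⟩, rfl⟩
      exact ⟨e₁ x, (hf x).symm⟩
    · rintro ⟨y, rfl⟩
      obtain ⟨x, rfl⟩ := he₁ y
      exact ⟨f x, ⟨x, rfl⟩, hf x⟩
  · have key : ∀ x, x ∈ LinearMap.ker g ↔ e₂ x ∈ LinearMap.ker g' := fun x => by
      rw [LinearMap.mem_ker, LinearMap.mem_ker, ← hg, map_eq_zero_iff _ he₃]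
    ext y
    constructor
    · rintro ⟨x, hx, rfl⟩
      exact (key x).1 hx
    · intro hy
      refine ⟨e₂.symm y, (key _).2 ?_, e₂.apply_symm_apply y⟩
      rwa [e₂.apply_symm_apply]

end Homology

/-! ### The standard resolution as functions of several variables. -/

section Resolution

variable {𝕜 : Type*} [RCLike 𝕜] {H : Type u} [Group H] [TopologicalSpace H] [IsTopologicalGroup H]

open TopRep

/-- Iterated evaluation of the elements of `C(H, C(H, …, A))`. -/
def resolutionEval (A : TopRep.{max u v} 𝕜 H) :
    ∀ p, resolutionX A p →ₗ[𝕜] ((Fin p → H) → A)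
  | 0 => LinearMap.pi fun _ => LinearMap.id
  | p + 1 => LinearMap.pi fun x => LinearMap.proj (Fin.tail x) ∘ₗ resolutionEval A p ∘ₗ
      (ContinuousMap.evalCLM (M := resolutionX A p) 𝕜 (x 0)).toLinearMap

variable (A : TopRep.{max u v} 𝕜 H)

theorem resolutionEval_zero (f : resolutionX A 0) (x : Fin 0 → H) : resolutionEval A 0 f x = f := rfl

theorem resolutionEval_succ {p : ℕ} (f : C(H, resolutionX A p)) (x : Fin (p + 1) → H) :
    resolutionEval A (p + 1) f x = resolutionEval A p (f (x 0)) (Fin.tail x) := rfl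

theorem resolutionEval_injective (p : ℕ) : Function.Injective (resolutionEval A p) := by
  induction p with
  | zero => exact fun f f' h => congrFun h Fin.elim0
  | succ p ih =>
    intro f f' h
    refine ContinuousMap.ext fun a => ih (funext fun x => ?_)
    have := congrFun h (Fin.cons a x)
    rwa [resolutionEval_succ, resolutionEval_succ, Fin.cons_zero, Fin.tail_cons] at this

theorem resolutionEval_d {p : ℕ} (f : resolutionX A p) :
    resolutionEval A (p + 1) ((d A p).hom f) = groupBd 𝕜 A p (resolutionEval A p f) := by
  induction p with
  | zero => rfl
  | succ p ih =>
    funext x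
    rw [groupBd_succ_apply]
    have h1 : resolutionEval A (p + 2) ((d A (p + 1)).hom f) x =
        resolutionEval A (p + 1) f (Fin.tail x) -
          resolutionEval A (p + 1) ((d A p).hom ((f : C(H, resolutionX A p)) (x 0))) (Fin.tail x) := by
      rw [← Pi.sub_apply, ← map_sub]
      rfl
    rw [h1, ih]
    rfl

theorem resolutionEval_action {p : ℕ} (h : H) (f : resolutionX A p) (x : Fin p → H) :
    resolutionEval A p ((resolutionX A p).ρ h f) x =
      A.ρ h (resolutionEval A p f fun i => h⁻¹ * x i) := by
  induction p with
  | zero => rfl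
  | succ p ih => exact ih _ _

variable [LocallyCompactSpace H]

/-- Local compactness of `H` makes evaluation on `C(H, ·)` jointly continuous; `Y` collects the
arguments already inserted. -/
theorem continuous_resolutionEval {p : ℕ} {Y : Type u} [TopologicalSpace Y]
    {f : Y → resolutionX A p} (hf : Continuous f) :
    Continuous fun z : Y × (Fin p → H) => resolutionEval A p (f z.1) z.2 := by
  induction p generalizing Y with
  | zero => exact hf.comp continuous_fst
  | succ p ih =>
    have h1 : Continuous fun z : Y × H => (f z.1 : C(H, resolutionX A p)) z.2 :=
      ContinuousEval.continuous_eval.comp (hf.prodMap continuous_id)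
    exact (ih h1).comp ((continuous_fst.prodMk ((continuous_apply (0 : Fin (p + 1))).comp
      continuous_snd)).prodMk (continuous_pi fun i : Fin p => (continuous_apply i.succ).comp
      continuous_snd))

theorem exists_resolutionEval_eq {p : ℕ} {Y : Type u} [TopologicalSpace Y]
    {F : Y → (Fin p → H) → A} (hF : Continuous fun z : Y × (Fin p → H) => F z.1 z.2) :
    ∃ f : C(Y, resolutionX A p), ∀ y, resolutionEval A p (f y) = F y := by
  induction p generalizing Y with
  | zero =>
    refine ⟨⟨fun y => F y Fin.elim0, hF.comp (continuous_id.prodMk continuous_const)⟩,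
      fun y => funext fun x => ?_⟩
    rw [resolutionEval_zero]
    exact congrArg (F y) (Subsingleton.elim _ _)
  | succ p ih =>
    obtain ⟨f, hf⟩ := ih (Y := Y × H) (F := fun y x => F y.1 (Fin.cons y.2 x)) (by
      refine hF.comp ((continuous_fst.comp continuous_fst).prodMk ?_)
      exact Continuous.finCons (A := fun _ => H) (continuous_snd.comp continuous_fst)
        continuous_snd)
    refine ⟨f.curry, fun y => funext fun x => ?_⟩
    rw [resolutionEval_succ, ContinuousMap.curry_apply, hf]
    exact congrArg (F y) (Fin.cons_self_tail x)

end Resolution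

/-! ### The edge `q = 0` computes continuous cohomology. -/

section Comparison

variable {𝕜 : Type*} [RCLike 𝕜] {H : Type u} [Group H] [TopologicalSpace H] [IsTopologicalGroup H]
  [LocallyCompactSpace H]
  {W : Type w} [MulAction H W] {X : AbstractSimplicialComplex W} [SimplicialAction X H]
  {A : Type (max u v)} [NormedAddCommGroup A] [NormedSpace 𝕜 A] (ρ : ContRepresentation 𝕜 H A)

open TopRep CategoryTheory

open Classical in
-- For `q = 0` a double cochain lives on the empty tuple alone. Invariance of an element of the
-- resolution is the equivariance of its several-variable form.
theorem exists_invariants_equiv (hX : IsFaceTuple X []) (p : ℕ) :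
    ∃ e : (resolutionX (TopRep.of ρ) (p + 1)).ρ.invariants ≃ₗ[𝕜] doubleCochains X ρ (p + 1) 0,
      ∀ f x l, (e f).1 x l = if l = [] then resolutionEval (TopRep.of ρ) (p + 1) f.1 x else 0 := by
  have hmem : ∀ f : (resolutionX (TopRep.of ρ) (p + 1)).ρ.invariants,
      (fun x (l : List W) => if l = [] then resolutionEval (TopRep.of ρ) (p + 1) f.1 x else 0) ∈
        doubleCochains X ρ (p + 1) 0 := by
    refine fun f => ⟨fun l => ?_, fun h x l => ?_, fun x l hl => if_neg ?_, fun hp => by simp at hp⟩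
    · by_cases hl : l = []
      · simp only [if_pos hl]
        exact (continuous_resolutionEval (TopRep.of ρ) (Y := PUnit) (f := fun _ => f.1)
          continuous_const).comp
          (continuous_const.prodMk continuous_id : Continuous fun x => (PUnit.unit, x))
      · simp only [if_neg hl]
        exact continuous_const
    · cases l with
      | nil =>
        beta_reduce
        rw [smul_list_nil, if_pos rfl, if_pos rfl, ← f.2 h, resolutionEval_action]
        simp only [inv_mul_cancel_left]
        rw [f.2 h]
      | cons a l =>
        beta_reduce
        rw [smul_cons, if_neg (by simp), if_neg (by simp), map_zero]
    · rintro rfl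
      exact hl ⟨hX, rfl⟩
  let e : (resolutionX (TopRep.of ρ) (p + 1)).ρ.invariants →ₗ[𝕜] doubleCochains X ρ (p + 1) 0 :=
    { toFun := fun f => ⟨_, hmem f⟩
      map_add' := fun f f' => by
        ext x l
        by_cases hl : l = [] <;> simp [hl]
      map_smul' := fun a f => by
        ext x l
        by_cases hl : l = [] <;> simp [hl] }
  have hinj : Function.Injective e := fun f f' h => by
    refine Subtype.ext (resolutionEval_injective _ _ (funext fun x => ?_))
    simpa [e] using congrFun (congrFun (congrArg Subtype.val h) x) []
  have hsurj : Function.Surjective e := fun F => by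
    obtain ⟨f, hf⟩ := exists_resolutionEval_eq (TopRep.of ρ) (p := p + 1) (Y := PUnit.{u + 1})
      (F := fun _ x => F.1 x []) ((F.2.1 []).comp continuous_snd)
    have hf := hf PUnit.unit
    refine ⟨⟨f PUnit.unit, fun h => resolutionEval_injective _ _ (funext fun x => ?_)⟩,
      Subtype.ext (funext fun x => funext fun l => ?_)⟩
    · rw [resolutionEval_action, hf]
      change ρ h (F.1 _ []) = F.1 x []
      rw [← F.2.2.1, smul_list_nil]
      simp only [mul_inv_cancel_left]
    · change (if l = [] then resolutionEval (TopRep.of ρ) (p + 1) (f PUnit.unit) x else 0) = _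
      split_ifs with hl
      · rw [hf, hl]
      · exact (F.2.2.2.1 x l fun h => hl (List.length_eq_zero_iff.1 h.2)).symm
  exact ⟨LinearEquiv.ofBijective e ⟨hinj, hsurj⟩, fun f x l => rfl⟩

theorem nonempty_continuousCohomology_equiv (hX : IsFaceTuple X []) (n : ℕ) :
    Nonempty (continuousCohomology n (TopRep.of ρ) ≃ₗ[𝕜]
      MidHomology (horBd X ρ n 0) (horBd X ρ (n + 1) 0)) := by
  classical
  let K := homogeneousCochains (TopRep.of ρ)
  obtain ⟨E, hE⟩ : ∃ e : ∀ p, (resolutionX (TopRep.of ρ) (p + 1)).ρ.invariants ≃ₗ[𝕜]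
      doubleCochains X ρ (p + 1) 0, ∀ p f x l, (e p f).1 x l =
        if l = [] then resolutionEval (TopRep.of ρ) (p + 1) f.1 x else 0 :=
    ⟨fun p => (exists_invariants_equiv ρ hX p).choose,
      fun p => (exists_invariants_equiv ρ hX p).choose_spec⟩
  have hd : ∀ p f, E (p + 1) ((K.d p (p + 1)).hom f) = horBd X ρ (p + 1) 0 (E p f) := by
    intro p f
    refine Subtype.ext (funext fun x => funext fun l => ?_)
    refine (hE (p + 1) _ x l).trans ?_
    change _ = groupBd 𝕜 (List W → A) (p + 1) (E p f).1 x l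
    rw [groupBd_apply_list]
    rw [show (fun y => (E p f).1 y l) =
      fun y => if l = [] then resolutionEval (TopRep.of ρ) (p + 1) f.1 y else 0 from
        funext fun y => hE p f y l]
    split_ifs with hl
    · have h1 : ((K.d p (p + 1)).hom f).1 = (d (TopRep.of ρ) (p + 1)).hom f.1 :=
        homogeneousCochains.d_apply (TopRep.of ρ) p f
      rw [h1, resolutionEval_d]
    · exact (congrFun (map_zero (groupBd 𝕜 A (p + 1))) x).symm
  cases n with
  | zero =>
    -- Degree zero has no predecessor; the convention puts degree `0` there again with zero
    -- differential. This matches the zero module at the corner of the double complex.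
    obtain ⟨e⟩ := nonempty_shortComplex_homology_equiv (K.sc' 0 0 1)
    let e0 := (ShortComplex.homologyMapIso
      (K.isoSc' 0 0 1 (by simp) (by simp))).toContinuousLinearEquiv.toLinearEquiv
    have h0 : (K.sc' 0 0 1).f = 0 := K.shape _ _ (by simp)
    obtain ⟨e'⟩ := nonempty_homology_equiv_of_linearEquiv (K.sc' 0 0 1).f.hom.toLinearMap
      (K.sc' 0 0 1).g.hom.toLinearMap (horBd X ρ 0 0) (horBd X ρ 1 0) (E 0)
      (by
        have h1 : horBd X ρ 0 0 = 0 := LinearMap.ext fun F => by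
          rw [show F = 0 from Subtype.ext (F.2.2.2.2 rfl rfl), map_zero, map_zero]
        rw [h1, h0, LinearMap.range_zero]
        exact (congrArg _ LinearMap.range_zero).trans (Submodule.map_bot _))
      (by
        ext y
        constructor
        · rintro ⟨x, hx, rfl⟩
          exact (hd 0 x).symm.trans ((congrArg (E 1) hx).trans (map_zero _))
        · intro hy
          refine ⟨(E 0).symm y, (E 1).injective ?_, (E 0).apply_symm_apply y⟩
          refine (hd 0 _).trans ?_
          rw [LinearEquiv.apply_symm_apply]
          exact LinearMap.mem_ker.1 hy |>.trans (map_zero (E 1)).symm)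
    exact ⟨e0.trans (e.trans e')⟩
  | succ n =>
    obtain ⟨e⟩ := nonempty_shortComplex_homology_equiv (K.sc' n (n + 1) (n + 2))
    let e0 := (ShortComplex.homologyMapIso
      (K.isoSc' n (n + 1) (n + 2) (by simp) (by simp))).toContinuousLinearEquiv.toLinearEquiv
    obtain ⟨e'⟩ := nonempty_homology_equiv_of_comm (K.sc' n (n + 1) (n + 2)).f.hom.toLinearMap
      (K.sc' n (n + 1) (n + 2)).g.hom.toLinearMap (horBd X ρ (n + 1) 0) (horBd X ρ (n + 2) 0)
      (E n) (E n).surjective (E (n + 1)) (E (n + 2)).toLinearMap (E (n + 2)).injective (hd n)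
      (hd (n + 1))
    exact ⟨e0.trans (e.trans e')⟩

end Comparison

section

variable {𝕜 : Type*} [RCLike 𝕜] {H : Type u} [Group H] [TopologicalSpace H] [IsTopologicalGroup H]
  [LocallyCompactSpace H] [T2Space H] [MeasurableSpace H] [BorelSpace H]
  {W : Type w} [MulAction H W] {X : AbstractSimplicialComplex W} [SimplicialAction X H]
  {A : Type (max u v)} [NormedAddCommGroup A] [NormedSpace 𝕜 A] [CompleteSpace A]

open TopRep in
/-- Continuous cohomology of a group acting properly and cocompactly on a contractible complex is
computed by the equivariant cochains of the complex. -/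
theorem nonempty_continuousCohomology_equiv_vertBd (ρ : ContRepresentation 𝕜 H A)
    (hH : ActsProperlyCocompactly X H) {N : ℕ} (hN : ∀ s ∈ X.faces, s.card ≤ N + 1)
    [ContractibleSpace (Realization X)] (n : ℕ) :
    Nonempty (continuousCohomology n (TopRep.of ρ) ≃ₗ[𝕜]
      MidHomology (vertBd X ρ 0 n) (vertBd X ρ 0 (n + 1))) := by
  obtain ⟨x⟩ : Nonempty (Realization X) := inferInstance
  have hX : IsFaceTuple X [] := ⟨_, x.support_mem, by simp⟩
  obtain ⟨s, hs⟩ := exists_contraction 𝕜 hN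
  obtain ⟨e⟩ := nonempty_cohomology_equiv_of_exact (dh := horBd X ρ) (dv := vertBd X ρ)
    vertBd_horBd horBd_horBd vertBd_vertBd
    (fun p q F hF => mem_imHor_of_horBd_eq_zero Measure.haar hH F hF)
    (fun p q F hF => mem_imVert_of_vertBd_eq_zero hH hs F hF) n
  obtain ⟨e'⟩ := nonempty_continuousCohomology_equiv ρ hX n
  exact ⟨e'.trans e.symm⟩

end


/-! ### Fundamental domains -/

section Topology

variable {W : Type w} {X : AbstractSimplicialComplex W} {H : Type*} [Group H]
  [MulAction H W] [SimplicialAction X H] [TopologicalSpace H]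

theorem countable_vertices_of_countable [Countable H] (hH : ActsProperlyCocompactly X H) :
    Countable W := by
  obtain ⟨R, hR⟩ := exists_finite_vertex_orbits hH
  have : Function.Surjective fun z : H × R => z.1 • (z.2 : W) := fun x => by
    obtain ⟨h, r, hr, hx⟩ := hR x
    exact ⟨(h, ⟨r, hr⟩), hx⟩
  exact this.countable

/-- The group is the union, over the countably many vertices `y`, of the compact transporters from
`x` to `y`. -/
theorem sigmaCompactSpace_of_countable_vertices [Countable W] (x : W)
    (hH : ActsProperlyCocompactly X H) : SigmaCompactSpace H := by
  have h : ⋃ y, {h : H | h • x = y} = Set.univ := Set.iUnion_eq_univ_iff.2 fun h => ⟨h • x, rfl⟩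
  rw [← isSigmaCompact_univ_iff, ← h]
  exact isSigmaCompact_iUnion_of_isCompact _ fun y => isCompact_transporter hH x y

theorem locallyCompactSpace_of_actsProperlyCocompactly [IsTopologicalGroup H] (x : W)
    (hH : ActsProperlyCocompactly X H) : LocallyCompactSpace H :=
  (isCompact_transporter hH x x).locallyCompactSpace_of_mem_nhds_of_group
    ((isOpen_transporter hH x x).mem_nhds (one_smul H x))

end Topology

section FundamentalDomain

variable {G : Type u} [Group G] [TopologicalSpace G] [IsTopologicalGroup G]
  [MeasurableSpace G] [BorelSpace G] (Γ : Subgroup G)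

/-- Discreteness gives an open `U ∋ 1` with `U⁻¹U ∩ Γ = {1}`, and countably many translates of `U`
cover the group. From each translate remove the `Γ`-saturations of the earlier ones: a coset then
meets only the first translate it can reach, and only once. -/
theorem exists_measurableSet_existsUnique_mul_mem [SigmaCompactSpace G] [DiscreteTopology Γ] :
    ∃ D : Set G, MeasurableSet D ∧ ∀ x : G, ∃! γ : Γ, x * γ ∈ D := by
  classical
  obtain ⟨V, hV, hV1⟩ : ∃ V : Set G, IsOpen V ∧ V ∩ Γ = {1} := by
    obtain ⟨V, hV, h⟩ := isOpen_induced_iff.1 (isOpen_discrete ({1} : Set Γ))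
    refine ⟨V, hV, ?_⟩
    ext g
    constructor
    · rintro ⟨h1, h2⟩
      have : (⟨g, h2⟩ : Γ) ∈ ({1} : Set Γ) := h ▸ h1
      exact congrArg Subtype.val (Set.mem_singleton_iff.1 this)
    · rintro rfl
      refine ⟨?_, Γ.one_mem⟩
      have : (1 : Γ) ∈ Subtype.val ⁻¹' V := h ▸ rfl
      exact this
  have hV1' : (1 : G) ∈ V := (hV1.symm ▸ rfl : (1 : G) ∈ V ∩ Γ).1
  have hc : ContinuousAt (fun z : G × G => z.1⁻¹ * z.2) (1, 1) := by fun_prop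
  obtain ⟨U, hU, hU1, hUV⟩ : ∃ U : Set G, IsOpen U ∧ 1 ∈ U ∧ ∀ a ∈ U, ∀ b ∈ U, a⁻¹ * b ∈ V := by
    have h1 : (fun z : G × G => z.1⁻¹ * z.2) ⁻¹' V ∈ nhds ((1 : G), (1 : G)) :=
      hc.preimage_mem_nhds (hV.mem_nhds (by simpa using hV1'))
    rw [nhds_prod_eq, Filter.mem_prod_same_iff] at h1
    obtain ⟨t, ht, htV⟩ := h1
    obtain ⟨U, hUt, hU, hU1⟩ := mem_nhds_iff.1 ht
    exact ⟨U, hU, hU1, fun a ha b hb => htV (Set.mk_mem_prod (hUt ha) (hUt hb))⟩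
  obtain ⟨S, hS, hcover⟩ := countable_cover_nhds_of_sigmaCompact (f := fun g : G => g • U)
    fun g => (hU.smul g).mem_nhds ⟨1, hU1, by simp⟩
  have hSne : S.Nonempty := by
    obtain ⟨g, hg, -⟩ := Set.mem_iUnion₂.1 (hcover.symm ▸ Set.mem_univ (1 : G) : (1 : G) ∈ _)
    exact ⟨g, hg⟩
  obtain ⟨s, rfl⟩ := hS.exists_eq_range hSne
  have hcover : ∀ x : G, ∃ i, x ∈ s i • U := fun x => by
    have := hcover.symm ▸ Set.mem_univ x
    simpa using this
  let sat : ℕ → Set G := fun j => ⋃ γ : Γ, (· * (γ : G)) ⁻¹' (s j • U)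
  have hopen : ∀ j, IsOpen (sat j) := fun j =>
    isOpen_iUnion fun γ => (hU.smul (s j)).preimage (continuous_mul_const _)
  have hsat : ∀ j (x : G) (γ : Γ), x * γ ∈ sat j ↔ x ∈ sat j := fun j x γ => by
    simp only [sat, Set.mem_iUnion, Set.mem_preimage]
    constructor
    · rintro ⟨δ, h⟩
      exact ⟨γ * δ, by rwa [Subgroup.coe_mul, ← mul_assoc]⟩
    · rintro ⟨δ, h⟩
      exact ⟨γ⁻¹ * δ, by
        rwa [Subgroup.coe_mul, Subgroup.coe_inv, mul_assoc, mul_inv_cancel_left]⟩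
  refine ⟨⋃ i, (s i • U \ ⋃ j < i, sat j), MeasurableSet.iUnion fun i =>
    (hU.smul (s i)).measurableSet.diff (MeasurableSet.iUnion fun j => MeasurableSet.iUnion fun _ =>
      (hopen j).measurableSet), fun x => ?_⟩
  have hex : ∃ i, x ∈ sat i := by
    obtain ⟨i, hi⟩ := hcover x
    exact ⟨i, Set.mem_iUnion.2 ⟨1, by simpa using hi⟩⟩
  obtain ⟨γ, hγ⟩ := Set.mem_iUnion.1 (Nat.find_spec hex)
  have hγ : x * γ ∈ s (Nat.find hex) • U := hγ
  refine ⟨γ, Set.mem_iUnion.2 ⟨Nat.find hex, hγ, ?_⟩, fun δ hδ => ?_⟩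
  · simp only [Set.mem_iUnion, not_exists]
    intro j hj h
    exact Nat.find_min hex hj ((hsat j x γ).1 h)
  · obtain ⟨i, hi, hi'⟩ := Set.mem_iUnion.1 hδ
    have hsi : x ∈ sat i := Set.mem_iUnion.2 ⟨δ, hi⟩
    have hij : i = Nat.find hex := by
      refine le_antisymm (not_lt.1 fun h => hi' ?_) (Nat.find_min' hex hsi)
      exact Set.mem_iUnion₂.2 ⟨_, h, (hsat _ x δ).2 (Nat.find_spec hex)⟩
    rw [hij] at hi
    rw [Set.mem_smul_set_iff_inv_smul_mem] at hi hγ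
    have h1 := hUV _ hγ _ hi
    have h2 : ((s (Nat.find hex))⁻¹ • (x * (γ : G)))⁻¹ * ((s (Nat.find hex))⁻¹ • (x * (δ : G))) =
        ((γ⁻¹ * δ : Γ) : G) := by
      simp only [smul_eq_mul, Subgroup.coe_mul, Subgroup.coe_inv]
      group
    rw [h2] at h1
    have h3 : ((γ⁻¹ * δ : Γ) : G) ∈ V ∩ Γ := ⟨h1, (γ⁻¹ * δ : Γ).2⟩
    rw [hV1] at h3
    exact (inv_mul_eq_one.1 (Subtype.ext (Set.mem_singleton_iff.1 h3))).symm

variable {Γ}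

theorem isFundamentalDomain_of_existsUnique {D : Set G} (hD : MeasurableSet D)
    (h : ∀ x : G, ∃! γ : Γ, x * γ ∈ D) (μ : Measure G) : IsFundamentalDomain Γ.op D μ := by
  refine IsFundamentalDomain.mk' hD.nullMeasurableSet fun x => ?_
  obtain ⟨γ, hγ, hu⟩ := h x
  refine ⟨⟨MulOpposite.op (γ : G), γ.2⟩, hγ, fun δ hδ => ?_⟩
  have := hu ⟨δ.1.unop, δ.2⟩ hδ
  rw [← this]
  rfl

/-- The translates of `C` cover the group, while the measures of their traces on `D` add up to `μ
C`. -/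
theorem measure_lt_top_of_isFundamentalDomain {μ : Measure G} [IsFiniteMeasureOnCompacts μ]
    [μ.IsMulRightInvariant] [Countable Γ]
    {D : Set G} (hD : IsFundamentalDomain Γ.op D μ) {C : Set G} (hC : IsCompact C)
    (hCΓ : ∀ g : G, ∃ γ : Γ, g * γ ∈ C) : μ D < ⊤ := by
  have : Countable Γ.op := Γ.equivOp.symm.injective.countable
  refine lt_of_le_of_lt ?_ (hC.measure_lt_top (μ := μ))
  rw [hD.measure_eq_tsum C]
  refine le_trans (measure_mono ?_) (measure_iUnion_le _)
  intro g hg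
  obtain ⟨γ, hγ⟩ := hCΓ g
  refine Set.mem_iUnion.2 ⟨⟨MulOpposite.op (γ : G)⁻¹, Γ.inv_mem γ.2⟩, ?_, hg⟩
  exact ⟨_, hγ, mul_inv_cancel_right g (γ : G)⟩

/-- Write `g⁻¹ • x` as `γ • r` with `r` among finitely many representatives; then `g * γ` carries
`r` to `x`, and such elements form a compact set. -/
theorem exists_isCompact_mul_mem {W : Type w} {X : AbstractSimplicialComplex W}
    [MulAction G W] [SimplicialAction X G] (hG : ActsProperlyCocompactly X G)
    (hΓ : ActsProperlyCocompactly X Γ) (x : W) :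
    ∃ C : Set G, IsCompact C ∧ ∀ g : G, ∃ γ : Γ, g * γ ∈ C := by
  obtain ⟨R, hR⟩ := exists_finite_vertex_orbits hΓ
  refine ⟨⋃ r ∈ R, {c : G | c • r = x}, R.isCompact_biUnion fun r _ =>
    isCompact_transporter hG r x, fun g => ?_⟩
  obtain ⟨γ, r, hr, h⟩ := hR (g⁻¹ • x)
  refine ⟨γ, Set.mem_iUnion₂.2 ⟨r, hr, ?_⟩⟩
  change (g * (γ : G)) • r = x
  rw [mul_smul]
  exact (congrArg (g • ·) h).trans (smul_inv_smul g x)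

end FundamentalDomain

/-! ### Completeness of the induced space, and equality almost everywhere. -/

section Complete

variable {𝕜 : Type*} [RCLike 𝕜] {G : Type u} [Group G] {Γ : Subgroup G}
  {V : Type v} [NormedAddCommGroup V] [NormedSpace 𝕜 V]
  [MeasurableSpace G] [TopologicalSpace G] [IsTopologicalGroup G] [BorelSpace G]
  {π : Γ →* (V ≃ₗᵢ[𝕜] V)} {μ : Measure G} {D D' : Set G} [μ.IsMulRightInvariant] [Countable Γ]

theorem memLp_of_equivariant
    (hD : IsFundamentalDomain Γ.op D μ) (hD' : IsFundamentalDomain Γ.op D' μ) {f : G → V}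
    (hf : ∀ (g : G) (h : Γ), f (g * (h : G)⁻¹) = π h (f g)) (hm : MemLp f 2 (μ.restrict D)) :
    MemLp f 2 (μ.restrict D') := by
  refine ⟨(aestronglyMeasurable_of_equivariant hD hf hm.1).restrict, ?_⟩
  rw [← eLpNorm_eq_of_equivariant hD hD' hf]
  exact hm.2

/-- The class of an equivariant function in the `L²`-space of another fundamental domain. -/
noncomputable def toLpOf (π : Γ →* (V ≃ₗᵢ[𝕜] V)) (hD : IsFundamentalDomain Γ.op D μ)
    (hD' : IsFundamentalDomain Γ.op D' μ) :
    IndFun π μ D →ₗᵢ[𝕜] Lp V 2 (μ.restrict D') where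
  toFun f := (memLp_of_equivariant hD hD' f.equivariant f.memLp).toLp
  map_add' _ _ := rfl
  map_smul' _ _ := rfl
  norm_map' f := by
    refine (Lp.norm_toLp _ (memLp_of_equivariant hD hD' f.equivariant f.memLp)).trans ?_
    rw [IndFun.norm_eq, eLpNorm_eq_of_equivariant hD hD' f.equivariant]

/-- On a strict fundamental domain every `L²` function extends equivariantly by `F(x) = π(γ) f(xγ)`,
where `γ` is the unique element with `xγ ∈ D'`. The given `D` is strict only up to null sets, hence
the passage to `D'`. -/
theorem toLpOf_surjective (hD : IsFundamentalDomain Γ.op D μ) (hD' : MeasurableSet D')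
    (h : ∀ x : G, ∃! γ : Γ, x * γ ∈ D') : Function.Surjective
      (toLpOf π hD (isFundamentalDomain_of_existsUnique hD' h μ)) := by
  intro f
  choose γ hγ hu using id h
  let F : G → V := fun x => π (γ x) (f (x * γ x))
  have hF : ∀ (g : G) (h : Γ), F (g * (h : G)⁻¹) = π h (F g) := fun g h => by
    have h1 : γ (g * (h : G)⁻¹) = h * γ g := by
      refine (hu _ _ ?_).symm
      change g * (h : G)⁻¹ * ((h * γ g : Γ) : G) ∈ D'
      rw [Subgroup.coe_mul, ← mul_assoc, inv_mul_cancel_right]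
      exact hγ g
    change π (γ (g * (h : G)⁻¹)) (f (g * (h : G)⁻¹ * γ (g * (h : G)⁻¹))) = π h (π (γ g) (f (g * γ g)))
    rw [h1, map_mul, Subgroup.coe_mul, ← mul_assoc, inv_mul_cancel_right]
    rfl
  have hFf : F =ᵐ[μ.restrict D'] f := by
    refine (ae_restrict_iff' hD').2 (Filter.Eventually.of_forall fun x hx => ?_)
    have h1 : γ x = 1 := (hu x 1 (by simpa using hx)).symm
    change π (γ x) (f (x * γ x)) = f x
    rw [h1, map_one, Subgroup.coe_one, mul_one]
    rfl
  have hF' : MemLp F 2 (μ.restrict D') := (memLp_congr_ae hFf).2 (Lp.memLp f)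
  refine ⟨⟨F, hF, memLp_of_equivariant (isFundamentalDomain_of_existsUnique hD' h μ) hD hF hF'⟩, ?_⟩
  exact (MemLp.toLp_congr hF' (Lp.memLp f) hFf).trans (Lp.toLp_coeFn f _)

theorem completeSpace_indL2 [CompleteSpace V] [SigmaCompactSpace G] [DiscreteTopology Γ]
    (hD : IsFundamentalDomain Γ.op D μ) : CompleteSpace (IndL2 π μ D) := by
  obtain ⟨D', hD', h⟩ := exists_measurableSet_existsUnique_mul_mem Γ
  have : CompleteSpace (IndFun π μ D) :=
    ((toLpOf π hD (isFundamentalDomain_of_existsUnique hD' h μ)).isometry.isUniformInducing.completeSpace_congr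
      (toLpOf_surjective hD hD' h)).2 inferInstance
  infer_instance

/-- The set where two equivariant functions differ is `Γ`-invariant, so it is null once its trace on
`D` is null. -/
theorem mk_eq_mk_iff_ae (hD : IsFundamentalDomain Γ.op D μ) (f f' : IndFun π μ D) :
    (SeparationQuotient.mk f : IndL2 π μ D) = SeparationQuotient.mk f' ↔
      f.toFun =ᵐ[μ] f'.toFun := by
  have : Countable Γ.op := Γ.equivOp.symm.injective.countable
  rw [SeparationQuotient.mk_eq_mk, Metric.inseparable_iff, dist_eq_norm]
  have h1 : ‖f - f'‖ = 0 ↔ f.toFun =ᵐ[μ.restrict D] f'.toFun := by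
    change ‖IndFun.toLp (𝕜 := 𝕜) (f - f')‖ = 0 ↔ _
    rw [norm_eq_zero, map_sub, sub_eq_zero]
    exact MemLp.toLp_eq_toLp_iff f.memLp f'.memLp
  rw [h1]
  refine ⟨fun h => ?_, fun h => ae_restrict_of_ae h⟩
  refine hD.measure_zero_of_invariant {x | ¬ f.toFun x = f'.toFun x} (fun γ => ?_) ?_
  · ext x
    rw [Set.mem_smul_set_iff_inv_smul_mem]
    have h2 : γ⁻¹ • x = x * ((⟨γ.1.unop, γ.2⟩ : Γ) : G)⁻¹ := rfl
    rw [h2, Set.mem_ofPred_eq, Set.mem_ofPred_eq, f.equivariant, f'.equivariant]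
    simp
  · rw [← Measure.restrict_apply₀' hD.nullMeasurableSet]
    exact h

end Complete


/-! ### Equivariant families of `L²`-functions -/

section CompactGroup

/-- For measurable `B`, the restriction of Haar measure to `F⁻¹(B)` is again left invariant, so
uniqueness makes `F⁻¹(B)` null or conull. As the range is essentially separable, such a zero-one law
forces `F` to be constant almost everywhere. -/
theorem exists_ae_eq_const_of_compactSpace {K : Type*} [Group K] [TopologicalSpace K]
    [IsTopologicalGroup K] [CompactSpace K] [MeasurableSpace K] [BorelSpace K] (ν : Measure K)
    [ν.IsHaarMeasure] {V : Type*} [TopologicalSpace V] [TopologicalSpace.MetrizableSpace V]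
    [Nonempty V] {F : K → V} (hF : AEStronglyMeasurable F ν)
    (hinv : ∀ k, ∀ᵐ x ∂ν, F (k * x) = F x) : ∃ v, ∀ᵐ x ∂ν, F x = v := by
  borelize V
  obtain ⟨t, ht, hgt⟩ := hF.isSeparable_ae_range
  have := ht.secondCountableTopology
  refine Filter.exists_eventuallyEq_const_of_eventually_mem_of_forall_separating MeasurableSet hgt
    fun B hB => ?_
  have hA : NullMeasurableSet (F ⁻¹' B) ν := hF.aemeasurable.nullMeasurable hB
  have : (ν.restrict (F ⁻¹' B)).IsMulLeftInvariant := ⟨fun k => by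
    have h1 := ((measurePreserving_mul_left ν k).restrict_preimage_emb
      (measurableEmbedding_mulLeft k) (F ⁻¹' B)).map_eq
    have h2 : (fun x => k * x) ⁻¹' (F ⁻¹' B) =ᵐ[ν] F ⁻¹' B := by
      refine Filter.eventuallyEq_set.2 ?_
      filter_upwards [hinv k] with x hx
      rw [Set.mem_preimage, Set.mem_preimage, Set.mem_preimage, hx]
    rwa [Measure.restrict_congr_set h2] at h1⟩
  have h1 := Measure.isMulInvariant_eq_smul_of_compactSpace (ν.restrict (F ⁻¹' B)) ν
  set c := Measure.haarScalarFactor (ν.restrict (F ⁻¹' B)) ν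
  have h2 : c • ν (F ⁻¹' B)ᶜ = 0 := by
    have := congrArg (fun m => m (F ⁻¹' B)ᶜ) h1
    simp only [Measure.smul_apply] at this
    rw [← this, Measure.restrict_apply₀' hA, Set.compl_inter_self, measure_empty]
  by_cases hc : c = 0
  · right
    rw [hc, zero_smul, Measure.restrict_eq_zero] at h1
    simp only [ae_iff, not_not]
    exact h1
  · left
    rw [ae_iff]
    exact (smul_eq_zero_iff_right hc).1 h2

theorem exists_ae_eq_const_on_subgroup {G : Type*} [Group G] [TopologicalSpace G]
    [IsTopologicalGroup G] [MeasurableSpace G] [BorelSpace G] (μ : Measure G) [μ.IsHaarMeasure]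
    (K : Subgroup G) (hK : IsOpen (K : Set G)) (hK' : IsCompact (K : Set G))
    {V : Type*} [TopologicalSpace V] [TopologicalSpace.MetrizableSpace V]
    [Nonempty V] {F : G → V} (hF : AEStronglyMeasurable F μ)
    (hinv : ∀ k ∈ K, ∀ᵐ x ∂μ, F (k * x) = F x) : ∃ v, ∀ᵐ x ∂μ, x ∈ K → F x = v := by
  have : CompactSpace K := isCompact_iff_compactSpace.1 hK'
  have hemb : MeasurableEmbedding (Subtype.val : K → G) := .subtype_coe hK.measurableSet
  have : (μ.comap (Subtype.val : K → G)).IsHaarMeasure :=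
    Measure.IsHaarMeasure.comap (mH := inferInstance) μ (f := K.subtype) hK.isOpenEmbedding_subtypeVal
  have hmap : ∀ p : G → Prop, (∀ᵐ x : K ∂(μ.comap (Subtype.val : K → G)), p x) ↔
      ∀ᵐ x ∂μ, x ∈ K → p x := fun p => by
    rw [← hemb.ae_map_iff, hemb.map_comap, Subtype.range_coe]
    exact ae_restrict_iff' hK.measurableSet
  obtain ⟨v, hv⟩ := exists_ae_eq_const_of_compactSpace (μ.comap (Subtype.val : K → G))
    (F := fun x => F x) (by
      refine AEStronglyMeasurable.comp_measurable ?_ hemb.measurable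
      rw [hemb.map_comap]
      exact hF.restrict) (fun k => by
      refine (hmap fun x => F (k * x) = F x).2 ?_
      filter_upwards [hinv k k.2] with x hx _ using hx)
  exact ⟨v, (hmap fun x => F x = v).1 hv⟩

end CompactGroup

/-! ### From `Γ`-equivariant functions to `G`-equivariant families of classes. -/

section EquivariantFunctions

/-- Functions that are equivariant with respect to a representation and vanish outside of `S`. -/
def equivariantFunctions {𝕜 H Ω A : Type*} [CommRing 𝕜] [Group H] [AddCommGroup A] [Module 𝕜 A]
    (ρ : Representation 𝕜 H A) (act : H → Ω → Ω) (S : Set Ω) : Submodule 𝕜 (Ω → A) where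
  carrier := {φ | (∀ h ω, ρ h (φ ω) = φ (act h ω)) ∧ ∀ ω, ω ∉ S → φ ω = 0}
  zero_mem' := ⟨fun h ω => by simp, fun _ _ => rfl⟩
  add_mem' := by
    rintro φ φ' ⟨h1, h2⟩ ⟨h3, h4⟩
    exact ⟨fun h ω => by simp [h1, h3], fun ω hω => by simp [h2 ω hω, h4 ω hω]⟩
  smul_mem' := by
    rintro a φ ⟨h1, h2⟩
    exact ⟨fun h ω => by simp [h1], fun ω hω => by simp [h2 ω hω]⟩

variable {𝕜 : Type*} [RCLike 𝕜] {G : Type u} [Group G] {Γ : Subgroup G}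
  {V : Type v} [NormedAddCommGroup V] [NormedSpace 𝕜 V]
  [MeasurableSpace G] [TopologicalSpace G] [IsTopologicalGroup G] [BorelSpace G]
  {π : Γ →* (V ≃ₗᵢ[𝕜] V)} {μ : Measure G} {D : Set G}
  {Ω : Type*} [MulAction G Ω]

theorem memLp_comp_inv_smul [Countable Ω] (hopen : ∀ ω ω' : Ω, IsOpen {g : G | g • ω = ω'})
    (hμD : μ D < ⊤) {φ : Ω → V} {C : ℝ} (hC : ∀ ω, ‖φ ω‖ ≤ C) (ω : Ω) :
    MemLp (fun g : G => φ (g⁻¹ • ω)) 2 (μ.restrict D) := by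
  have : IsFiniteMeasure (μ.restrict D) := ⟨by rwa [Measure.restrict_apply_univ]⟩
  let _ : MeasurableSpace Ω := ⊤
  have h1 : Measurable fun g : G => g⁻¹ • ω := by
    refine measurable_to_countable' fun ω' => ?_
    exact ((hopen ω ω').preimage continuous_inv).measurableSet
  have h2 : StronglyMeasurable φ := StronglyMeasurable.of_discrete
  exact MemLp.of_bound (h2.comp_measurable h1).aestronglyMeasurable C
    (Filter.Eventually.of_forall fun g => hC _)

theorem exists_bound_of_finite_orbits {S : Set Ω} {φ : Ω → V}
    (hφ : φ ∈ equivariantFunctions (isomRep π).toRepresentation (fun γ ω => (γ : G) • ω) S)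
    (hfin : ∃ R : Set Ω, R.Finite ∧ ∀ ω ∈ S, ∃ γ : Γ, ∃ r ∈ R, (γ : G) • r = ω) :
    ∃ C, ∀ ω, ‖φ ω‖ ≤ C := by
  obtain ⟨R, hR, h⟩ := hfin
  obtain ⟨C, hC⟩ := (hR.image fun r => ‖φ r‖).bddAbove
  refine ⟨max C 0, fun ω => ?_⟩
  by_cases hω : ω ∈ S
  · obtain ⟨γ, r, hr, rfl⟩ := h ω hω
    rw [← hφ.1 γ r]
    exact ((π γ).norm_map (φ r)).le.trans ((hC ⟨r, hr, rfl⟩).trans (le_max_left _ _))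
  · rw [hφ.2 ω hω, norm_zero]
    exact le_max_right _ _

variable [μ.IsHaarMeasure] [μ.IsMulRightInvariant] [Countable Γ]

/-- Open stabilizers turn almost-everywhere statements into pointwise ones, since every conull set
meets them; this gives injectivity. Compactness of the stabilizers on `S` recovers `φ` from
representatives, and countability of `Ω` allows the exceptional null sets to be united. -/
theorem exists_equivariantFunctions_equiv [Countable Ω]
    (hopen : ∀ ω ω' : Ω, IsOpen {g : G | g • ω = ω'}) (hD : IsFundamentalDomain Γ.op D μ)
    (hμD : μ D < ⊤) {S : Set Ω} (hcompact : ∀ ω ∈ S, IsCompact {g : G | g • ω = ω})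
    (hfin : ∃ R : Set Ω, R.Finite ∧ ∀ ω ∈ S, ∃ γ : Γ, ∃ r ∈ R, (γ : G) • r = ω)
    (hS : ∀ (g : G), ∀ ω ∉ S, g • ω ∉ S) :
    ∃ e : equivariantFunctions (isomRep π).toRepresentation (fun γ ω => (γ : G) • ω) S ≃ₗ[𝕜]
        equivariantFunctions (indRep π hD).toRepresentation (fun g (ω : Ω) => g • ω) S,
      ∀ φ ω, ∃ f : IndFun π μ D, (∀ g, f.toFun g = φ.1 (g⁻¹ • ω)) ∧
        (e φ).1 ω = SeparationQuotient.mk f := by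
  have hnhds : ∀ ω : Ω, {g : G | g • ω = ω}.Nonempty := fun ω => ⟨1, one_smul G ω⟩
  let Λ := equivariantFunctions (isomRep π).toRepresentation (fun γ (ω : Ω) => (γ : G) • ω) S
  let pull : Λ → Ω → IndFun π μ D := fun φ ω => ⟨fun g => φ.1 (g⁻¹ • ω), fun g h => by
    beta_reduce
    rw [mul_inv_rev, inv_inv, mul_smul]
    exact (φ.2.1 h _).symm, memLp_comp_inv_smul hopen hμD
      (exists_bound_of_finite_orbits φ.2 hfin).choose_spec ω⟩
  let e₀ : Λ →ₗ[𝕜] equivariantFunctions (indRep π hD).toRepresentation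
      (fun g (ω : Ω) => g • ω) S :=
    { toFun := fun φ => ⟨fun ω => SeparationQuotient.mk (pull φ ω), fun g ω => by
        change indRep π hD g (SeparationQuotient.mk (pull φ ω)) = _
        rw [indRep_mk]
        refine congrArg _ (Subtype.ext (funext fun x => ?_))
        change φ.1 ((g⁻¹ * x)⁻¹ • ω) = φ.1 (x⁻¹ • g • ω)
        rw [mul_inv_rev, inv_inv, mul_smul], fun ω hω => by
        refine congrArg SeparationQuotient.mk (?_ : pull φ ω = 0)
        exact Subtype.ext (funext fun x => φ.2.2 _ (hS _ _ hω))⟩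
      map_add' := fun φ φ' => rfl
      map_smul' := fun a φ => rfl }
  have hinj : Function.Injective e₀ := fun φ φ' h => Subtype.ext (funext fun ω => by
    have h1 := (mk_eq_mk_iff_ae hD _ _).1 (congrFun (congrArg Subtype.val h) ω)
    obtain ⟨g, hg, hg'⟩ := (Measure.dense_of_ae h1).exists_mem_open
      ((hopen ω ω)) (hnhds ω)
    have hg : φ.1 (g⁻¹ • ω) = φ'.1 (g⁻¹ • ω) := hg
    rwa [inv_smul_eq_iff.2 (Eq.symm hg')] at hg)
  have hsurj : Function.Surjective e₀ := fun ψ => by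
    choose f hf using fun ω => SeparationQuotient.surjective_mk (ψ.1 ω)
    -- Equivariance of `ψ`, written for the chosen representatives, holds only almost everywhere for
    -- each separate `g` and `ω`.
    have hae : ∀ (g : G) ω, ∀ᵐ y ∂μ, (f ω).toFun (g⁻¹ * y) = (f (g • ω)).toFun y := fun g ω => by
      refine (mk_eq_mk_iff_ae hD (translate hD g (f ω)) (f (g • ω))).1 ?_
      rw [← indRep_mk, hf, hf]
      exact ψ.2.1 g ω
    have hval : ∀ ω, ∃ v, (ω ∉ S → v = 0) ∧ ∀ᵐ y ∂μ, y • ω = ω → (f ω).toFun y = v := fun ω => by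
      by_cases hω : ω ∈ S
      · obtain ⟨v, hv⟩ := exists_ae_eq_const_on_subgroup μ (MulAction.stabilizer G ω) (hopen ω ω)
          (hcompact ω hω) (F := (f ω).toFun)
          (aestronglyMeasurable_of_equivariant hD (f ω).equivariant (f ω).memLp.1) (fun k hk => by
            have h1 := hae k⁻¹ ω
            rwa [inv_inv, inv_smul_eq_iff.2 (Eq.symm hk)] at h1)
        exact ⟨v, fun h => absurd hω h, hv⟩
      · refine ⟨0, fun _ => rfl, ?_⟩
        have h1 := (mk_eq_mk_iff_ae hD (f ω) 0).1 ((hf ω).trans (ψ.2.2 ω hω))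
        filter_upwards [h1] with y hy _ using hy
    choose φ hφ0 hφ using hval
    -- If `y⁻¹ • ω = ω'`, a fixed `x` with `x • ω' = ω` moves `y` into the stabilizer of `ω'`, where
    -- the value is `φ ω'`. Countably many `ω'` exhaust the group.
    have hform : ∀ ω, ∀ᵐ y ∂μ, (f ω).toFun y = φ (y⁻¹ • ω) := fun ω => by
      have key : ∀ ω', ∀ᵐ y ∂μ, y⁻¹ • ω = ω' → (f ω).toFun y = φ ω' := fun ω' => by
        by_cases hx : ∃ x : G, x • ω' = ω
        · obtain ⟨x, rfl⟩ := hx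
          filter_upwards [hae x ω', (measurePreserving_mul_left μ
            x⁻¹).quasiMeasurePreserving.ae (hφ ω')] with y h1 h2 h3
          rw [← h1, h2]
          rw [mul_smul, inv_smul_eq_iff, ← inv_smul_eq_iff.1 h3]
        · refine Filter.Eventually.of_forall fun y hy => absurd ⟨y, ?_⟩ hx
          rw [← hy, smul_inv_smul]
      filter_upwards [ae_all_iff.2 key] with y hy using hy _ rfl
    -- Evaluate the formula at `y` and at `y γ⁻¹`, for some `y` in the stabilizer of `ω` where both
    -- hold; the equivariance of `f ω` becomes that of `φ`.
    have hφΛ : φ ∈ Λ := by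
      refine ⟨fun γ ω => ?_, hφ0⟩
      have h1 := (measurePreserving_mul_right μ (γ : G)⁻¹).quasiMeasurePreserving.ae (hform ω)
      obtain ⟨y, ⟨h2, h3⟩, h4⟩ := (Measure.dense_of_ae (h1.and (hform ω))).exists_mem_open
        (hopen ω ω) (hnhds ω)
      have h4 : y⁻¹ • ω = ω := inv_smul_eq_iff.2 (Eq.symm h4)
      rw [(f ω).equivariant, h3, mul_inv_rev, inv_inv, mul_smul, h4] at h2
      exact h2
    refine ⟨⟨φ, hφΛ⟩, Subtype.ext (funext fun ω => ?_)⟩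
    rw [← hf ω]
    refine (mk_eq_mk_iff_ae hD _ _).2 ?_
    filter_upwards [hform ω] with y hy using hy.symm
  exact ⟨LinearEquiv.ofBijective e₀ ⟨hinj, hsurj⟩, fun φ ω => ⟨pull φ ω, fun g => rfl, rfl⟩⟩

/-- Linear relations between values are preserved. -/
theorem exists_indFun_linearCombination {φ : Ω → V}
    {ψ : Ω → IndL2 π μ D} (h : ∀ ω, ∃ f : IndFun π μ D, (∀ g, f.toFun g = φ (g⁻¹ • ω)) ∧
      ψ ω = SeparationQuotient.mk f) (c : Ω →₀ 𝕜) :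
    ∃ f : IndFun π μ D,
      (∀ g, f.toFun g = Finsupp.linearCombination 𝕜 (fun ω => φ (g⁻¹ • ω)) c) ∧
        Finsupp.linearCombination 𝕜 ψ c = SeparationQuotient.mk f := by
  induction c using Finsupp.induction_linear with
  | zero => exact ⟨0, fun g => by rw [map_zero]; rfl, by rw [map_zero]; rfl⟩
  | add c c' hc hc' =>
    obtain ⟨f, h1, h2⟩ := hc
    obtain ⟨f', h1', h2'⟩ := hc'
    refine ⟨f + f', fun g => ?_, ?_⟩
    · rw [map_add, ← h1, ← h1']
      rfl
    · rw [map_add, h2, h2']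
      rfl
  | single ω a =>
    obtain ⟨f, h1, h2⟩ := h ω
    refine ⟨a • f, fun g => ?_, ?_⟩
    · rw [Finsupp.linearCombination_single, ← h1]
      rfl
    · rw [Finsupp.linearCombination_single, h2]
      rfl

end EquivariantFunctions


/-! ### Comparison of cochains with values in a representation and in its induction -/

section Tuples

variable {𝕜 : Type*} [RCLike 𝕜] {H : Type u} [Group H] [TopologicalSpace H]
  {W : Type w} [MulAction H W] (X : AbstractSimplicialComplex W) [SimplicialAction X H]
  {A : Type*} [NormedAddCommGroup A] [NormedSpace 𝕜 A] (ρ : ContRepresentation 𝕜 H A)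

/-- The double cochains without dependence on group elements. -/
def doubleCochainsZeroEquiv (q : ℕ) : doubleCochains X ρ 0 (q + 1) ≃ₗ[𝕜]
    equivariantFunctions ρ.toRepresentation (fun h (l : List W) => h • l)
      {l | IsFaceTuple X l ∧ l.length = q + 1} where
  toFun F := ⟨F.1 Fin.elim0, fun h l => by
    have h1 := F.2.2.1 h Fin.elim0 l
    rw [show (fun i => h * Fin.elim0 i) = (Fin.elim0 : Fin 0 → H) from Subsingleton.elim _ _] at h1
    exact h1.symm, F.2.2.2.1 _⟩
  invFun φ := ⟨fun _ => φ.1, fun l => continuous_const, fun h _ l => (φ.2.1 h l).symm,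
    fun _ => φ.2.2, fun _ hq => by simp at hq⟩
  left_inv F := Subtype.ext (funext fun x => congrArg F.1 (Subsingleton.elim _ _))
  right_inv φ := rfl
  map_add' F F' := rfl
  map_smul' a F := rfl

end Tuples

section Comparison

variable {𝕜 : Type*} [RCLike 𝕜] {G : Type u} [Group G] {Γ : Subgroup G} [Countable Γ]
  {V : Type v} [NormedAddCommGroup V] [NormedSpace 𝕜 V]
  [MeasurableSpace G] [TopologicalSpace G] [IsTopologicalGroup G] [BorelSpace G]
  {π : Γ →* (V ≃ₗᵢ[𝕜] V)} {μ : Measure G} {D : Set G}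
  [μ.IsHaarMeasure] [μ.IsMulRightInvariant]
  {W : Type w} [MulAction G W] {X : AbstractSimplicialComplex W} [SimplicialAction X G]

theorem exists_doubleCochains_equiv (hG : ActsProperlyCocompactly X G)
    (hΓ : ActsProperlyCocompactly X Γ) (hX : IsLocallyFinite X)
    (hD : IsFundamentalDomain Γ.op D μ) (hμD : μ D < ⊤) (q : ℕ) :
    ∃ e : doubleCochains X (isomRep π) 0 (q + 1) ≃ₗ[𝕜] doubleCochains X (indRep π hD) 0 (q + 1),
      ∀ F l, ∃ f : IndFun π μ D, (∀ g, f.toFun g = F.1 Fin.elim0 (g⁻¹ • l)) ∧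
        (e F).1 Fin.elim0 l = SeparationQuotient.mk f := by
  have : Countable W := countable_vertices_of_countable hΓ
  obtain ⟨e, he⟩ := exists_equivariantFunctions_equiv (π := π) (Ω := List W)
    (isOpen_transporter_list hG) hD hμD (S := {l | IsFaceTuple X l ∧ l.length = q + 1})
    (fun l hl => isCompact_transporter_list hG (by rintro rfl; simp at hl) l)
    (by
      obtain ⟨R, hR, h⟩ := exists_finite_tuple_orbits hΓ hX q
      exact ⟨R, hR, fun l hl => h l hl.1 hl.2⟩)
    (fun g l hl h => hl ⟨(isFaceTuple_smul g).1 h.1, (length_smul_list g l).symm.trans h.2⟩)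
  exact ⟨(doubleCochainsZeroEquiv X (isomRep π) q).trans
    (e.trans (doubleCochainsZeroEquiv X (indRep π hD) q).symm), fun F l =>
    he (doubleCochainsZeroEquiv X (isomRep π) q F) l⟩

theorem nonempty_midHomology_vertBd_equiv (hG : ActsProperlyCocompactly X G)
    (hΓ : ActsProperlyCocompactly X Γ) (hX : IsLocallyFinite X)
    (hD : IsFundamentalDomain Γ.op D μ) (hμD : μ D < ⊤) (n : ℕ) :
    Nonempty (MidHomology (vertBd X (isomRep π) 0 n) (vertBd X (isomRep π) 0 (n + 1)) ≃ₗ[𝕜]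
      MidHomology (vertBd X (indRep π hD) 0 n) (vertBd X (indRep π hD) 0 (n + 1))) := by
  have h := exists_doubleCochains_equiv (π := π) hG hΓ hX hD hμD
  choose e he using h
  have hcomm : ∀ q F, e (q + 1) (vertBd X (isomRep π) 0 (q + 1) F) =
      vertBd X (indRep π hD) 0 (q + 1) (e q F) := fun q F => by
    refine Subtype.ext (funext fun x => funext fun l => ?_)
    rw [show x = Fin.elim0 from Subsingleton.elim _ _]
    change _ = faceBd 𝕜 X (IndL2 π μ D) (q + 1) ((e q F).1 Fin.elim0) l
    obtain ⟨f, hf, hf'⟩ := he (q + 1) (vertBd X (isomRep π) 0 (q + 1) F) l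
    rw [hf']
    have hf : ∀ g, f.toFun g = faceBd 𝕜 X V (q + 1) (F.1 Fin.elim0) (g⁻¹ • l) := hf
    by_cases hl : IsFaceTuple X l ∧ l.length = q + 2
    · obtain ⟨f', h1, h2⟩ := exists_indFun_linearCombination (he q F) (TupleChain.bdList 𝕜 l)
      rw [faceBd_apply 𝕜 _ hl.1 hl.2, h2]
      refine congrArg _ (Subtype.ext (funext fun g => ?_))
      refine (hf g).trans (Eq.trans ?_ (h1 g).symm)
      rw [faceBd_apply 𝕜 _ ((isFaceTuple_smul _).2 hl.1) ((length_smul_list _ _).trans hl.2),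
        bdList_smul, linearCombination_map]
      rfl
    · rw [faceBd_eq_zero 𝕜 _ hl]
      refine congrArg SeparationQuotient.mk (?_ : f = 0)
      refine Subtype.ext (funext fun g => (hf g).trans ?_)
      exact faceBd_eq_zero 𝕜 _ (by rwa [isFaceTuple_smul, length_smul_list])
  cases n with
  | zero =>
    -- The incoming terms are both the zero module at the corner, so the zero map between them is
    -- surjective.
    refine nonempty_homology_equiv_of_comm _ _ _ _ 0 (fun F => ⟨0, ?_⟩) (e 0) (e 1).toLinearMap
      (e 1).injective (fun F => ?_) (hcomm 0)
    · exact (Subtype.ext (F.2.2.2.2 rfl rfl)).symm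
    · rw [show F = 0 from Subtype.ext (F.2.2.2.2 rfl rfl), map_zero, map_zero]
      exact (map_zero (vertBd X (indRep π hD) 0 0)).symm
  | succ n =>
    exact nonempty_homology_equiv_of_comm _ _ _ _ (e n) (e n).surjective (e (n + 1))
      (e (n + 2)).toLinearMap (e (n + 2)).injective (hcomm n) (hcomm (n + 1))

/-! ### Ordered simplices and the maps `Φ_k`. -/

section Ordered

variable {k : ℕ}

/-- The list of the vertices of an ordered simplex. -/
def OrderedSimplex.toList (σ : OrderedSimplex X k) : List W := List.ofFn σ.vertex

theorem OrderedSimplex.toList_injective :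
    Function.Injective (OrderedSimplex.toList : OrderedSimplex X k → List W) := fun _ _ h =>
  OrderedSimplex.ext (List.ofFn_injective h)

theorem OrderedSimplex.smul_toList (g : G) (σ : OrderedSimplex X k) :
    g • σ.toList = (g • σ).toList :=
  List.map_ofFn

theorem OrderedSimplex.isFaceTuple_toList (σ : OrderedSimplex X k) : IsFaceTuple X σ.toList :=
  ⟨_, σ.mem, fun x hx => by
    obtain ⟨i, rfl⟩ := (List.mem_ofFn' _ _).1 hx
    exact Finset.mem_map.2 ⟨i, Finset.mem_univ i, rfl⟩⟩

theorem OrderedSimplex.setOf_smul_eq (σ σ' : OrderedSimplex X k) :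
    {g : G | g • σ = σ'} = {g : G | g • σ.toList = σ'.toList} := by
  ext g
  rw [Set.mem_ofPred_eq, Set.mem_ofPred_eq, smul_toList, toList_injective.eq_iff]

theorem exists_finite_orderedSimplex_orbits (hΓ : ActsProperlyCocompactly X Γ)
    (hX : IsLocallyFinite X) (k : ℕ) : ∃ R : Set (OrderedSimplex X k), R.Finite ∧
      ∀ σ, ∃ γ : Γ, ∃ r ∈ R, (γ : G) • r = σ := by
  obtain ⟨R, hR, h⟩ := exists_finite_tuple_orbits hΓ hX k
  refine ⟨OrderedSimplex.toList ⁻¹' R, hR.preimage OrderedSimplex.toList_injective.injOn,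
    fun σ => ?_⟩
  obtain ⟨γ, r, hr, hσ⟩ := h σ.toList σ.isFaceTuple_toList (List.length_ofFn)
  have hσ : (γ : G) • r = σ.toList := hσ
  have h1 : ((γ : G)⁻¹ • σ).toList = r := by
    rw [← OrderedSimplex.smul_toList, ← hσ, inv_smul_smul]
  exact ⟨γ, (γ : G)⁻¹ • σ, by rwa [Set.mem_preimage, h1], smul_inv_smul _ _⟩

theorem exists_twistedCochains_equiv (hG : ActsProperlyCocompactly X G)
    (hΓ : ActsProperlyCocompactly X Γ) (hX : IsLocallyFinite X)
    (hD : IsFundamentalDomain Γ.op D μ) (hμD : μ D < ⊤) (k : ℕ) :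
    ∃ e : twistedCochains X (isomRep π).toRepresentation k ≃ₗ[𝕜]
        twistedCochains X (indRep π hD).toRepresentation k,
      ∀ φ σ, ∃ f : IndFun π μ D, (∀ g : G, f.toFun g = φ.1 (g⁻¹ • σ)) ∧
        (e φ).1 σ = SeparationQuotient.mk f := by
  have : Countable W := countable_vertices_of_countable hΓ
  have : Countable (OrderedSimplex X k) := OrderedSimplex.toList_injective.countable
  have hopen : ∀ σ σ' : OrderedSimplex X k, IsOpen {g : G | g • σ = σ'} := fun σ σ' => by
    rw [OrderedSimplex.setOf_smul_eq]
    exact isOpen_transporter_list hG _ _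
  obtain ⟨e, he⟩ := exists_equivariantFunctions_equiv (π := π) hopen hD hμD (S := Set.univ)
    (fun σ _ => by
      rw [OrderedSimplex.setOf_smul_eq]
      exact isCompact_transporter_list hG (by simp [OrderedSimplex.toList]) _)
    (by
      obtain ⟨R, hR, h⟩ := exists_finite_orderedSimplex_orbits hΓ hX k
      exact ⟨R, hR, fun σ _ => h σ⟩)
    (fun g σ hσ => absurd (Set.mem_univ σ) hσ)
  -- Antisymmetry of the image is an identity for almost every `g`; a `g` in the open stabilizer of
  -- `σ` gives it back for `φ` at `σ`. Hence the equivalence on all equivariant functions restricts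
  -- to cochains.
  have hanti : ∀ φ, IsAntisymmetric X φ.1 ↔ IsAntisymmetric X (e φ).1 := fun φ => by
    have h1 : ∀ σ τ, (e φ).1 (σ.perm τ) = (Equiv.Perm.sign τ : ℤ) • (e φ).1 σ ↔
        ∀ᵐ g ∂μ, φ.1 ((g⁻¹ • σ).perm τ) = (Equiv.Perm.sign τ : ℤ) • φ.1 (g⁻¹ • σ) := fun σ τ => by
      obtain ⟨f, hf, hf'⟩ := he φ σ
      obtain ⟨f₁, hf₁, hf₁'⟩ := he φ (σ.perm τ)
      rw [hf', hf₁']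
      refine (mk_eq_mk_iff_ae hD f₁ ((Equiv.Perm.sign τ : ℤ) • f)).trans ?_
      refine Filter.eventually_congr (Filter.Eventually.of_forall fun g => ?_)
      rw [hf₁, show ((Equiv.Perm.sign τ : ℤ) • f).toFun g = (Equiv.Perm.sign τ : ℤ) • f.toFun g
        from rfl, hf]
      rfl
    constructor
    · exact fun h τ σ => (h1 σ τ).2 (Filter.Eventually.of_forall fun g => h τ _)
    · intro h τ σ
      obtain ⟨g, hg, hg'⟩ := (Measure.dense_of_ae ((h1 σ τ).1 (h τ σ))).exists_mem_open
        (hopen σ σ) ⟨1, one_smul G σ⟩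
      have hg' : g⁻¹ • σ = σ := inv_smul_eq_iff.2 (Eq.symm hg')
      have hg : φ.1 ((g⁻¹ • σ).perm τ) = (Equiv.Perm.sign τ : ℤ) • φ.1 (g⁻¹ • σ) := hg
      rwa [hg'] at hg
  let e' : twistedCochains X (isomRep π).toRepresentation k ≃ₗ[𝕜]
      twistedCochains X (indRep π hD).toRepresentation k :=
    { toFun := fun φ => ⟨(e ⟨φ.1, φ.2.2, fun σ hσ => absurd (Set.mem_univ σ) hσ⟩).1,
        (hanti _).1 φ.2.1, (e _).2.1⟩
      invFun := fun ψ => ⟨(e.symm ⟨ψ.1, ψ.2.2, fun σ hσ => absurd (Set.mem_univ σ) hσ⟩).1,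
        (hanti _).2 (by rw [e.apply_symm_apply]; exact ψ.2.1), (e.symm _).2.1⟩
      left_inv := fun φ => Subtype.ext (by
        have h := e.symm_apply_apply ⟨φ.1, φ.2.2, fun σ hσ => absurd (Set.mem_univ σ) hσ⟩
        exact congrArg (fun φ => φ.1) h)
      right_inv := fun ψ => Subtype.ext (by
        have h := e.apply_symm_apply ⟨ψ.1, ψ.2.2, fun σ hσ => absurd (Set.mem_univ σ) hσ⟩
        exact congrArg (fun ψ => ψ.1) h)
      map_add' := fun φ φ' => Subtype.ext (congrArg (fun ψ => ψ.1) (map_add e ⟨φ.1, _⟩ ⟨φ'.1, _⟩))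
      map_smul' := fun a φ => Subtype.ext (congrArg (fun ψ => ψ.1) (map_smul e a ⟨φ.1, _⟩)) }
  exact ⟨e', fun φ σ => he ⟨φ.1, φ.2.2, fun σ hσ => absurd (Set.mem_univ σ) hσ⟩ σ⟩

/-- The representatives are prescribed at every `g`, so the identity holds for functions before
passing to classes. -/
theorem coboundary_apply_of_forall_exists (hD : IsFundamentalDomain Γ.op D μ)
    (e : ∀ k, twistedCochains X (isomRep π).toRepresentation k ≃ₗ[𝕜]
      twistedCochains X (indRep π hD).toRepresentation k)
    (he : ∀ k φ σ, ∃ f : IndFun π μ D, (∀ g : G, f.toFun g = φ.1 (g⁻¹ • σ)) ∧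
        (e k φ).1 σ = SeparationQuotient.mk f)
    (φ : twistedCochains X (isomRep π).toRepresentation k) :
    e (k + 1) (coboundary (isomRep π).toRepresentation k φ) =
      coboundary (indRep π hD).toRepresentation k (e k φ) := by
  refine Subtype.ext (funext fun σ => ?_)
  obtain ⟨f, hf, hf'⟩ := he (k + 1) (coboundary (isomRep π).toRepresentation k φ) σ
  choose F hF hF' using fun i => he k φ (σ.face i)
  have h1 : f = ∑ i : Fin (k + 2), (-1 : ℤ) ^ (i : ℕ) • F i := by
    refine Subtype.ext (funext fun g => (hf g).trans ?_)
    have h2 : (∑ i : Fin (k + 2), (-1 : ℤ) ^ (i : ℕ) • F i).1 g =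
        ∑ i : Fin (k + 2), (-1 : ℤ) ^ (i : ℕ) • (F i).toFun g := by
      have := map_sum ((LinearMap.proj g : (G → V) →ₗ[𝕜] V) ∘ₗ (indSubmodule π μ D).subtype)
        (fun i : Fin (k + 2) => (-1 : ℤ) ^ (i : ℕ) • F i) Finset.univ
      exact this
    rw [h2]
    simp only [hF]
    rfl
  rw [hf', h1]
  change SeparationQuotient.mkCLM 𝕜 (IndFun π μ D) _ =
    ∑ i : Fin (k + 2), (-1 : ℤ) ^ (i : ℕ) • (e k φ).1 (σ.face i)
  rw [map_sum]
  refine Finset.sum_congr rfl fun i _ => ?_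
  rw [map_zsmul, hF']
  rfl

end Ordered

end Comparison

end L2Shapiro

/-! ### The main theorem. -/

theorem theorem3p4
    {W : Type w} (X : AbstractSimplicialComplex W) (n : ℕ) (c : W → Fin (n + 1))
    (hX_pure : IsPure X n)
    (hX_contractible : ContractibleSpace (Realization X))
    (hX_locallyFinite : IsLocallyFinite X)
    (hc : IsColoring X c)
    {G : Type u} [Group G] [TopologicalSpace G] [IsTopologicalGroup G] [LocallyCompactSpace G]
    [T2Space G] [MeasurableSpace G] [BorelSpace G]
    (μ : Measure G) [μ.IsHaarMeasure] [μ.Regular] [μ.IsMulRightInvariant]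
    [MulAction G W] [SimplicialAction X G]
    (hG : ActsProperlyCocompactly X G)
    (hG_color : ∀ (g : G) (x : W), c (g • x) = c x)
    (hG_trans : TransitiveOnTop X n G)
    (Γ : Subgroup G) [Countable Γ]
    (hΓ : ActsProperlyCocompactly X Γ)
    {𝕜 : Type*} [RCLike 𝕜]
    {V : Type (max u v)} [NormedAddCommGroup V] [NormedSpace 𝕜 V] [CompleteSpace V]
    (π : Γ →* (V ≃ₗᵢ[𝕜] V)) :
    (∃ D : Set G, IsFundamentalDomain Γ.op D μ) ∧
    ∀ (D : Set G) (hD : IsFundamentalDomain Γ.op D μ),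
      (∀ k : ℕ, Nonempty
        (continuousCohomology k (TopRep.of (isomRep π)) ≃ₗ[𝕜]
          continuousCohomology k (TopRep.of (indRep π hD)))) ∧
      ∃ Φ : ∀ k : ℕ, twistedCochains X (isomRep π).toRepresentation k ≃ₗ[𝕜]
          twistedCochains X (indRep π hD).toRepresentation k,
        (∀ (k : ℕ) (φ : twistedCochains X (isomRep π).toRepresentation k),
          Φ (k + 1) (coboundary (isomRep π).toRepresentation k φ) =
            coboundary (indRep π hD).toRepresentation k (Φ k φ)) ∧
        ∀ (k : ℕ) (φ : twistedCochains X (isomRep π).toRepresentation k)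
          (σ : OrderedSimplex X k),
          ∃ f : IndFun π μ D, (∀ g : G, f.toFun g = φ.1 (g⁻¹ • σ)) ∧
            (Φ k φ).1 σ = SeparationQuotient.mk f := by

  obtain ⟨p⟩ : Nonempty (Realization X) := inferInstance
  obtain ⟨x₀, -⟩ := (X.isRelLowerSet_faces p.support_mem).1
  have : LocallyCompactSpace Γ := locallyCompactSpace_of_actsProperlyCocompactly x₀ hΓ
  have : DiscreteTopology Γ := discreteTopology_of_countable Γ
  have : Countable W := countable_vertices_of_countable hΓ
  -- Countability of `Γ` makes the vertex set countable, and this in turn makes `G` σ-compact, as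
  -- the construction of a fundamental domain requires.
  have : SigmaCompactSpace G := sigmaCompactSpace_of_countable_vertices x₀ hG
  obtain ⟨D₀, hD₀, hD₀'⟩ := exists_measurableSet_existsUnique_mul_mem Γ
  refine ⟨⟨D₀, isFundamentalDomain_of_existsUnique hD₀ hD₀' μ⟩, fun D hD => ?_⟩
  obtain ⟨C, hC, hC'⟩ := exists_isCompact_mul_mem hG hΓ x₀
  have hμD : μ D < ⊤ := measure_lt_top_of_isFundamentalDomain hD hC hC'
  refine ⟨fun k => ?_, ?_⟩
  · have : CompleteSpace (IndL2 π μ D) := completeSpace_indL2 hD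
    obtain ⟨e₁⟩ := nonempty_continuousCohomology_equiv_vertBd.{u, v} (isomRep π) hΓ
      hX_pure.1 k
    obtain ⟨e₂⟩ := nonempty_midHomology_vertBd_equiv (π := π) hG hΓ hX_locallyFinite hD hμD k
    obtain ⟨e₃⟩ := nonempty_continuousCohomology_equiv_vertBd.{u, v} (indRep π hD) hG
      hX_pure.1 k
    exact ⟨e₁.trans (e₂.trans e₃.symm)⟩
  · choose Φ hΦ using exists_twistedCochains_equiv (π := π) hG hΓ hX_locallyFinite hD hμD
    exact ⟨Φ, fun k φ => coboundary_apply_of_forall_exists hD Φ hΦ φ, hΦ⟩
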